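/- **Intrinsic Itô formula.** Let $0\le p_0\le d$ be integers, $T_0>0$, $D\subseteq\mathbb R^d$ open and connected, $B$ a real $d\times d$ matrix, and put $Y=\partial_t+\langle Bx,\nabla_x\rangle$ on $\mathbb R\times\mathbb R^d$. *Hörmander condition.* Assume that at every point of $\mathbb R\times\mathbb R^d$ the Lie algebra generated by $\partial_{x_1},\dots,\partial_{x_{p_0}},Y$ has rank $d+1$. *The process.* Let $X=(X_t)_{0\le t<T_0}$ be a continuous $\mathbb R^d$-valued Markov process (for instance a continuous strong Markov process) with transition distribution $p(t,x;T,d\xi)$, i.e. there are a set $\Omega$, $\sigma$-algebras $\mathcal F^t_T$ ($0\le t\le T<T_0$) with $\mathcal F^t_T\subseteq\mathcal F^{t'}_{T'}$ for $t'\le t\le T\le T'$, and probability measures $P_{t,x}$ on $\mathcal F^t_{T_0}:=\sigma(\bigcup_{t\le T<T_0}\mathcal F^t_T)$ such that: $p(t,x;T,\cdot)$ ($0\le t<T<T_0$) are probability measures on $\mathbb R^d$, Borel measurable in $x$, satisfying the Chapman–Kolmogorov identity; $X_T$ is $\mathcal F^t_T$-measurable for $t\le T$; all trajectories are continuous; $P_{t,x}(X_t=x)=1$;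 and $P_{t,x}(X_T\in A\mid\mathcal F^t_s)=p(s,X_s;T,A)$ $P_{t,x}$-a.s. for $t\le s<T<T_0$ and Borel $A$. *Local diffusion.* Let $a_{ij},a_i$ ($1\le i,j\le p_0$) be real Borel functions on $[0,T_0[\times D$, bounded on compact subsets of $[0,T_0[\times D$. For a quantity $g(t,T)$, $\lim_{T-t\to0^+}g(t,T)=\ell$ means that $g(t,t+h)\to\ell$ and, if $t>0$, $g(t-h,t)\to\ell$ as $h\to0^+$. Assume that $X$ is a local diffusion generated on $D$ by $\mathcal A_t=\frac12\sum_{i,j\le p_0}a_{ij}\partial_{x_ix_j}+\sum_{i\le p_0}a_i\partial_{x_i}+\langle Bx,\nabla_x\rangle$, that is, for all $t\in[0,T_0[$, $\delta>0$ and compact $H\subset D$: $$\lim_{T-t\to0^+}\frac{p(t,x;T,\{|\xi-x|>\delta\}\cap H)}{T-t}=0\ \text{ uniformly in }x\in\mathbb R^d,\qquad \lim_{T-t\to0^+}\frac{p(t,x;T,\{|\xi-x|>\delta\})}{T-t}=0\ \text{ uniformly in }x\in H,$$ and, for $i,j=1,\dots,d$ and uniformly in $x\in H$, $$\lim_{T-t\to0^+}\int_{|\xi-x|<\delta}(\xi-x)_i\frac{p(t,x;T,d\xi)}{T-t}=\mathbf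 1_{i\le p_0}a_i(t,x)+(Bx)_i,\qquad \lim_{T-t\to0^+}\int_{|\xi-x|<\delta}(\xi-x)_i(\xi-x)_j\frac{p(t,x;T,d\xi)}{T-t}=\mathbf 1_{i,j\le p_0}a_{ij}(t,x).$$ *Intrinsic Hölder spaces.* For $z=(t,x)$ put $e^{\delta\partial_{x_i}}z=(t,x+\delta e_i)$ ($i\le p_0$) and $e^{\delta Y}z=(t+\delta,e^{\delta B}x)$, and let $\partial_{x_i}f(z)$, $Yf(z)$ be the derivatives of $\delta\mapsto f(e^{\delta\partial_{x_i}}z)$, $\delta\mapsto f(e^{\delta Y}z)$ at $\delta=0$. For $Q$ open and $V\Subset Q$ let $\delta_V=\inf_{z\in V}\delta_z$, where $\delta_z$ is the supremum of the $\bar\delta\in\,]0,1]$ such that all these curves through $z$ stay in $Q$ for $|\delta|\le\bar\delta$. Write $f\in C^{\beta}_{\partial_{x_i}}(Q)$ (resp. $f\in C^{\beta}_Y(Q)$) if for every $V\Subset Q$ the supremum over $z\in V$, $0<|\delta|<\delta_V$ of $|f(e^{\delta\partial_{x_i}}z)-f(z)|/|\delta|^{\beta}$ (resp. $|f(e^{\delta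 Y}z)-f(z)|/|\delta|^{\beta/2}$) is finite. Then $C^{0,\alpha}_B(Q)=C^\alpha_Y(Q)\cap\bigcap_{i\le p_0}C^\alpha_{\partial_{x_i}}(Q)$; $f\in C^{1,\alpha}_B(Q)$ if $f\in C^{1+\alpha}_Y(Q)$ and, for all $i\le p_0$, $\partial_{x_i}f$ exists on $Q$ and is in $C^{0,\alpha}_B(Q)$; $f\in C^{2,\alpha}_B(Q)$ if $Yf$ exists on $Q$ and is in $C^{0,\alpha}_B(Q)$ and, for all $i\le p_0$, $\partial_{x_i}f$ exists on $Q$ and is in $C^{1,\alpha}_B(Q)$. *Conclusion.* Let $(t,x)\in\,]0,T_0[\times\mathbb R^d$, $\alpha\in\,]0,1]$, and let $f\in C^{2,\alpha}_B(]0,T_0[\times D)$ have compact support in $]0,T_0[\times D$ (and be extended by zero). With $\mathcal Lf=\frac12\sum_{i,j\le p_0}a_{ij}\partial_{x_ix_j}f+\sum_{i\le p_0}a_i\partial_{x_i}f+Yf$ (which vanishes off the support of $f$), the process $$M^t_T:=f(T,X_T)-f(t,X_t)-\int_t^T\mathcal Lf(u,X_u)\,du,\qquad t\le T<T_0,$$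 is well defined and is a zero-mean martingale with respect to $(\mathcal F^t_T)_{t\le T<T_0}$ under $P_{t,x}$. Moreover, it is square integrable and, for $t\le T<T_0$, $$E_{t,x}\big[|M^t_T|^2\big]=E_{t,x}\Big[\int_t^T\sum_{i,j=1}^{p_0}a_{ij}(s,X_s)\,\partial_{x_i}f(s,X_s)\,\partial_{x_j}f(s,X_s)\,ds\Big],$$ where both sides are finite. -/

import Mathlib

open MeasureTheory ProbabilityTheory Filter Topology Set
open scoped ENNReal

noncomputable section

/-- `ℝ^d` with the Euclidean norm. -/
abbrev Euc (d : ℕ) : Type := EuclideanSpace ℝ (Fin d)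

/-- The linear operator `x ↦ B x` on `ℝ^d`. -/
def matOp {d : ℕ} (B : Matrix (Fin d) (Fin d) ℝ) : Euc d →L[ℝ] Euc d :=
  Matrix.toEuclideanCLM (n := Fin d) (𝕜 := ℝ) B

/-- The `i`-th canonical basis vector of `ℝ^d`, for `i` among the first `p₀` indices. -/
def basisVec {p₀ d : ℕ} (hp : p₀ ≤ d) (i : Fin p₀) : Euc d :=
  EuclideanSpace.single (Fin.castLE hp i) (1 : ℝ)

/-! ### The Hörmander condition -/

/-- The real Lie algebra of vector fields generated by the family `S`: the smallest real vector
space of vector fields that contains `S` and is closed under Lie brackets. -/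
inductive LieGenerated {V : Type*} [NormedAddCommGroup V] [NormedSpace ℝ V] (S : Set (V → V)) :
    (V → V) → Prop
  | of (v : V → V) (hv : v ∈ S) : LieGenerated S v
  | zero : LieGenerated S 0
  | add (v w : V → V) (hv : LieGenerated S v) (hw : LieGenerated S w) : LieGenerated S (v + w)
  | smul (c : ℝ) (v : V → V) (hv : LieGenerated S v) : LieGenerated S (c • v)
  | bracket (v w : V → V) (hv : LieGenerated S v) (hw : LieGenerated S w) :
      LieGenerated S (VectorField.lieBracket ℝ v w)

/-- The vector field `∂_{x_i}` on `ℝ × ℝ^d`. -/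
def fieldDx {p₀ d : ℕ} (hp : p₀ ≤ d) (i : Fin p₀) : ℝ × Euc d → ℝ × Euc d :=
  fun _ => (0, basisVec hp i)

/-- The vector field `Y = ∂_t + ⟨Bx, ∇_x⟩` on `ℝ × ℝ^d`. -/
def fieldY {d : ℕ} (B : Matrix (Fin d) (Fin d) ℝ) : ℝ × Euc d → ℝ × Euc d :=
  fun z => (1, matOp B z.2)

/-- Hörmander's condition for `∂_{x_1}, …, ∂_{x_{p₀}}, Y`: at every point of `ℝ × ℝ^d` the Lie
algebra they generate has full rank `d + 1`. -/
def HormanderCondition {p₀ d : ℕ} (hp : p₀ ≤ d) (B : Matrix (Fin d) (Fin d) ℝ) : Prop :=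
  ∀ z : ℝ × Euc d,
    Module.finrank ℝ (Submodule.span ℝ
      ((fun v : ℝ × Euc d → ℝ × Euc d => v z) ''
        {v | LieGenerated (Set.range (fieldDx hp) ∪ {fieldY B}) v})) = d + 1

/-! ### Intrinsic Hölder spaces -/

/-- The integral curve `δ ↦ (t, x + δ e_i)` of `∂_{x_i}`. -/
def flowDx {p₀ d : ℕ} (hp : p₀ ≤ d) (i : Fin p₀) (δ : ℝ) (z : ℝ × Euc d) : ℝ × Euc d :=
  (z.1, z.2 + δ • basisVec hp i)

/-- The integral curve `δ ↦ (t + δ, e^{δB} x)` of `Y`. -/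
def flowY {d : ℕ} (B : Matrix (Fin d) (Fin d) ℝ) (δ : ℝ) (z : ℝ × Euc d) : ℝ × Euc d :=
  (z.1 + δ, NormedSpace.exp (δ • matOp B) z.2)

/-- The radius `δ_z ∈ ]0,1]` up to which all the integral curves through `z` remain in `Q`. -/
def radiusAt {p₀ d : ℕ} (hp : p₀ ≤ d) (B : Matrix (Fin d) (Fin d) ℝ) (Q : Set (ℝ × Euc d))
    (z : ℝ × Euc d) : ℝ :=
  sSup {r : ℝ | r ∈ Ioc (0 : ℝ) 1 ∧
    ∀ δ ∈ Icc (-r) r, (∀ i : Fin p₀, flowDx hp i δ z ∈ Q) ∧ flowY B δ z ∈ Q}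

/-- `δ_V = inf_{z ∈ V} δ_z`. -/
def radiusOn {p₀ d : ℕ} (hp : p₀ ≤ d) (B : Matrix (Fin d) (Fin d) ℝ) (Q V : Set (ℝ × Euc d)) : ℝ :=
  sInf (radiusAt hp B Q '' V)

/-- For each `V ⋐ Q`, the difference quotients of order `β` of `f` along the flow `φ` are bounded
over base points in `V` and increments `0 < |δ| < δ_V`. -/
def HolderAlong {p₀ d : ℕ} (hp : p₀ ≤ d) (B : Matrix (Fin d) (Fin d) ℝ) (Q : Set (ℝ × Euc d))
    (φ : ℝ → ℝ × Euc d → ℝ × Euc d) (β : ℝ) (f : ℝ × Euc d → ℝ) : Prop :=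
  ∀ V : Set (ℝ × Euc d), IsCompact (closure V) → closure V ⊆ Q →
    ∃ C : ℝ, ∀ z ∈ V, ∀ δ : ℝ, 0 < |δ| → |δ| < radiusOn hp B Q V →
      |f (φ δ z) - f z| / |δ| ^ β ≤ C

/-- `f ∈ C^α_{∂_{x_i}}(Q)`. -/
def HolderDx {p₀ d : ℕ} (hp : p₀ ≤ d) (B : Matrix (Fin d) (Fin d) ℝ) (Q : Set (ℝ × Euc d))
    (i : Fin p₀) (α : ℝ) (f : ℝ × Euc d → ℝ) : Prop :=
  HolderAlong hp B Q (flowDx hp i) α f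

/-- `f ∈ C^α_Y(Q)`: the exponent of the increment is `α / 2`. -/
def HolderY {p₀ d : ℕ} (hp : p₀ ≤ d) (B : Matrix (Fin d) (Fin d) ℝ) (Q : Set (ℝ × Euc d))
    (α : ℝ) (f : ℝ × Euc d → ℝ) : Prop :=
  HolderAlong hp B Q (flowY B) (α / 2) f

/-- The derivative `∂_{x_i} f`. -/
def derivDx {p₀ d : ℕ} (hp : p₀ ≤ d) (i : Fin p₀) (f : ℝ × Euc d → ℝ) : ℝ × Euc d → ℝ :=
  fun z => deriv (fun δ : ℝ => f (flowDx hp i δ z)) 0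

/-- The Lie derivative `Y f`. -/
def derivY {d : ℕ} (B : Matrix (Fin d) (Fin d) ℝ) (f : ℝ × Euc d → ℝ) : ℝ × Euc d → ℝ :=
  fun z => deriv (fun δ : ℝ => f (flowY B δ z)) 0

/-- `∂_{x_i} f` exists at every point of `Q`. -/
def HasDx {p₀ d : ℕ} (hp : p₀ ≤ d) (Q : Set (ℝ × Euc d)) (i : Fin p₀) (f : ℝ × Euc d → ℝ) : Prop :=
  ∀ z ∈ Q, DifferentiableAt ℝ (fun δ : ℝ => f (flowDx hp i δ z)) 0

/-- `Y f` exists at every point of `Q`. -/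
def HasY {d : ℕ} (B : Matrix (Fin d) (Fin d) ℝ) (Q : Set (ℝ × Euc d)) (f : ℝ × Euc d → ℝ) : Prop :=
  ∀ z ∈ Q, DifferentiableAt ℝ (fun δ : ℝ => f (flowY B δ z)) 0

/-- The intrinsic Hölder space `C^{n,α}_B(Q)`. -/
def IntrinsicHolder {p₀ d : ℕ} (hp : p₀ ≤ d) (B : Matrix (Fin d) (Fin d) ℝ) (Q : Set (ℝ × Euc d))
    (α : ℝ) : ℕ → (ℝ × Euc d → ℝ) → Prop
  | 0, f => HolderY hp B Q α f ∧ ∀ i : Fin p₀, HolderDx hp B Q i α f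
  | 1, f => HolderY hp B Q (1 + α) f ∧
      ∀ i : Fin p₀, HasDx hp Q i f ∧ IntrinsicHolder hp B Q α 0 (derivDx hp i f)
  | n + 2, f => (HasY B Q f ∧ IntrinsicHolder hp B Q α n (derivY B f)) ∧
      ∀ i : Fin p₀, HasDx hp Q i f ∧ IntrinsicHolder hp B Q α (n + 1) (derivDx hp i f)

/-! ### The operator -/

/-- `𝓛 f = ½ ∑ a_{ij} ∂_{x_i x_j} f + ∑ a_i ∂_{x_i} f + Y f`; here `b i` is the first order
coefficient `a_i`. -/
def opL {p₀ d : ℕ} (hp : p₀ ≤ d) (B : Matrix (Fin d) (Fin d) ℝ)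
    (a : Fin p₀ → Fin p₀ → ℝ × Euc d → ℝ) (b : Fin p₀ → ℝ × Euc d → ℝ)
    (f : ℝ × Euc d → ℝ) (z : ℝ × Euc d) : ℝ :=
  (1 / 2 : ℝ) * ∑ i, ∑ j, a i j z * derivDx hp i (derivDx hp j f) z
    + ∑ i, b i z * derivDx hp i f z + derivY B f z

/-- `∑ a_{ij} ∂_{x_i} f ∂_{x_j} f`. -/
def energyDensity {p₀ d : ℕ} (hp : p₀ ≤ d) (a : Fin p₀ → Fin p₀ → ℝ × Euc d → ℝ)
    (f : ℝ × Euc d → ℝ) (z : ℝ × Euc d) : ℝ :=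
  ∑ i, ∑ j, a i j z * derivDx hp i f z * derivDx hp j f z

/-! ### Continuous Markov processes and local diffusions -/

/-- `𝓕^t_{T₀}`, the σ-algebra generated by all the `𝓕^t_T`, `t ≤ T < T₀`. -/
abbrev sigmaFrom {Ω : Type*} (F : ℝ → ℝ → MeasurableSpace Ω) (T₀ t : ℝ) : MeasurableSpace Ω :=
  ⨆ T ∈ Ico t T₀, F t T

/-- An `ℝ^d`-valued Markov process `(X_t)_{0 ≤ t < T₀}` with continuous trajectories and transition
distribution `p(t,x;T,·) = p t T x`, on a space `(Ω, (𝓕^t_T), (P_{t,x}))`. The measure `P_{t,x}` is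
defined on `𝓕^t_{T₀}`. Only indices with `0 ≤ t ≤ T < T₀` are meaningful. -/
structure ContMarkovProcess (d : ℕ) (T₀ : ℝ) (Ω : Type*) where
  /-- transition distribution -/
  p : ℝ → ℝ → Kernel (Euc d) (Euc d)
  /-- the σ-algebras `𝓕^t_T` -/
  F : ℝ → ℝ → MeasurableSpace Ω
  /-- the probability measures `P_{t,x}` -/
  P : (t : ℝ) → Euc d → @Measure Ω (sigmaFrom F T₀ t)
  /-- the process -/
  X : ℝ → Ω → Euc d
  isMarkovKernel : ∀ t T, 0 ≤ t → t < T → T < T₀ → IsMarkovKernel (p t T)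
  chapmanKolmogorov : ∀ t s T, 0 ≤ t → t < s → s < T → T < T₀ →
    ∀ (x : Euc d) (A : Set (Euc d)), MeasurableSet A →
      p t T x A = ∫⁻ ξ, p s T ξ A ∂(p t s x)
  mono : ∀ t' t T T', 0 ≤ t' → t' ≤ t → t ≤ T → T ≤ T' → T' < T₀ → F t T ≤ F t' T'
  adapted : ∀ t T, 0 ≤ t → t ≤ T → T < T₀ → Measurable[F t T] (X T)
  isProbability : ∀ t x, 0 ≤ t → t < T₀ → IsProbabilityMeasure (P t x)
  initial : ∀ t x, 0 ≤ t → t < T₀ → P t x {ω | X t ω = x} = 1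
  markov : ∀ t x s T, 0 ≤ t → t ≤ s → s < T → T < T₀ →
    ∀ A : Set (Euc d), MeasurableSet A →
      (P t x)⟦X T ⁻¹' A | F t s⟧ =ᵐ[P t x] fun ω => (p s T (X s ω)).real A
  continuous_paths : ∀ ω, ContinuousOn (fun t => X t ω) (Ico 0 T₀)

/-- The filtration `𝓕^t = (𝓕^t_T)_{t ≤ T < T₀}`. -/
def ContMarkovProcess.filtration {d : ℕ} {T₀ : ℝ} {Ω : Type*} (M : ContMarkovProcess d T₀ Ω)
    (t : ℝ) (ht : 0 ≤ t) : Filtration (Ico t T₀) (sigmaFrom M.F T₀ t) where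
  seq T := M.F t T
  mono' T T' h := M.mono t t T T' ht le_rfl T.2.1 h T'.2.2
  le' T := le_iSup₂_of_le (f := fun T (_ : T ∈ Ico t T₀) => M.F t T) T.1 T.2 le_rfl

/-- `lim_{T-t → 0⁺} φ(t,T,x) = g(x)` uniformly w.r.t. `x ∈ S`: both `φ(t,t+h,x)` and (if `t > 0`)
`φ(t-h,t,x)` converge to `g(x)` as `h → 0⁺`, uniformly w.r.t. `x ∈ S`. -/
def UnifLimAt {d : ℕ} (φ : ℝ → ℝ → Euc d → ℝ) (g : Euc d → ℝ) (t : ℝ) (S : Set (Euc d)) : Prop :=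
  TendstoUniformlyOn (fun (h : ℝ) x => φ t (t + h) x) g (𝓝[>] 0) S ∧
  (0 < t → TendstoUniformlyOn (fun (h : ℝ) x => φ (t - h) t x) g (𝓝[>] 0) S)

/-- A Borel function on `[0,T₀[ × D` that is bounded on compact subsets of `[0,T₀[ × D`. -/
def LocBounded {d : ℕ} (T₀ : ℝ) (D : Set (Euc d)) (c : ℝ × Euc d → ℝ) : Prop :=
  Measurable ((Ico 0 T₀ ×ˢ D).domRestrict c) ∧
  ∀ K : Set (ℝ × Euc d), IsCompact K → K ⊆ Ico 0 T₀ ×ˢ D → ∃ C : ℝ, ∀ z ∈ K, |c z| ≤ C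

/-- `M` is a local diffusion generated on `D` by
`𝓐_t = ½ ∑ a_{ij} ∂_{x_i x_j} + ∑ b_i ∂_{x_i} + ⟨Bx, ∇_x⟩`. -/
structure IsLocalDiffusion {p₀ d : ℕ} (hp : p₀ ≤ d) {T₀ : ℝ} {Ω : Type*}
    (M : ContMarkovProcess d T₀ Ω) (D : Set (Euc d)) (B : Matrix (Fin d) (Fin d) ℝ)
    (a : Fin p₀ → Fin p₀ → ℝ × Euc d → ℝ) (b : Fin p₀ → ℝ × Euc d → ℝ) : Prop where
  locBounded_a : ∀ i j, LocBounded T₀ D (a i j)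
  locBounded_b : ∀ i, LocBounded T₀ D (b i)
  lim_jump_into : ∀ t, 0 ≤ t → t < T₀ → ∀ δ : ℝ, 0 < δ → ∀ H : Set (Euc d), IsCompact H → H ⊆ D →
    UnifLimAt (fun t T x => (M.p t T x).real ({ξ | δ < ‖ξ - x‖} ∩ H) / (T - t))
      (fun _ => 0) t univ
  lim_jump_from : ∀ t, 0 ≤ t → t < T₀ → ∀ δ : ℝ, 0 < δ → ∀ H : Set (Euc d), IsCompact H → H ⊆ D →
    UnifLimAt (fun t T x => (M.p t T x).real {ξ | δ < ‖ξ - x‖} / (T - t))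
      (fun _ => 0) t H
  lim_drift : ∀ t, 0 ≤ t → t < T₀ → ∀ δ : ℝ, 0 < δ → ∀ H : Set (Euc d), IsCompact H → H ⊆ D →
    ∀ i : Fin d,
    UnifLimAt (fun t T x => (∫ ξ in {ξ | ‖ξ - x‖ < δ}, (ξ - x) i ∂(M.p t T x)) / (T - t))
      (fun x => (if h : (i : ℕ) < p₀ then b ⟨i, h⟩ (t, x) else 0) + matOp B x i) t H
  lim_diffusion : ∀ t, 0 ≤ t → t < T₀ → ∀ δ : ℝ, 0 < δ → ∀ H : Set (Euc d), IsCompact H → H ⊆ D →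
    ∀ i j : Fin d,
    UnifLimAt
      (fun t T x => (∫ ξ in {ξ | ‖ξ - x‖ < δ}, (ξ - x) i * (ξ - x) j ∂(M.p t T x)) / (T - t))
      (fun x => if h : (i : ℕ) < p₀ ∧ (j : ℕ) < p₀ then a ⟨i, h.1⟩ ⟨j, h.2⟩ (t, x) else 0) t H

/-- `M^t_T = f(T,X_T) - f(t,X_t) - ∫_t^T 𝓛f(u,X_u) du`. -/
def itoRemainder {p₀ d : ℕ} (hp : p₀ ≤ d) {T₀ : ℝ} {Ω : Type*} (M : ContMarkovProcess d T₀ Ω)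
    (B : Matrix (Fin d) (Fin d) ℝ) (a : Fin p₀ → Fin p₀ → ℝ × Euc d → ℝ)
    (b : Fin p₀ → ℝ × Euc d → ℝ) (f : ℝ × Euc d → ℝ) (t T : ℝ) (ω : Ω) : ℝ :=
  f (T, M.X T ω) - f (t, M.X t ω) - ∫ u in t..T, opL hp B a b f (u, M.X u ω)

end

/-!
Translation by `c e^{δB} e_i` is the flow of `c ∂_{x_i}` conjugated by that of `δ Y`, and under
Hörmander's condition the vectors `e^{δB} e_i` with small `δ` span `ℝ^d`. Hölder regularity along
the fields is therefore genuine continuity of `f`, `∂_i f`, `∂_i ∂_j f` and `Y f`, although `f` need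
not be differentiable in the remaining space directions or in time. Averaging the translates
`f (t, x - e^{tB} y)`, whose translations commute with the fields, approximates `f` by functions
smooth in `x` with the same intrinsic regularity. For these, the limits defining a local diffusion
and the Markov property at time `s` give the right derivative `E[W 𝓛f(s, X_s)]` of
`s ↦ E[W f(s, X_s)]` for bounded `W` in the past. The resulting Dynkin formula passes to the limit
in the approximation, and being valid for all `W` it is the martingale property.

The square `f²` is of the same class and `𝓛(f²) = 2 f 𝓛f + ∑ a_ij ∂_i f ∂_j f`. Expanding the square
of `M_T` and applying Dynkin's formula to `f²`, and to `f` with the weights `f(t, X_t)` and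
`𝓛f(u, X_u)`, leaves only the integral of `∑ a_ij ∂_i f ∂_j f`.
-/

/-! ### Derivatives along flows -/

section DerivAlong

variable {Z E : Type*} [TopologicalSpace Z] [NormedAddCommGroup E] [NormedSpace ℝ E]
  {φ : Flow ℝ Z}

/-- `f` is differentiable along the flow `φ` at every point, with Lie derivative `g`. -/
def HasDerivAlong (φ : Flow ℝ Z) (f g : Z → E) : Prop :=
  ∀ z, HasDerivAt (fun δ => f (φ δ z)) (g z) 0

/-- The increments of `g` along the flow `φ` tend to `0` uniformly in the base point. -/
def UnifContAlong {F : Type*} [UniformSpace F] (φ : Flow ℝ Z) (g : Z → F) : Prop :=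
  TendstoUniformly (fun δ z => g (φ δ z)) g (𝓝 0)

theorem HasDerivAlong.hasDerivAt {f g : Z → E} (h : HasDerivAlong φ f g) (z : Z) (δ : ℝ) :
    HasDerivAt (fun η => f (φ η z)) (g (φ δ z)) δ := by
  have shifted : HasDerivAt (fun η => f (φ η (φ δ z))) (g (φ δ z)) (δ - δ) := by
    simpa using h (φ δ z)
  simpa [← φ.map_add] using shifted.comp_sub_const δ δ

theorem HasDerivAlong.norm_sub_le {f g : Z → E} (h : HasDerivAlong φ f g) {C : ℝ}
    (hC : ∀ z, ‖g z‖ ≤ C) (δ : ℝ) (z : Z) : ‖f (φ δ z) - f z‖ ≤ C * |δ| := by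
  simpa [φ.map_zero_apply] using Convex.norm_image_sub_le_of_norm_hasDerivWithin_le (s := univ)
    (f := fun η => f (φ η z)) (x := 0) (y := δ)
    (fun η _ => (h.hasDerivAt z η).hasDerivWithinAt) (fun η _ => hC _) convex_univ trivial trivial

theorem HasDerivAlong.unifContAlong {f g : Z → E} (h : HasDerivAlong φ f g) {C : ℝ}
    (hC : ∀ z, ‖g z‖ ≤ C) : UnifContAlong φ f := by
  rw [UnifContAlong, Metric.tendstoUniformly_iff]
  intro ε hε
  have small : ∀ᶠ δ : ℝ in 𝓝 0, C * |δ| < ε :=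
    Continuous.tendsto' (by fun_prop) 0 0 (by simp) |>.eventually_lt_const hε
  filter_upwards [small] with δ hδ z
  rw [dist_comm, dist_eq_norm]
  exact (h.norm_sub_le hC δ z).trans_lt hδ

theorem HasDerivAlong.mul {𝔸 : Type*} [NormedRing 𝔸] [NormedAlgebra ℝ 𝔸] {f g f' g' : Z → 𝔸}
    (hf : HasDerivAlong φ f f') (hg : HasDerivAlong φ g g') :
    HasDerivAlong φ (fun z => f z * g z) fun z => f' z * g z + f z * g' z := fun z => by
  simpa [φ.map_zero_apply] using (hf z).fun_mul (hg z)

/-- Increments that enter or leave `K` are increments of the reversed flow issued from `K`. -/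
theorem unifContAlong_of_tendstoUniformlyOn {F : Type*} [PseudoMetricSpace F] [Zero F] {g : Z → F}
    {K : Set Z} (hg : ∀ z ∉ K, g z = 0)
    (h : TendstoUniformlyOn (fun δ z => g (φ δ z)) g (𝓝 0) K) : UnifContAlong φ g := by
  rw [UnifContAlong, Metric.tendstoUniformly_iff]
  rw [Metric.tendstoUniformlyOn_iff] at h
  intro ε hε
  have reversed := (Continuous.tendsto' continuous_neg (0 : ℝ) 0 neg_zero).eventually (h ε hε)
  filter_upwards [h ε hε, reversed] with δ hδ hδ' z
  by_cases hz : z ∈ K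
  · exact hδ z hz
  by_cases hz' : φ δ z ∈ K
  · simpa [← φ.map_add, φ.map_zero_apply, dist_comm] using hδ' _ hz'
  · simpa [hg _ hz, hg _ hz'] using hε

theorem unifContAlong_of_holder {g : Z → ℝ} {K : Set Z} (hg : ∀ z ∉ K, g z = 0) {C β r : ℝ}
    (hβ : 0 < β) (hr : 0 < r)
    (h : ∀ z ∈ K, ∀ δ : ℝ, 0 < |δ| → |δ| < r → |g (φ δ z) - g z| / |δ| ^ β ≤ C) :
    UnifContAlong φ g := by
  refine unifContAlong_of_tendstoUniformlyOn hg (Metric.tendstoUniformlyOn_iff.2 fun ε hε => ?_)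
  have hlim : Tendsto (fun δ : ℝ => C * |δ| ^ β) (𝓝 0) (𝓝 0) := by
    have : Continuous fun δ : ℝ => C * |δ| ^ β :=
      continuous_const.mul (continuous_abs.rpow_const fun _ => Or.inr hβ.le)
    exact this.tendsto' 0 0 (by simp [Real.zero_rpow hβ.ne'])
  have small : ∀ᶠ δ : ℝ in 𝓝 0, |δ| < r := by
    simpa using continuous_abs.continuousAt.eventually_lt_const (by simpa using hr)
  filter_upwards [hlim.eventually_lt_const hε, small] with δ hδ hδr z hz
  rcases eq_or_ne δ 0 with rfl | hδ0
  · simpa [φ.map_zero_apply] using hε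
  · have hδ0 : 0 < |δ| := abs_pos.2 hδ0
    rw [dist_comm, Real.dist_eq]
    exact ((div_le_iff₀ (Real.rpow_pos_of_pos hδ0 β)).1 (h z hz δ hδ0 hδr)).trans_lt hδ

theorem eventuallyEq_zero_along {F : Type*} [Zero F] (φ : Flow ℝ Z) {f : Z → F} {K : Set Z}
    (hK : IsClosed K) (hf : ∀ z ∉ K, f z = 0) {z : Z} (hz : z ∉ K) :
    (fun δ => f (φ δ z)) =ᶠ[𝓝 0] fun _ => 0 := by
  have outside : ∀ᶠ δ in 𝓝 (0 : ℝ), φ δ z ∈ Kᶜ :=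
    (φ.continuous continuous_id continuous_const).continuousAt.eventually_mem
      (hK.isOpen_compl.mem_nhds (by simpa [φ.map_zero_apply] using hz))
  filter_upwards [outside] with δ hδ using hf _ hδ

theorem deriv_along_eq_zero (φ : Flow ℝ Z) {f : Z → E} {K : Set Z} (hK : IsClosed K)
    (hf : ∀ z ∉ K, f z = 0) {z : Z} (hz : z ∉ K) : deriv (fun δ => f (φ δ z)) 0 = 0 := by
  rw [(eventuallyEq_zero_along φ hK hf hz).deriv_eq, deriv_const]

theorem hasDerivAlong_of_eq_zero_off (φ : Flow ℝ Z) {f : Z → E} {K Q : Set Z} (hK : IsClosed K)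
    (hKQ : K ⊆ Q) (hf : ∀ z ∉ K, f z = 0)
    (h : ∀ z ∈ Q, DifferentiableAt ℝ (fun δ : ℝ => f (φ δ z)) 0) :
    HasDerivAlong φ f fun z => deriv (fun δ => f (φ δ z)) 0 := by
  intro z
  by_cases hz : z ∈ K
  · exact (h z (hKQ hz)).hasDerivAt
  · exact ((differentiableAt_const (0 : E)).congr_of_eventuallyEq
      (eventuallyEq_zero_along φ hK hf hz)).hasDerivAt

end DerivAlong

theorem exp_add_smul {𝔸 : Type*} [NormedRing 𝔸] [NormedAlgebra ℝ 𝔸] [CompleteSpace 𝔸] (A : 𝔸)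
    (δ η : ℝ) :
    NormedSpace.exp ((δ + η) • A) = NormedSpace.exp (δ • A) * NormedSpace.exp (η • A) := by
  let _ : NormedAlgebra ℚ 𝔸 := NormedAlgebra.restrictScalars ℚ ℝ 𝔸
  rw [add_smul, NormedSpace.exp_add_of_commute]
  exact ((Commute.refl A).smul_left δ).smul_right η

section Flows

variable {p₀ d : ℕ} (hp : p₀ ≤ d) (B : Matrix (Fin d) (Fin d) ℝ)

/-- The one-parameter group `e^{δB}` of linear operators on `ℝ^d`. -/
noncomputable def expB (δ : ℝ) : Euc d →L[ℝ] Euc d := NormedSpace.exp (δ • matOp B)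

@[simp] theorem expB_zero : expB B 0 = 1 := by
  rw [expB, show (0 : ℝ) • matOp B = 0 from zero_smul ℝ (matOp B), NormedSpace.exp_zero]

theorem expB_add (δ η : ℝ) : expB B (δ + η) = expB B δ * expB B η :=
  exp_add_smul (matOp B) δ η

theorem expB_add_apply (δ η : ℝ) (x : Euc d) : expB B (δ + η) x = expB B δ (expB B η x) := by
  rw [expB_add]; rfl

@[simp] theorem expB_apply_neg (δ : ℝ) (x : Euc d) : expB B δ (expB B (-δ) x) = x := by
  simp [← expB_add_apply]

theorem hasDerivAt_expB (δ : ℝ) : HasDerivAt (expB B) (matOp B * expB B δ) δ :=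
  hasDerivAt_exp_smul_const' (𝕂 := ℝ) (matOp B) δ

@[fun_prop]
theorem continuous_expB : Continuous (expB B) :=
  continuous_iff_continuousAt.2 fun δ => (hasDerivAt_expB B δ).continuousAt

theorem flowY_eq (δ : ℝ) (z : ℝ × Euc d) : flowY B δ z = (z.1 + δ, expB B δ z.2) := rfl

/-- `flowY`, the flow of `Y = ∂_t + ⟨Bx, ∇_x⟩`, bundled. -/
noncomputable def yFlow : Flow ℝ (ℝ × Euc d) where
  toFun := flowY B
  cont' := by
    change Continuous fun q : ℝ × (ℝ × Euc d) => (q.2.1 + q.1, expB B q.1 q.2.2)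
    fun_prop
  map_add' δ η z := by
    simp only [flowY_eq, expB_add_apply, Prod.mk.injEq, and_true]; ring
  map_zero' z := by simp [flowY_eq]

/-- `flowDx`, the flow of `∂_{x_i}`, bundled. -/
noncomputable def dxFlow (i : Fin p₀) : Flow ℝ (ℝ × Euc d) where
  toFun := flowDx hp i
  cont' := by
    change Continuous fun q : ℝ × (ℝ × Euc d) => (q.2.1, q.2.2 + q.1 • basisVec hp i)
    fun_prop
  map_add' δ η z := by
    simp only [flowDx, Prod.mk.injEq, true_and, add_smul]; abel
  map_zero' z := by simp [flowDx]

theorem yFlow_apply (δ : ℝ) (z : ℝ × Euc d) : yFlow B δ z = (z.1 + δ, expB B δ z.2) := rfl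

theorem dxFlow_apply (i : Fin p₀) (δ : ℝ) (z : ℝ × Euc d) :
    dxFlow hp i δ z = (z.1, z.2 + δ • basisVec hp i) := rfl

variable {hp B}

theorem HasDerivAlong.derivDx_eq {i : Fin p₀} {f g : ℝ × Euc d → ℝ}
    (h : HasDerivAlong (dxFlow hp i) f g) : derivDx hp i f = g := funext fun z => (h z).deriv

theorem HasDerivAlong.derivY_eq {f g : ℝ × Euc d → ℝ}
    (h : HasDerivAlong (yFlow B) f g) : derivY B f = g := funext fun z => (h z).deriv

theorem derivDx_eq_zero_off {f : ℝ × Euc d → ℝ} {K : Set (ℝ × Euc d)} (hK : IsClosed K)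
    (hf : ∀ z ∉ K, f z = 0) (i : Fin p₀) : ∀ z ∉ K, derivDx hp i f z = 0 := fun _ hz =>
  deriv_along_eq_zero (dxFlow hp i) hK hf hz

theorem derivY_eq_zero_off {f : ℝ × Euc d → ℝ} {K : Set (ℝ × Euc d)} (hK : IsClosed K)
    (hf : ∀ z ∉ K, f z = 0) : ∀ z ∉ K, derivY B f z = 0 := fun _ hz =>
  deriv_along_eq_zero (yFlow B) hK hf hz

end Flows

/-! ### Hörmander's condition and controllability -/

section Kalman

variable {p₀ d : ℕ} {hp : p₀ ≤ d} {B : Matrix (Fin d) (Fin d) ℝ}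

/-- The span of the vectors `B^k e_i`, `i ≤ p₀`, which is the range of Kalman's controllability
matrix. -/
def kalmanSpace (hp : p₀ ≤ d) (B : Matrix (Fin d) (Fin d) ℝ) : Submodule ℝ (Euc d) :=
  Submodule.span ℝ {v | ∃ (k : ℕ) (i : Fin p₀), v = (matOp B ^ k) (basisVec hp i)}

theorem matOp_mem_kalmanSpace {w : Euc d} (hw : w ∈ kalmanSpace hp B) :
    matOp B w ∈ kalmanSpace hp B := by
  unfold kalmanSpace at hw
  induction hw using Submodule.span_induction with
  | mem v hv =>
    obtain ⟨k, i, rfl⟩ := hv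
    exact Submodule.subset_span ⟨k + 1, i, by rw [pow_succ']; rfl⟩
  | zero => simp
  | add u v _ _ hu hv => rw [map_add]; exact add_mem hu hv
  | smul c v _ hv => rw [map_smul]; exact Submodule.smul_mem _ _ hv

/-- The vector field `c Y + ⟨w, ∇_x⟩`. -/
noncomputable def affineField (B : Matrix (Fin d) (Fin d) ℝ) (c : ℝ) (w : Euc d)
    (z : ℝ × Euc d) : ℝ × Euc d :=
  (c, c • matOp B z.2 + w)

theorem fderiv_affineField (c : ℝ) (w : Euc d) (z u : ℝ × Euc d) :
    fderiv ℝ (affineField B c w) z u = (0, c • matOp B u.2) := by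
  have space : HasFDerivAt (fun z : ℝ × Euc d => c • matOp B z.2 + w)
      (c • (matOp B).comp (ContinuousLinearMap.snd ℝ ℝ (Euc d))) z :=
    (((matOp B).comp (ContinuousLinearMap.snd ℝ ℝ (Euc d))).hasFDerivAt.const_smul c).add_const w
  have full : HasFDerivAt (affineField B c w) _ z := (hasFDerivAt_const c z).prodMk space
  simp [full.fderiv]

theorem lieBracket_affineField (c c' : ℝ) (w w' : Euc d) :
    VectorField.lieBracket ℝ (affineField B c w) (affineField B c' w') =
      affineField B 0 (c' • matOp B w - c • matOp B w') := by
  funext z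
  rw [VectorField.lieBracket, fderiv_affineField, fderiv_affineField]
  refine Prod.ext (by simp [affineField]) ?_
  simp only [affineField, Prod.mk_sub_mk, map_add, map_smul, zero_smul, zero_add, smul_add]
  rw [smul_comm c c']
  abel

theorem LieGenerated.exists_eq_affineField {v : ℝ × Euc d → ℝ × Euc d}
    (h : LieGenerated (Set.range (fieldDx hp) ∪ {fieldY B}) v) :
    ∃ c : ℝ, ∃ w ∈ kalmanSpace hp B, v = affineField B c w := by
  induction h with
  | of v hv =>
    rcases hv with ⟨i, rfl⟩ | rfl
    · exact ⟨0, basisVec hp i, Submodule.subset_span ⟨0, i, by simp⟩,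
        by ext z <;> simp [fieldDx, affineField]⟩
    · exact ⟨1, 0, zero_mem _, by ext z <;> simp [fieldY, affineField]⟩
  | zero => exact ⟨0, 0, zero_mem _, by ext z <;> simp [affineField]⟩
  | add v w _ _ hv hw =>
    obtain ⟨c, u, hu, rfl⟩ := hv
    obtain ⟨c', u', hu', rfl⟩ := hw
    exact ⟨c + c', u + u', add_mem hu hu', by ext z <;> simp [affineField]; ring⟩
  | smul k v _ hv =>
    obtain ⟨c, u, hu, rfl⟩ := hv
    exact ⟨k * c, k • u, Submodule.smul_mem _ _ hu, by ext z <;> simp [affineField]; ring⟩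
  | bracket v w _ _ hv hw =>
    obtain ⟨c, u, hu, rfl⟩ := hv
    obtain ⟨c', u', hu', rfl⟩ := hw
    exact ⟨0, _, sub_mem (Submodule.smul_mem _ _ (matOp_mem_kalmanSpace hu))
      (Submodule.smul_mem _ _ (matOp_mem_kalmanSpace hu')), lieBracket_affineField c c' u u'⟩

theorem HormanderCondition.kalmanSpace_eq_top (h : HormanderCondition hp B) :
    kalmanSpace hp B = ⊤ := by
  have fields_at_zero : Submodule.span ℝ ((fun v : ℝ × Euc d → ℝ × Euc d => v 0) ''
      {v | LieGenerated (Set.range (fieldDx hp) ∪ {fieldY B}) v}) ≤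
      (⊤ : Submodule ℝ ℝ).prod (kalmanSpace hp B) := by
    rw [Submodule.span_le]
    rintro _ ⟨v, hv, rfl⟩
    obtain ⟨c, w, hw, rfl⟩ := LieGenerated.exists_eq_affineField hv
    simpa [affineField] using hw
  rw [Submodule.eq_top_of_finrank_eq ((h 0).trans (by simp [add_comm])), top_le_iff]
    at fields_at_zero
  refine eq_top_iff.2 fun w _ => ?_
  have : ((0 : ℝ), w) ∈ (⊤ : Submodule ℝ ℝ).prod (kalmanSpace hp B) :=
    fields_at_zero ▸ Submodule.mem_top
  exact this.2

theorem hasDerivAt_clm_expB_apply (L : Euc d →L[ℝ] ℝ) (v : Euc d) (δ : ℝ) :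
    HasDerivAt (fun η => L (expB B η v)) (L (matOp B (expB B δ v))) δ :=
  (L.comp (ContinuousLinearMap.apply ℝ (Euc d) v)).hasFDerivAt.comp_hasDerivAt δ
    (hasDerivAt_expB B δ)

/-- A linear form vanishing on `e^{δB} e_i` for small `δ` vanishes on all derivatives `B^k e_i`. -/
theorem HormanderCondition.span_expB_eq_top (h : HormanderCondition hp B) {ρ : ℝ} (hρ : 0 < ρ) :
    Submodule.span ℝ {v : Euc d | ∃ δ : ℝ, |δ| < ρ ∧ ∃ i : Fin p₀, v = expB B δ (basisVec hp i)}
      = ⊤ := by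
  by_contra hne
  obtain ⟨l, hl0, hl⟩ := Submodule.exists_le_ker_of_lt_top _ (lt_top_iff_ne_top.2 hne)
  set L : Euc d →L[ℝ] ℝ := LinearMap.toContinuousLinearMap l
  have vanish : ∀ (k : ℕ) (i : Fin p₀) (δ : ℝ), |δ| < ρ →
      L ((matOp B ^ k) (expB B δ (basisVec hp i))) = 0 := by
    intro k i
    induction k with
    | zero => exact fun δ hδ => hl (Submodule.subset_span ⟨δ, hδ, i, rfl⟩)
    | succ k ih =>
      intro δ hδ
      have locally_zero : (fun η => L ((matOp B ^ k) (expB B η (basisVec hp i)))) =ᶠ[𝓝 δ] 0 := by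
        filter_upwards [continuous_abs.continuousAt.eventually_lt_const hδ] with η hη using ih η hη
      rw [pow_succ]
      exact (hasDerivAt_clm_expB_apply (L.comp (matOp B ^ k)) _ δ).unique
        ((hasDerivAt_const δ (0 : ℝ)).congr_of_eventuallyEq locally_zero)
  have kalman_le : kalmanSpace hp B ≤ LinearMap.ker l := by
    refine Submodule.span_le.2 ?_
    rintro _ ⟨k, i, rfl⟩
    simpa [L] using vanish k i 0 (by simpa using hρ)
  rw [h.kalmanSpace_eq_top, top_le_iff, LinearMap.ker_eq_top] at kalman_le
  exact hl0 kalman_le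

end Kalman

section IntrinsicContinuity

variable {p₀ d : ℕ} {hp : p₀ ≤ d} {B : Matrix (Fin d) (Fin d) ℝ} {F : Type*} [PseudoMetricSpace F]

theorem dist_translate_sum_le {V ι : Type*} [AddCommMonoid V] {g : V → F} {ε : ℝ} {v : ι → V}
    {s : Finset ι} (h : ∀ k ∈ s, ∀ x, dist (g (x + v k)) (g x) ≤ ε) (x : V) :
    dist (g (x + ∑ k ∈ s, v k)) (g x) ≤ s.card * ε := by
  classical
  induction s using Finset.induction_on with
  | empty => simp
  | insert k s hk ih =>
    rw [Finset.sum_insert hk, Finset.card_insert_of_notMem hk, add_comm (v k), ← add_assoc]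
    have last := h k (Finset.mem_insert_self k s) (x + ∑ k ∈ s, v k)
    have rest := ih fun j hj => h j (Finset.mem_insert_of_mem hj)
    push_cast
    linarith [dist_triangle (g (x + ∑ k ∈ s, v k + v k)) (g (x + ∑ k ∈ s, v k)) (g x)]

/-- The translation by `c e^{δB} e_i` is the composition of `e^{-δY}`, `e^{c ∂_i}` and `e^{δY}`. -/
theorem dist_translate_expB_le {g : ℝ × Euc d → F} {ε δ c : ℝ} {i : Fin p₀}
    (hY : ∀ z, dist (g (yFlow B δ z)) (g z) ≤ ε) (hY' : ∀ z, dist (g (yFlow B (-δ) z)) (g z) ≤ ε)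
    (hX : ∀ z, dist (g (dxFlow hp i c z)) (g z) ≤ ε) (t : ℝ) (x : Euc d) :
    dist (g (t, x + c • expB B δ (basisVec hp i))) (g (t, x)) ≤ 3 * ε := by
  have conj : yFlow B δ (dxFlow hp i c (yFlow B (-δ) (t, x))) =
      (t, x + c • expB B δ (basisVec hp i)) := by
    simp [yFlow_apply, dxFlow_apply]
  rw [← conj]
  linarith [dist_triangle4 (g (yFlow B δ (dxFlow hp i c (yFlow B (-δ) (t, x)))))
    (g (dxFlow hp i c (yFlow B (-δ) (t, x)))) (g (yFlow B (-δ) (t, x))) (g (t, x)),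
    hY (dxFlow hp i c (yFlow B (-δ) (t, x))), hX (yFlow B (-δ) (t, x)), hY' (t, x)]

theorem HormanderCondition.tendstoUniformly_translate (h : HormanderCondition hp B)
    {g : ℝ × Euc d → F} (hY : UnifContAlong (yFlow B) g)
    (hX : ∀ i, UnifContAlong (dxFlow hp i) g) :
    TendstoUniformly (fun (y : Euc d) z => g (z.1, z.2 + y)) g (𝓝 0) := by
  rw [Metric.tendstoUniformly_iff]
  intro ε hε
  set η : ℝ := ε / (3 * d + 1)
  have hη : 0 < η := by positivity
  obtain ⟨ρ, hρ, small⟩ : ∃ ρ > 0, ∀ δ : ℝ, |δ| < ρ → (∀ z, dist (g (yFlow B δ z)) (g z) ≤ η) ∧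
      ∀ i z, dist (g (dxFlow hp i δ z)) (g z) ≤ η := by
    have := (Metric.tendstoUniformly_iff.1 hY η hη).and
      (eventually_all.2 fun i => Metric.tendstoUniformly_iff.1 (hX i) η hη)
    obtain ⟨ρ, hρ, hball⟩ := Metric.eventually_nhds_iff.1 this
    refine ⟨ρ, hρ, fun δ hδ => ?_⟩
    obtain ⟨alongY, alongX⟩ := hball (by simpa using hδ)
    exact ⟨fun z => by simpa [dist_comm] using (alongY z).le,
      fun i z => by simpa [dist_comm] using (alongX i z).le⟩
  have hspan := h.span_expB_eq_top hρ
  let b := Module.Basis.ofSpan hspan.ge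
  have : Fintype _ := FiniteDimensional.fintypeBasisIndex b
  have coord_small : ∀ᶠ y : Euc d in 𝓝 0, ∀ k, |b.coord k y| < ρ := by
    refine eventually_all.2 fun k => ?_
    have := (LinearMap.continuous_of_finiteDimensional (b.coord k)).abs
    exact this.continuousAt.eventually_lt_const (by simpa using hρ)
  filter_upwards [coord_small] with y hy z
  have along_basis : ∀ k ∈ Finset.univ, ∀ x : Euc d,
      dist (g (z.1, x + b.coord k y • b k)) (g (z.1, x)) ≤ 3 * η := by
    intro k _ x
    obtain ⟨δ, hδ, i, hbk⟩ := Module.Basis.ofSpan_subset hspan.ge ⟨k, rfl⟩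
    rw [show b k = expB B δ (basisVec hp i) from hbk]
    exact dist_translate_expB_le (small δ hδ).1 (small (-δ) (by simpa using hδ)).1
      ((small _ (hy k)).2 i) z.1 x
  have total := dist_translate_sum_le (g := fun x => g (z.1, x)) along_basis z.2
  rw [show ∑ k, b.coord k y • b k = y by simp [b.sum_repr], Finset.card_univ,
    ← Module.finrank_eq_card_basis b, finrank_euclideanSpace_fin] at total
  rw [dist_comm]
  calc dist (g (z.1, z.2 + y)) (g z) ≤ d * (3 * η) := total
    _ < (3 * d + 1) * η := by linarith
    _ = ε := by simp only [η]; field_simp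

theorem HormanderCondition.continuous_of_unifContAlong (h : HormanderCondition hp B)
    {g : ℝ × Euc d → F} (hY : UnifContAlong (yFlow B) g)
    (hX : ∀ i, UnifContAlong (dxFlow hp i) g) : Continuous g := by
  refine continuous_iff_continuousAt.2 fun z₀ => Metric.tendsto_nhds.2 fun ε hε => ?_
  have time_lim : Tendsto (fun z : ℝ × Euc d => z.1 - z₀.1) (𝓝 z₀) (𝓝 0) :=
    Continuous.tendsto' (by fun_prop) _ _ (by simp)
  have space_lim : Tendsto (fun z : ℝ × Euc d => z.2 - expB B (z.1 - z₀.1) z₀.2) (𝓝 z₀) (𝓝 0) :=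
    Continuous.tendsto' (by fun_prop) _ _ (by simp)
  filter_upwards [time_lim.eventually (Metric.tendstoUniformly_iff.1 hY _ (half_pos hε)),
    space_lim.eventually
      (Metric.tendstoUniformly_iff.1 (h.tendstoUniformly_translate hY hX) _ (half_pos hε))]
    with z along_Y in_space
  have leg₁ := along_Y z₀
  have leg₂ := in_space (yFlow B (z.1 - z₀.1) z₀)
  simp only [yFlow_apply, add_sub_cancel] at leg₁ leg₂
  rw [dist_comm]
  linarith [dist_triangle (g z₀) (g (z.1, expB B (z.1 - z₀.1) z₀.2)) (g z)]

end IntrinsicContinuity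

section IntrinsicC2

variable {p₀ d : ℕ} {hp : p₀ ≤ d} {B : Matrix (Fin d) (Fin d) ℝ}

/-- The class of functions of intrinsic order two: `f` is continuous along with `∂_i f`, `∂_i ∂_j f`
and `Y f`, which exist everywhere. It contains the compactly supported functions of class
`C^{2,α}_B`, and it is the class in which Itô's formula is proved. -/
structure IntrinsicC2 (hp : p₀ ≤ d) (B : Matrix (Fin d) (Fin d) ℝ) (f : ℝ × Euc d → ℝ) : Prop where
  cont : Continuous f
  hasDx : ∀ i, HasDerivAlong (dxFlow hp i) f (derivDx hp i f)
  contDx : ∀ i, Continuous (derivDx hp i f)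
  hasDxx : ∀ i j, HasDerivAlong (dxFlow hp i) (derivDx hp j f) (derivDx hp i (derivDx hp j f))
  contDxx : ∀ i j, Continuous (derivDx hp i (derivDx hp j f))
  hasY : HasDerivAlong (yFlow B) f (derivY B f)
  contY : Continuous (derivY B f)

theorem radiusOn_pos {Q K : Set (ℝ × Euc d)} (hQ : IsOpen Q) (hK : IsCompact K) (hKQ : K ⊆ Q)
    (hne : K.Nonempty) : 0 < radiusOn hp B Q K := by
  have stays : ∀ (φ : Flow ℝ (ℝ × Euc d)), ∀ z ∈ K, ∀ᶠ q : ℝ × (ℝ × Euc d) in 𝓝 (0, z),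
      φ q.1 q.2 ∈ Q := fun φ z hz =>
    (φ.continuous continuous_fst continuous_snd).continuousAt.eventually_mem
      (hQ.mem_nhds (by simpa [φ.map_zero_apply] using hKQ hz))
  have stays_unif : ∀ᶠ δ : ℝ in 𝓝 0, ∀ z ∈ K,
      (∀ i : Fin p₀, flowDx hp i δ z ∈ Q) ∧ flowY B δ z ∈ Q :=
    hK.eventually_forall_of_forall_eventually fun z hz =>
      (eventually_all.2 fun i => stays (dxFlow hp i) z hz).and (stays (yFlow B) z hz)
  obtain ⟨ε, hε, hball⟩ := Metric.eventually_nhds_iff.1 stays_unif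
  have hr : 0 < min (ε / 2) 1 := by positivity
  refine hr.trans_le (le_csInf (hne.image _) ?_)
  rintro _ ⟨z, hz, rfl⟩
  refine le_csSup ⟨1, fun r hr => hr.1.2⟩ ⟨⟨hr, min_le_right _ _⟩, fun δ hδ => hball ?_ z hz⟩
  rw [Real.dist_eq, sub_zero]
  linarith [abs_le.2 hδ, min_le_left (ε / 2) 1]

theorem HolderAlong.unifContAlong {Q K : Set (ℝ × Euc d)} (hQ : IsOpen Q) (hK : IsCompact K)
    (hKQ : K ⊆ Q) {φ : Flow ℝ (ℝ × Euc d)} {β : ℝ} (hβ : 0 < β) {g : ℝ × Euc d → ℝ}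
    (hg : ∀ z ∉ K, g z = 0) (h : HolderAlong hp B Q φ β g) : UnifContAlong φ g := by
  rcases K.eq_empty_or_nonempty with rfl | hne
  · exact unifContAlong_of_tendstoUniformlyOn hg tendstoUniformlyOn_empty
  obtain ⟨C, hC⟩ := h K (by rwa [hK.isClosed.closure_eq]) (by rwa [hK.isClosed.closure_eq])
  exact unifContAlong_of_holder hg hβ (radiusOn_pos hQ hK hKQ hne) hC

theorem HasDerivAlong.unifContAlong_of_isCompact {Z : Type*} [TopologicalSpace Z] [R1Space Z]
    {φ : Flow ℝ Z} {f g : Z → ℝ} {K : Set Z} (h : HasDerivAlong φ f g) (hK : IsCompact K)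
    (hc : Continuous g) (hg : ∀ z ∉ K, g z = 0) : UnifContAlong φ f :=
  let ⟨_, hC⟩ := hc.bounded_above_of_compact_support (HasCompactSupport.intro hK hg)
  h.unifContAlong hC

theorem IntrinsicHolder.continuous_of_zero (hB : HormanderCondition hp B) {Q K : Set (ℝ × Euc d)}
    (hQ : IsOpen Q) (hK : IsCompact K) (hKQ : K ⊆ Q) {α : ℝ} (hα : 0 < α) {g : ℝ × Euc d → ℝ}
    (hg : ∀ z ∉ K, g z = 0) (h : IntrinsicHolder hp B Q α 0 g) : Continuous g :=
  hB.continuous_of_unifContAlong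
    (HolderAlong.unifContAlong (φ := yFlow B) hQ hK hKQ (half_pos hα) hg h.1)
    fun i => HolderAlong.unifContAlong (φ := dxFlow hp i) hQ hK hKQ hα hg (h.2 i)

/-- Only the top order derivatives are continuous by the Hölder condition alone; the lower order
ones are Lipschitz along the fields by which they are differentiated. -/
theorem IntrinsicHolder.intrinsicC2 (hB : HormanderCondition hp B) {Q : Set (ℝ × Euc d)}
    (hQ : IsOpen Q) {α : ℝ} (hα : 0 < α) {f : ℝ × Euc d → ℝ} (hf : IntrinsicHolder hp B Q α 2 f)
    (hfc : HasCompactSupport f) (hfs : tsupport f ⊆ Q) : IntrinsicC2 hp B f := by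
  obtain ⟨⟨hY, holderY⟩, hX⟩ := hf
  have hK : IsCompact (tsupport f) := hfc
  have hKc := hK.isClosed
  have zero_f : ∀ z ∉ tsupport f, f z = 0 := fun z hz => image_eq_zero_of_notMem_tsupport hz
  have zero_Dx := fun i => derivDx_eq_zero_off (hp := hp) hKc zero_f i
  have zero_Dxx := fun i j => derivDx_eq_zero_off (hp := hp) hKc (zero_Dx j) i
  have zero_Y := derivY_eq_zero_off (B := B) hKc zero_f
  have hasDx : ∀ i, HasDerivAlong (dxFlow hp i) f (derivDx hp i f) := fun i =>
    hasDerivAlong_of_eq_zero_off (dxFlow hp i) hKc hfs zero_f (hX i).1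
  have hasDxx : ∀ i j, HasDerivAlong (dxFlow hp i) (derivDx hp j f)
      (derivDx hp i (derivDx hp j f)) := fun i j =>
    hasDerivAlong_of_eq_zero_off (dxFlow hp i) hKc hfs (zero_Dx j) ((hX j).2.2 i).1
  have hasY : HasDerivAlong (yFlow B) f (derivY B f) :=
    hasDerivAlong_of_eq_zero_off (yFlow B) hKc hfs zero_f hY
  have contY : Continuous (derivY B f) := continuous_of_zero hB hQ hK hfs hα zero_Y holderY
  have contDxx : ∀ i j, Continuous (derivDx hp i (derivDx hp j f)) := fun i j =>
    continuous_of_zero hB hQ hK hfs hα (zero_Dxx i j) ((hX j).2.2 i).2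
  have contDx : ∀ j, Continuous (derivDx hp j f) := fun j =>
    hB.continuous_of_unifContAlong
      (HolderAlong.unifContAlong (φ := yFlow B) hQ hK hfs (by positivity) (zero_Dx j) (hX j).2.1)
      fun i => (hasDxx i j).unifContAlong_of_isCompact hK (contDxx i j) (zero_Dxx i j)
  have cont : Continuous f :=
    hB.continuous_of_unifContAlong (hasY.unifContAlong_of_isCompact hK contY zero_Y)
      fun i => (hasDx i).unifContAlong_of_isCompact hK (contDx i) (zero_Dx i)
  exact ⟨cont, hasDx, contDx, hasDxx, contDxx, hasY, contY⟩

namespace IntrinsicC2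

variable {f : ℝ × Euc d → ℝ} (hf : IntrinsicC2 hp B f)

include hf

theorem hasDerivAlong_dx_mul_self (i : Fin p₀) :
    HasDerivAlong (dxFlow hp i) (fun z => f z * f z) fun z => 2 * (f z * derivDx hp i f z) :=
  fun z => ((hf.hasDx i).mul (hf.hasDx i) z).congr_deriv (by ring)

theorem hasDerivAlong_dxx_mul_self (i j : Fin p₀) :
    HasDerivAlong (dxFlow hp i) (fun z => 2 * (f z * derivDx hp j f z)) fun z =>
      2 * (derivDx hp i f z * derivDx hp j f z + f z * derivDx hp i (derivDx hp j f) z) :=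
  fun z => ((hf.hasDx i).mul (hf.hasDxx i j) z).const_mul 2

theorem hasDerivAlong_y_mul_self :
    HasDerivAlong (yFlow B) (fun z => f z * f z) fun z => 2 * (f z * derivY B f z) :=
  fun z => (hf.hasY.mul hf.hasY z).congr_deriv (by ring)

theorem mul_self : IntrinsicC2 hp B fun z => f z * f z := by
  have eqDx := fun i => (hf.hasDerivAlong_dx_mul_self i).derivDx_eq
  have eqDxx := fun i j => (hf.hasDerivAlong_dxx_mul_self i j).derivDx_eq
  have eqY := hf.hasDerivAlong_y_mul_self.derivY_eq
  have := hf.cont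
  have := hf.contDx
  have := hf.contDxx
  have := hf.contY
  exact {
    cont := by fun_prop
    hasDx i := by rw [eqDx]; exact hf.hasDerivAlong_dx_mul_self i
    contDx i := by rw [eqDx]; fun_prop
    hasDxx i j := by rw [eqDx, eqDxx]; exact hf.hasDerivAlong_dxx_mul_self i j
    contDxx i j := by rw [eqDx, eqDxx]; fun_prop
    hasY := by rw [eqY]; exact hf.hasDerivAlong_y_mul_self
    contY := by rw [eqY]; fun_prop }

theorem opL_mul_self (a : Fin p₀ → Fin p₀ → ℝ × Euc d → ℝ) (b : Fin p₀ → ℝ × Euc d → ℝ)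
    (z : ℝ × Euc d) :
    opL hp B a b (fun z => f z * f z) z
      = 2 * (f z * opL hp B a b f z) + energyDensity hp a f z := by
  have second_order : ∀ i j, a i j z * (2 * (derivDx hp i f z * derivDx hp j f z
      + f z * derivDx hp i (derivDx hp j f) z))
      = 2 * (a i j z * derivDx hp i f z * derivDx hp j f z)
        + 2 * f z * (a i j z * derivDx hp i (derivDx hp j f) z) := fun i j => by ring
  have first_order : ∀ i, b i z * (2 * (f z * derivDx hp i f z)) =
      2 * f z * (b i z * derivDx hp i f z) := fun i => by ring
  simp only [opL, energyDensity, fun i => (hf.hasDerivAlong_dx_mul_self i).derivDx_eq,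
    fun i j => (hf.hasDerivAlong_dxx_mul_self i j).derivDx_eq,
    hf.hasDerivAlong_y_mul_self.derivY_eq, second_order, first_order, Finset.sum_add_distrib,
    ← Finset.mul_sum]
  ring

end IntrinsicC2

end IntrinsicC2

/-! ### Intrinsic mollification -/

section Mollify

variable {p₀ d : ℕ} (B : Matrix (Fin d) (Fin d) ℝ)

/-- The left translation by `(0, -y)` for the group law of `ℝ × ℝ^d` under which the fields
`∂_{x_i}` and `Y` are invariant; it commutes with their flows. -/
noncomputable def leftShift (y : Euc d) (z : ℝ × Euc d) : ℝ × Euc d := (z.1, z.2 - expB B z.1 y)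

theorem leftShift_yFlow (y : Euc d) (δ : ℝ) (z : ℝ × Euc d) :
    leftShift B y (yFlow B δ z) = yFlow B δ (leftShift B y z) := by
  simp only [leftShift, yFlow_apply, map_sub, ← expB_add_apply, add_comm]

theorem leftShift_dxFlow (hp : p₀ ≤ d) (i : Fin p₀) (y : Euc d) (δ : ℝ) (z : ℝ × Euc d) :
    leftShift B y (dxFlow hp i δ z) = dxFlow hp i δ (leftShift B y z) := by
  simp only [leftShift, dxFlow_apply, Prod.mk.injEq, true_and]
  abel

@[simp] theorem leftShift_zero (z : ℝ × Euc d) : leftShift B 0 z = z := by simp [leftShift]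

@[simp] theorem leftShift_neg_leftShift (y : Euc d) (z : ℝ × Euc d) :
    leftShift B (-y) (leftShift B y z) = z := by simp [leftShift]

theorem continuous_leftShift : Continuous fun q : Euc d × (ℝ × Euc d) => leftShift B q.1 q.2 := by
  unfold leftShift
  fun_prop

/-- The average `∫ φ(y) g(t, x - e^{tB} y) dy` of the left translates of `g`. It commutes with the
derivatives along the fields and is smooth in `x`. -/
noncomputable def mollify (φ : ContDiffBump (0 : Euc d)) (g : ℝ × Euc d → ℝ) (z : ℝ × Euc d) : ℝ :=
  ∫ y, φ.normed volume y * g (leftShift B y z)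

variable {B} (φ : ContDiffBump (0 : Euc d)) {g : ℝ × Euc d → ℝ}

theorem integrable_mollify_integrand (hg : Continuous g) (z : ℝ × Euc d) :
    Integrable fun y => φ.normed volume y * g (leftShift B y z) := by
  have shift : Continuous fun y => leftShift B y z :=
    (continuous_leftShift B).comp (Continuous.prodMk_left z)
  exact (φ.continuous_normed.mul (hg.comp shift)).integrable_of_hasCompactSupport
    φ.hasCompactSupport_normed.mul_right

theorem norm_normed_mul_le {C : ℝ} (y : Euc d) {c : ℝ} (hc : |c| ≤ C) :
    ‖φ.normed volume y * c‖ ≤ φ.normed volume y * C := by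
  rw [norm_mul, Real.norm_of_nonneg (φ.nonneg_normed y)]
  exact mul_le_mul_of_nonneg_left hc (φ.nonneg_normed y)

theorem abs_mollify_le {C : ℝ} (hC : ∀ z, |g z| ≤ C) (z : ℝ × Euc d) : |mollify B φ g z| ≤ C := by
  have := norm_integral_le_of_norm_le ((φ.integrable_normed (μ := volume)).mul_const C)
    (ae_of_all _ fun y => norm_normed_mul_le φ y (hC (leftShift B y z)))
  rwa [integral_mul_const, φ.integral_normed, one_mul, Real.norm_eq_abs] at this

theorem continuous_mollify (hg : Continuous g) {C : ℝ} (hC : ∀ z, |g z| ≤ C) :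
    Continuous (mollify B φ g) :=
  continuous_of_dominated (bound := fun y => φ.normed volume y * C)
    (fun z => (integrable_mollify_integrand φ hg z).aestronglyMeasurable)
    (fun _ => ae_of_all _ fun y => norm_normed_mul_le φ y (hC _))
    (φ.integrable_normed.mul_const C)
    (ae_of_all _ fun y => continuous_const.mul (hg.comp ((continuous_leftShift B).comp
      (Continuous.prodMk_right y))))

theorem HasDerivAlong.mollify {ψ : Flow ℝ (ℝ × Euc d)}
    (hcomm : ∀ y δ z, leftShift B y (ψ δ z) = ψ δ (leftShift B y z)) {f g : ℝ × Euc d → ℝ}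
    (hf : Continuous f) (hg : Continuous g) {C : ℝ} (hC : ∀ z, |g z| ≤ C)
    (h : HasDerivAlong ψ f g) : HasDerivAlong ψ (mollify B φ f) (mollify B φ g) := by
  intro z
  have under_integral := (hasDerivAt_integral_of_dominated_loc_of_deriv_le
    (μ := (volume : Measure (Euc d)))
    (F := fun δ y => φ.normed volume y * f (leftShift B y (ψ δ z)))
    (F' := fun δ y => φ.normed volume y * g (leftShift B y (ψ δ z)))
    (x₀ := (0 : ℝ)) (bound := fun y => φ.normed volume y * C) univ_mem
    (Eventually.of_forall fun δ => (integrable_mollify_integrand φ hf _).aestronglyMeasurable)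
    (integrable_mollify_integrand φ hf _)
    (integrable_mollify_integrand φ hg _).aestronglyMeasurable
    (ae_of_all _ fun y δ _ => norm_normed_mul_le φ y (hC _)) (φ.integrable_normed.mul_const C)
    (ae_of_all _ fun y δ _ => by
      simpa only [hcomm] using (h.hasDerivAt (leftShift B y z) δ).const_mul _)).2
  simp only [ψ.map_zero_apply] at under_integral
  exact under_integral

theorem mollify_eq_convolution (g : ℝ × Euc d → ℝ) (t : ℝ) (x : Euc d) :
    mollify B φ g (t, x) = (convolution (φ.normed volume) (fun u => g (t, expB B t u))
      (ContinuousLinearMap.lsmul ℝ ℝ) volume) (expB B (-t) x) := by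
  simp only [mollify, convolution, leftShift, ContinuousLinearMap.lsmul_apply, smul_eq_mul, map_sub,
    expB_apply_neg]

theorem contDiff_mollify (hg : Continuous g) (t : ℝ) (n : ℕ∞) :
    ContDiff ℝ n fun x => mollify B φ g (t, x) := by
  have conv : ContDiff ℝ n (convolution (φ.normed volume) (fun u => g (t, expB B t u))
      (ContinuousLinearMap.lsmul ℝ ℝ) volume) :=
    φ.hasCompactSupport_normed.contDiff_convolution_left _ φ.contDiff_normed
      (by fun_prop : Continuous fun u => g (t, expB B t u)).locallyIntegrable
  simp only [mollify_eq_convolution]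
  exact conv.comp (expB B (-t)).contDiff

theorem abs_mollify_sub_le (hg : Continuous g) (z : ℝ × Euc d) {ε : ℝ}
    (h : ∀ y : Euc d, ‖y‖ < φ.rOut → |g (leftShift B y z) - g z| ≤ ε) :
    |mollify B φ g z - g z| ≤ ε := by
  have meas : Continuous fun u => g (z.1, expB B z.1 u) := by fun_prop
  have near : ∀ u ∈ Metric.ball (expB B (-z.1) z.2) φ.rOut,
      dist (g (z.1, expB B z.1 u)) (g (z.1, expB B z.1 (expB B (-z.1) z.2))) ≤ ε := by
    intro u hu
    simpa [leftShift, Real.dist_eq] using h (expB B (-z.1) z.2 - u)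
      (by rwa [← dist_eq_norm, dist_comm])
  simpa only [← mollify_eq_convolution, Real.dist_eq, expB_apply_neg] using
    φ.dist_normed_convolution_le (μ := volume) meas.aestronglyMeasurable near

theorem mollify_eq_zero {z : ℝ × Euc d}
    (h : ∀ y : Euc d, ‖y‖ ≤ φ.rOut → g (leftShift B y z) = 0) : mollify B φ g z = 0 := by
  refine integral_eq_zero_of_ae (ae_of_all _ fun y => ?_)
  by_cases hy : ‖y‖ ≤ φ.rOut
  · simp [h y hy]
  · have : φ y = 0 := φ.zero_of_le_dist (by rw [dist_zero_right]; exact (not_le.1 hy).le)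
    simp [ContDiffBump.normed_def, this]

theorem tendsto_mollify {ι : Type*} {l : Filter ι} {φ : ι → ContDiffBump (0 : Euc d)}
    (hφ : Tendsto (fun n => (φ n).rOut) l (𝓝 0)) (hg : Continuous g) (z : ℝ × Euc d) :
    Tendsto (fun n => mollify B (φ n) g z) l (𝓝 (g z)) := by
  have shift : Continuous fun y => g (leftShift B y z) :=
    hg.comp ((continuous_leftShift B).comp (Continuous.prodMk_left z))
  refine Metric.tendsto_nhds.2 fun ε hε => ?_
  obtain ⟨ρ, hρ, near⟩ := Metric.continuousAt_iff.1 (shift.continuousAt (x := 0)) (ε / 2)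
    (half_pos hε)
  filter_upwards [hφ.eventually_lt_const hρ] with n hn
  rw [Real.dist_eq]
  refine (abs_mollify_sub_le (φ n) hg z fun y hy => ?_).trans_lt (half_lt_self hε)
  have := near (x := y) (by rw [dist_zero_right]; exact hy.trans hn)
  rw [leftShift_zero, Real.dist_eq] at this
  exact this.le

theorem exists_compact_leftShift {Q K : Set (ℝ × Euc d)} (hQ : IsOpen Q) (hK : IsCompact K)
    (hKQ : K ⊆ Q) : ∃ r > 0, ∃ K' : Set (ℝ × Euc d), IsCompact K' ∧ K' ⊆ Q ∧
      ∀ z ∉ K', ∀ y : Euc d, ‖y‖ ≤ r → leftShift B y z ∉ K := by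
  have stays : ∀ᶠ y : Euc d in 𝓝 0, ∀ z ∈ K, leftShift B y z ∈ Q :=
    hK.eventually_forall_of_forall_eventually fun z hz =>
      (continuous_leftShift B).continuousAt.eventually_mem (hQ.mem_nhds (by simpa using hKQ hz))
  obtain ⟨ε, hε, hball⟩ := Metric.eventually_nhds_iff.1 stays
  refine ⟨ε / 2, half_pos hε, (fun q : Euc d × (ℝ × Euc d) => leftShift B q.1 q.2) ''
    (Metric.closedBall 0 (ε / 2) ×ˢ K),
    ((isCompact_closedBall _ _).prod hK).image (continuous_leftShift B), ?_, ?_⟩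
  · rintro _ ⟨⟨y, z⟩, ⟨hy, hz⟩, rfl⟩
    exact hball ((Metric.mem_closedBall.1 hy).trans_lt (half_lt_self hε)) z hz
  · intro z hz y hy hmem
    exact hz ⟨(-y, leftShift B y z), ⟨by simpa using hy, hmem⟩, leftShift_neg_leftShift B y z⟩

end Mollify

/-! ### Generators of local diffusions -/

section Taylor

variable {E : Type*} [NormedAddCommGroup E] [NormedSpace ℝ E] {g : E → ℝ}

theorem exists_norm_sub_le_of_uniformContinuous {E F : Type*} [NormedAddCommGroup E]
    [NormedAddCommGroup F] {u : E → F} (hu : UniformContinuous u) {ε : ℝ} (hε : 0 < ε) :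
    ∃ δ > 0, ∀ x y, ‖y - x‖ < δ → ‖u y - u x‖ ≤ ε := by
  obtain ⟨δ, hδ, h⟩ := Metric.uniformContinuous_iff.1 hu ε hε
  simp only [dist_eq_norm] at h
  exact ⟨δ, hδ, fun x y hxy => (h hxy).le⟩

theorem exists_norm_fderiv_fderiv_sub_le (hg : ContDiff ℝ 2 g) (hgc : HasCompactSupport g) {ε : ℝ}
    (hε : 0 < ε) : ∃ δ > 0, ∀ x y, ‖y - x‖ < δ →
      ‖fderiv ℝ (fderiv ℝ g) y - fderiv ℝ (fderiv ℝ g) x‖ ≤ ε := by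
  have continuous : Continuous (fderiv ℝ (fderiv ℝ g)) :=
    (hg.fderiv_right (m := 1) (by norm_num)).continuous_fderiv one_ne_zero
  have uniform := ((hgc.fderiv ℝ).fderiv ℝ).uniformContinuous_of_continuous continuous
  exact exists_norm_sub_le_of_uniformContinuous (F := E →L[ℝ] E →L[ℝ] ℝ) uniform hε

theorem norm_fderiv_sub_taylor_one_le (hg : ContDiff ℝ 2 g) {x y : E} {δ ε : ℝ}
    (h : ∀ y, ‖y - x‖ < δ → ‖fderiv ℝ (fderiv ℝ g) y - fderiv ℝ (fderiv ℝ g) x‖ ≤ ε)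
    (hy : ‖y - x‖ < δ) :
    ‖fderiv ℝ g y - fderiv ℝ g x - fderiv ℝ (fderiv ℝ g) x (y - x)‖ ≤ ε * ‖y - x‖ := by
  have diff : Differentiable ℝ (fderiv ℝ g) :=
    (hg.fderiv_right (m := 1) (by norm_num)).differentiable one_ne_zero
  refine Convex.norm_image_sub_le_of_norm_fderiv_le' (fun y _ => diff y)
    (fun y hy => h y (mem_ball_iff_norm.1 hy)) (convex_ball x δ) ?_ (mem_ball_iff_norm.2 hy)
  exact Metric.mem_ball_self ((norm_nonneg _).trans_lt hy)

theorem abs_sub_taylor_two_le (hg : ContDiff ℝ 2 g) {x y : E} {δ ε : ℝ}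
    (h : ∀ y, ‖y - x‖ < δ → ‖fderiv ℝ (fderiv ℝ g) y - fderiv ℝ (fderiv ℝ g) x‖ ≤ ε)
    (hy : ‖y - x‖ < δ) :
    |g y - g x - (fderiv ℝ g x (y - x) + 1 / 2 * fderiv ℝ (fderiv ℝ g) x (y - x) (y - x))|
      ≤ ε * ‖y - x‖ ^ 2 := by
  obtain ⟨v, rfl⟩ : ∃ v, y = x + v := ⟨y - x, by abel⟩
  rw [add_sub_cancel_left] at hy ⊢
  have hε : 0 ≤ ε := le_trans (by positivity) (h (x + v) (by simpa using hy))
  set q := fderiv ℝ (fderiv ℝ g) x v v with hq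
  have deriv_remainder (θ : ℝ) :
      HasDerivAt (fun θ : ℝ => g (x + θ • v) - θ * fderiv ℝ g x v - θ ^ 2 / 2 * q)
        (fderiv ℝ g (x + θ • v) v - fderiv ℝ g x v - θ * q) θ := by
    have line : HasDerivAt (fun θ : ℝ => x + θ • v) v θ := by
      simpa using ((hasDerivAt_id θ).smul_const v).const_add x
    have first := ((hg.differentiable two_ne_zero _).hasFDerivAt.comp_hasDerivAt θ line).sub
      ((hasDerivAt_id' θ).mul_const (fderiv ℝ g x v))
    exact (first.sub ((((hasDerivAt_id' θ).fun_pow 2).div_const 2).mul_const q)).congr_deriv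
      (by simp)
  have bound (θ : ℝ) (hθ : θ ∈ Icc (0 : ℝ) 1) :
      ‖fderiv ℝ g (x + θ • v) v - fderiv ℝ g x v - θ * q‖ ≤ ε * ‖v‖ ^ 2 := by
    have norm_le : ‖θ • v‖ ≤ ‖v‖ := by
      rw [norm_smul, Real.norm_of_nonneg hθ.1]
      exact mul_le_of_le_one_left (norm_nonneg _) hθ.2
    have taylor := norm_fderiv_sub_taylor_one_le hg h (y := x + θ • v)
      (by simpa using norm_le.trans_lt hy)
    rw [add_sub_cancel_left] at taylor
    calc _ = ‖(fderiv ℝ g (x + θ • v) - fderiv ℝ g x - fderiv ℝ (fderiv ℝ g) x (θ • v)) v‖ := by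
          simp [hq]
      _ ≤ ε * ‖θ • v‖ * ‖v‖ := ContinuousLinearMap.le_of_opNorm_le _ taylor v
      _ ≤ ε * ‖v‖ ^ 2 := by rw [pow_two, ← mul_assoc]; gcongr
  have := Convex.norm_image_sub_le_of_norm_hasDerivWithin_le (s := Icc (0 : ℝ) 1) (x := 0)
    (y := 1) (fun θ _ => (deriv_remainder θ).hasDerivWithinAt) bound (convex_Icc 0 1)
    (by simp) (by simp)
  simp only [one_smul, one_mul, one_pow, zero_smul, add_zero, zero_mul, sub_zero, norm_one, mul_one,
    ne_eq, OfNat.ofNat_ne_zero, not_false_eq_true, zero_pow, zero_div, Real.norm_eq_abs] at this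
  convert this using 2
  ring

end Taylor

section DiffusionOp

variable {d : ℕ} {m m' : Fin d → ℝ} {c c' : Fin d → Fin d → ℝ} {g : Euc d → ℝ} {x : Euc d}

/-- The second order operator `∑ mᵢ ∂ᵢ + ½ ∑ cᵢⱼ ∂ᵢⱼ` with coefficients frozen at the point of
evaluation. -/
noncomputable def diffusionOp (m : Fin d → ℝ) (c : Fin d → Fin d → ℝ) (g : Euc d → ℝ)
    (x : Euc d) : ℝ :=
  ∑ i, m i * fderiv ℝ g x (EuclideanSpace.single i 1) +
    1 / 2 * ∑ i, ∑ j, c i j *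
      fderiv ℝ (fderiv ℝ g) x (EuclideanSpace.single i 1) (EuclideanSpace.single j 1)

theorem diffusionOp_sub :
    diffusionOp (m - m') (c - c') g x = diffusionOp m c g x - diffusionOp m' c' g x := by
  simp only [diffusionOp, Pi.sub_apply, sub_mul, Finset.sum_sub_distrib]
  ring

theorem diffusionOp_div (r : ℝ) :
    diffusionOp (fun i => m i / r) (fun i j => c i j / r) g x = diffusionOp m c g x / r := by
  simp only [diffusionOp, div_mul_eq_mul_div, ← Finset.sum_div]
  ring

theorem diffusionOp_eq_zero (hx : x ∉ tsupport g) : diffusionOp m c g x = 0 := by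
  have first : x ∉ tsupport (fderiv ℝ g) := fun h => hx (tsupport_fderiv_subset ℝ h)
  have second : x ∉ tsupport (fderiv ℝ (fderiv ℝ g)) := fun h => first (tsupport_fderiv_subset ℝ h)
  simp [diffusionOp, image_eq_zero_of_notMem_tsupport first,
    image_eq_zero_of_notMem_tsupport second]

theorem clm_apply_eq_sum_single {F : Type*} [NormedAddCommGroup F] [NormedSpace ℝ F]
    (T : Euc d →L[ℝ] F) (v : Euc d) : T v = ∑ i, v i • T (EuclideanSpace.single i 1) := by
  have expansion : v = ∑ i, v i • (EuclideanSpace.single i (1 : ℝ) : Euc d) := by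
    simpa using ((EuclideanSpace.basisFun (Fin d) ℝ).sum_repr v).symm
  conv_lhs => rw [expansion, map_sum]
  simp only [map_smul]

theorem diffusionOp_increment (v : Euc d) :
    diffusionOp v (fun i j => v i * v j) g x
      = fderiv ℝ g x v + 1 / 2 * fderiv ℝ (fderiv ℝ g) x v v := by
  rw [clm_apply_eq_sum_single (fderiv ℝ g x) v, clm_apply_eq_sum_single (fderiv ℝ (fderiv ℝ g) x) v,
    _root_.sum_apply]
  simp only [diffusionOp, _root_.smul_apply, smul_eq_mul,
    clm_apply_eq_sum_single (fderiv ℝ (fderiv ℝ g) x _) v, Finset.mul_sum]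
  simp only [mul_assoc]

theorem abs_sum_le_card_mul {ι : Type*} [Fintype ι] {u : ι → ℝ} {C : ℝ} (h : ∀ i, |u i| ≤ C) :
    |∑ i, u i| ≤ Fintype.card ι * C :=
  (Finset.abs_sum_le_sum_abs _ _).trans
    ((Finset.sum_le_card_nsmul _ _ C fun i _ => h i).trans_eq (by simp))

theorem abs_diffusionOp_le {η M : ℝ} (hη : 0 ≤ η) (hm : ∀ i, |m i| ≤ η) (hc : ∀ i j, |c i j| ≤ η)
    (hM : ‖fderiv ℝ g x‖ ≤ M) (hM' : ‖fderiv ℝ (fderiv ℝ g) x‖ ≤ M) :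
    |diffusionOp m c g x| ≤ η * (M * (d + d ^ 2)) := by
  have norm_single (i : Fin d) : ‖(EuclideanSpace.single i 1 : Euc d)‖ = 1 := by simp
  have first := abs_sum_le_card_mul fun i => (abs_mul _ _).trans_le <| mul_le_mul (hm i)
    (((fderiv ℝ g x).le_of_opNorm_le hM _).trans_eq (by rw [norm_single i, mul_one]))
    (abs_nonneg _) hη
  have second := abs_sum_le_card_mul fun i => abs_sum_le_card_mul fun j =>
    (abs_mul _ _).trans_le <| mul_le_mul (hc i j)
      (((fderiv ℝ (fderiv ℝ g) x).le_of_opNorm₂_le_of_le hM' (norm_single i).le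
        (norm_single j).le).trans_eq (by ring)) (abs_nonneg _) hη
  simp only [Fintype.card_fin] at first second
  rw [diffusionOp]
  refine (abs_add_le _ _).trans ?_
  rw [abs_mul, abs_of_pos (by norm_num : (0 : ℝ) < 1 / 2)]
  linarith [(abs_nonneg _).trans second]

end DiffusionOp

section TruncatedMoments

variable {d : ℕ} {μ : Measure (Euc d)} {x : Euc d} {δ : ℝ}

/-- The truncated first moment `∫_{|ξ-x|<δ} (ξ-x)ᵢ μ(dξ)`. -/
noncomputable def truncMean (μ : Measure (Euc d)) (x : Euc d) (δ : ℝ) (i : Fin d) : ℝ :=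
  ∫ ξ in {ξ | ‖ξ - x‖ < δ}, (ξ - x) i ∂μ

/-- The truncated second moment `∫_{|ξ-x|<δ} (ξ-x)ᵢ(ξ-x)ⱼ μ(dξ)`. -/
noncomputable def truncCov (μ : Measure (Euc d)) (x : Euc d) (δ : ℝ) (i j : Fin d) : ℝ :=
  ∫ ξ in {ξ | ‖ξ - x‖ < δ}, (ξ - x) i * (ξ - x) j ∂μ

theorem measurableSet_norm_sub_lt (x : Euc d) (δ : ℝ) : MeasurableSet {ξ | ‖ξ - x‖ < δ} :=
  (isOpen_lt (by fun_prop) continuous_const).measurableSet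

theorem abs_sub_apply_le_of_norm_lt {ξ : Euc d} (hξ : ‖ξ - x‖ < δ) (i : Fin d) :
    |(ξ - x) i| ≤ δ :=
  (PiLp.norm_apply_le (ξ - x) i).trans hξ.le

variable [IsFiniteMeasure μ]

theorem integrableOn_sub_apply (i : Fin d) :
    IntegrableOn (fun ξ : Euc d => (ξ - x) i) {ξ | ‖ξ - x‖ < δ} μ :=
  Measure.integrableOn_of_bounded (M := δ) (measure_ne_top _ _)
    (Continuous.aestronglyMeasurable (by fun_prop))
    ((ae_restrict_iff' (measurableSet_norm_sub_lt x δ)).2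
      (ae_of_all _ fun _ hξ => abs_sub_apply_le_of_norm_lt hξ i))

theorem integrableOn_sub_apply_mul (i j : Fin d) :
    IntegrableOn (fun ξ : Euc d => (ξ - x) i * (ξ - x) j) {ξ | ‖ξ - x‖ < δ} μ :=
  (integrableOn_sub_apply j).bdd_mul (Continuous.aestronglyMeasurable (by fun_prop))
    ((ae_restrict_iff' (measurableSet_norm_sub_lt x δ)).2
      (ae_of_all _ fun _ hξ => abs_sub_apply_le_of_norm_lt hξ i))

theorem integrableOn_diffusionOp_increment (g : Euc d → ℝ) :
    IntegrableOn (fun ξ => diffusionOp (ξ - x).ofLp (fun i j => (ξ - x) i * (ξ - x) j) g x)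
      {ξ | ‖ξ - x‖ < δ} μ :=
  (integrable_finsetSum _ fun i _ => (integrableOn_sub_apply i).mul_const _).add
    ((integrable_finsetSum _ fun i _ => integrable_finsetSum _ fun j _ =>
      (integrableOn_sub_apply_mul i j).mul_const _).const_mul _)

theorem setIntegral_diffusionOp_increment (g : Euc d → ℝ) :
    ∫ ξ in {ξ | ‖ξ - x‖ < δ}, diffusionOp (ξ - x).ofLp (fun i j => (ξ - x) i * (ξ - x) j) g x ∂μ
      = diffusionOp (truncMean μ x δ) (truncCov μ x δ) g x := by
  have first (i : Fin d) := (integrableOn_sub_apply (μ := μ) (x := x) (δ := δ) i).mul_const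
    (fderiv ℝ g x (EuclideanSpace.single i 1))
  have second (i j : Fin d) := (integrableOn_sub_apply_mul (μ := μ) (x := x) (δ := δ) i j).mul_const
    (fderiv ℝ (fderiv ℝ g) x (EuclideanSpace.single i 1) (EuclideanSpace.single j 1))
  simp only [diffusionOp]
  rw [integral_add (integrable_finsetSum _ fun i _ => first i)
    ((integrable_finsetSum _ fun i _ => integrable_finsetSum _ fun j _ => second i j).const_mul _),
    integral_const_mul, integral_finsetSum _ fun i _ => first i,
    integral_finsetSum _ fun i _ => integrable_finsetSum _ fun j _ => second i j]
  simp only [integral_finsetSum _ fun j _ => second _ j, integral_mul_const, truncMean, truncCov]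

variable {g : Euc d → ℝ} {M : ℝ}

theorem abs_setIntegral_sub_diffusionOp_le (hg : ContDiff ℝ 2 g) {ε : ℝ}
    (h : ∀ y, ‖y - x‖ < δ → ‖fderiv ℝ (fderiv ℝ g) y - fderiv ℝ (fderiv ℝ g) x‖ ≤ ε) :
    |∫ ξ in {ξ | ‖ξ - x‖ < δ},
        (g ξ - g x - diffusionOp (ξ - x).ofLp (fun i j => (ξ - x) i * (ξ - x) j) g x) ∂μ|
      ≤ ε * ∑ i, truncCov μ x δ i i := by
  have square (i : Fin d) := integrableOn_sub_apply_mul (μ := μ) (x := x) (δ := δ) i i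
  simp only [truncCov]
  rw [← integral_finsetSum _ fun i _ => square i, ← integral_const_mul, ← Real.norm_eq_abs]
  refine norm_integral_le_of_norm_le
    ((integrable_finsetSum _ fun i _ => square i).const_mul ε)
    ((ae_restrict_iff' (measurableSet_norm_sub_lt x δ)).2 (ae_of_all _ fun ξ hξ => ?_))
  rw [diffusionOp_increment, Real.norm_eq_abs]
  refine (abs_sub_taylor_two_le hg h hξ).trans_eq ?_
  rw [EuclideanSpace.real_norm_sq_eq]
  simp only [pow_two]

theorem abs_setIntegral_compl_sub_le (hδ : 0 < δ) (hM : ∀ ξ, ‖g ξ‖ ≤ M) :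
    |∫ ξ in {ξ | ‖ξ - x‖ < δ}ᶜ, (g ξ - g x) ∂μ| ≤ 2 * M * μ.real {ξ | δ / 2 < ‖ξ - x‖} := by
  refine (norm_setIntegral_le_of_norm_le_const (C := 2 * M) (measure_lt_top _ _) fun ξ _ =>
    (norm_sub_le_of_le (hM ξ) (hM x)).trans_eq (two_mul M).symm).trans ?_
  have hM0 : 0 ≤ M := (norm_nonneg _).trans (hM x)
  have subset : {ξ | ‖ξ - x‖ < δ}ᶜ ⊆ {ξ | δ / 2 < ‖ξ - x‖} := fun ξ hξ =>
    (half_lt_self hδ).trans_le (not_lt.1 hξ)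
  gcongr
  finiteness

theorem abs_integral_sub_diffusionOp_le (hg : ContDiff ℝ 2 g) {ε : ℝ} (hδ : 0 < δ)
    (hM : ∀ ξ, ‖g ξ‖ ≤ M)
    (h : ∀ y, ‖y - x‖ < δ → ‖fderiv ℝ (fderiv ℝ g) y - fderiv ℝ (fderiv ℝ g) x‖ ≤ ε) :
    |∫ ξ, (g ξ - g x) ∂μ - diffusionOp (truncMean μ x δ) (truncCov μ x δ) g x|
      ≤ ε * ∑ i, truncCov μ x δ i i + 2 * M * μ.real {ξ | δ / 2 < ‖ξ - x‖} := by
  have integrable : Integrable (fun ξ => g ξ - g x) μ :=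
    (Integrable.of_bound hg.continuous.aestronglyMeasurable M (ae_of_all _ hM)).sub
      (integrable_const _)
  have near := abs_setIntegral_sub_diffusionOp_le (μ := μ) hg h
  rw [integral_sub integrable.integrableOn (integrableOn_diffusionOp_increment g),
    setIntegral_diffusionOp_increment] at near
  rw [← integral_add_compl (measurableSet_norm_sub_lt x δ) integrable, add_sub_right_comm]
  exact (abs_add_le _ _).trans (add_le_add near (abs_setIntegral_compl_sub_le hδ hM))

end TruncatedMoments

section LocalMoments

variable {d : ℕ} {κ : ℝ → Kernel (Euc d) (Euc d)} {D H : Set (Euc d)} {β : Euc d → Fin d → ℝ}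
  {A : Euc d → Fin d → Fin d → ℝ} {g : Euc d → ℝ}

/-- As `h → 0⁺`, the kernels `κ h` have the infinitesimal jumps, drift `β` and diffusion matrix `A`
of a local diffusion on `D`. This is what `IsLocalDiffusion` says at a fixed time, about the
transition kernels over an interval of length `h` that starts or ends there. -/
structure HasLocalMoments (κ : ℝ → Kernel (Euc d) (Euc d)) (D : Set (Euc d))
    (β : Euc d → Fin d → ℝ) (A : Euc d → Fin d → Fin d → ℝ) : Prop where
  isMarkovKernel : ∀ᶠ h in 𝓝[>] (0 : ℝ), IsMarkovKernel (κ h)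
  bounded_diffusion : ∀ i, ∀ H : Set (Euc d), IsCompact H → H ⊆ D → ∃ C, ∀ x ∈ H, |A x i i| ≤ C
  jump_into : ∀ δ : ℝ, 0 < δ → ∀ H : Set (Euc d), IsCompact H → H ⊆ D → TendstoUniformlyOn
    (fun h x => (κ h x).real ({ξ | δ < ‖ξ - x‖} ∩ H) / h) (fun _ => 0) (𝓝[>] 0) univ
  jump_from : ∀ δ : ℝ, 0 < δ → ∀ H : Set (Euc d), IsCompact H → H ⊆ D → TendstoUniformlyOn
    (fun h x => (κ h x).real {ξ | δ < ‖ξ - x‖} / h) (fun _ => 0) (𝓝[>] 0) H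
  drift : ∀ δ : ℝ, 0 < δ → ∀ H : Set (Euc d), IsCompact H → H ⊆ D → ∀ i, TendstoUniformlyOn
    (fun h x => truncMean (κ h x) x δ i / h) (fun x => β x i) (𝓝[>] 0) H
  diffusion : ∀ δ : ℝ, 0 < δ → ∀ H : Set (Euc d), IsCompact H → H ⊆ D → ∀ i j, TendstoUniformlyOn
    (fun h x => truncCov (κ h x) x δ i j / h) (fun x => A x i j) (𝓝[>] 0) H

namespace HasLocalMoments

theorem exists_eventually_trace_le (hκ : HasLocalMoments κ D β A) (hH : IsCompact H)
    (hHD : H ⊆ D) : ∃ C : ℝ, ∀ δ, 0 < δ →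
      ∀ᶠ h in 𝓝[>] (0 : ℝ), ∀ x ∈ H, (∑ i, truncCov (κ h x) x δ i i) / h ≤ C := by
  choose C hC using fun i => hκ.bounded_diffusion i H hH hHD
  refine ⟨∑ i, (C i + 1), fun δ hδ => ?_⟩
  have close := eventually_all.2 fun i =>
    Metric.tendstoUniformlyOn_iff.1 (hκ.diffusion δ hδ H hH hHD i i) 1 one_pos
  filter_upwards [close] with h hh x hx
  rw [Finset.sum_div]
  refine Finset.sum_le_sum fun i _ => ?_
  linarith [(abs_lt.1 (hh i x hx)).1, (le_abs_self _).trans (hC i x hx)]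

theorem tendstoUniformlyOn_diffusionOp (hκ : HasLocalMoments κ D β A) (hH : IsCompact H)
    (hHD : H ⊆ D) {M : ℝ} (hM : ∀ x, ‖fderiv ℝ g x‖ ≤ M)
    (hM' : ∀ x, ‖fderiv ℝ (fderiv ℝ g) x‖ ≤ M) {δ : ℝ} (hδ : 0 < δ) :
    TendstoUniformlyOn
      (fun h x => diffusionOp (truncMean (κ h x) x δ) (truncCov (κ h x) x δ) g x / h)
      (fun x => diffusionOp (β x) (A x) g x) (𝓝[>] 0) H := by
  rw [Metric.tendstoUniformlyOn_iff]
  intro ε hε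
  obtain ⟨η, hη, hηε⟩ := exists_pos_mul_lt hε (M * (d + d ^ 2))
  have drift := eventually_all.2 fun i =>
    Metric.tendstoUniformlyOn_iff.1 (hκ.drift δ hδ H hH hHD i) η hη
  have diffusion := eventually_all.2 fun i => eventually_all.2 fun j =>
    Metric.tendstoUniformlyOn_iff.1 (hκ.diffusion δ hδ H hH hHD i j) η hη
  filter_upwards [drift, diffusion] with h hm hc x hx
  rw [← diffusionOp_div, Real.dist_eq, ← diffusionOp_sub]
  refine (abs_diffusionOp_le hη.le (fun i => (hm i x hx).le) (fun i j => (hc i j x hx).le)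
    (hM x) (hM' x)).trans_lt ?_
  rwa [mul_comm]

theorem exists_eventually_taylor_error_le (hκ : HasLocalMoments κ D β A) (hH : IsCompact H)
    (hHD : H ⊆ D) (hg : ContDiff ℝ 2 g) (hgc : HasCompactSupport g) {ε : ℝ} (hε : 0 < ε) :
    ∃ δ > 0, ∀ᶠ h in 𝓝[>] (0 : ℝ), ∀ x ∈ H, |(∫ ξ, (g ξ - g x) ∂(κ h x)) / h
      - diffusionOp (truncMean (κ h x) x δ) (truncCov (κ h x) x δ) g x / h| < ε := by
  obtain ⟨M, hM⟩ := hg.continuous.bounded_above_of_compact_support hgc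
  obtain ⟨C, hC⟩ := hκ.exists_eventually_trace_le hH hHD
  obtain ⟨ε₁, hε₁, hCε⟩ := exists_pos_mul_lt (half_pos hε) C
  obtain ⟨η, hη, hMη⟩ := exists_pos_mul_lt (half_pos hε) (2 * M)
  obtain ⟨δ, hδ, modulus⟩ := exists_norm_fderiv_fderiv_sub_le hg hgc hε₁
  refine ⟨δ, hδ, ?_⟩
  have jumps := Metric.tendstoUniformlyOn_iff.1 (hκ.jump_from (δ / 2) (half_pos hδ) H hH hHD) η hη
  filter_upwards [hC δ hδ, jumps, hκ.isMarkovKernel, self_mem_nhdsWithin]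
    with h trace_le jump_lt _ hh x hx
  have hh : 0 < h := hh
  have jump_le : (κ h x).real {ξ | δ / 2 < ‖ξ - x‖} / h ≤ η := by
    simpa using (le_abs_self _).trans (by simpa [Real.dist_eq] using (jump_lt x hx).le)
  have hM0 : 0 ≤ M := (norm_nonneg _).trans (hM x)
  calc _ ≤ (ε₁ * ∑ i, truncCov (κ h x) x δ i i
          + 2 * M * (κ h x).real {ξ | δ / 2 < ‖ξ - x‖}) / h := by
        rw [← sub_div, abs_div, abs_of_pos hh]
        gcongr
        exact abs_integral_sub_diffusionOp_le hg hδ hM (modulus x)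
    _ = ε₁ * ((∑ i, truncCov (κ h x) x δ i i) / h)
          + 2 * M * ((κ h x).real {ξ | δ / 2 < ‖ξ - x‖} / h) := by ring
    _ ≤ ε₁ * C + 2 * M * η := by gcongr; exact trace_le x hx
    _ < ε := by linarith

theorem tendstoUniformlyOn_generator (hκ : HasLocalMoments κ D β A) (hH : IsCompact H)
    (hHD : H ⊆ D) (hg : ContDiff ℝ 2 g) (hgc : HasCompactSupport g) :
    TendstoUniformlyOn (fun h x => (∫ ξ, (g ξ - g x) ∂(κ h x)) / h)
      (fun x => diffusionOp (β x) (A x) g x) (𝓝[>] 0) H := by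
  have hg1 : ContDiff ℝ 1 (fderiv ℝ g) := hg.fderiv_right (by norm_num)
  obtain ⟨M, hM⟩ := hg1.continuous.bounded_above_of_compact_support (hgc.fderiv ℝ)
  obtain ⟨M', hM'⟩ := (hg1.continuous_fderiv one_ne_zero).bounded_above_of_compact_support
    ((hgc.fderiv ℝ).fderiv ℝ)
  rw [Metric.tendstoUniformlyOn_iff]
  intro ε hε
  obtain ⟨δ, hδ, taylor⟩ := hκ.exists_eventually_taylor_error_le hH hHD hg hgc (half_pos hε)
  have moments := Metric.tendstoUniformlyOn_iff.1 (hκ.tendstoUniformlyOn_diffusionOp hH hHD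
    (fun x => (hM x).trans (le_max_left M M')) (fun x => (hM' x).trans (le_max_right M M')) hδ)
    (ε / 2) (half_pos hε)
  filter_upwards [taylor, moments] with h h₁ h₂ x hx
  refine (dist_triangle_right _ _ _).trans_lt ((add_lt_add (h₂ x hx) (h₁ x hx)).trans_eq ?_)
  exact add_halves ε

/-- Starting away from the support of `g`, only the jumps into that support contribute. -/
theorem tendstoUniformlyOn_generator_far (hκ : HasLocalMoments κ D β A) (hg : Continuous g)
    (hgc : HasCompactSupport g) (hgD : tsupport g ⊆ D) {δ : ℝ} (hδ : 0 < δ) :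
    TendstoUniformlyOn (fun h x => (∫ ξ, (g ξ - g x) ∂(κ h x)) / h)
      (fun x => diffusionOp (β x) (A x) g x) (𝓝[>] 0) (Metric.cthickening δ (tsupport g))ᶜ := by
  obtain ⟨M, hM⟩ := hg.bounded_above_of_compact_support hgc
  rw [Metric.tendstoUniformlyOn_iff]
  intro ε hε
  obtain ⟨η, hη, hηε⟩ := exists_pos_mul_lt hε M
  filter_upwards [Metric.tendstoUniformlyOn_iff.1 (hκ.jump_into δ hδ _ hgc hgD) η hη,
    hκ.isMarkovKernel, self_mem_nhdsWithin] with h jump_lt _ hh x hx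
  have hh : 0 < h := hh
  have off_support : x ∉ tsupport g := fun h => hx (Metric.self_subset_cthickening _ h)
  have far (ξ : Euc d) (hξ : ξ ∈ tsupport g) : δ < ‖ξ - x‖ := by
    by_contra! near
    exact hx (Metric.mem_cthickening_of_dist_le x ξ δ _ hξ (by rwa [dist_comm, dist_eq_norm]))
  have jump_le : (κ h x).real ({ξ | δ < ‖ξ - x‖} ∩ tsupport g) / h ≤ η := by
    simpa using (le_abs_self _).trans (by simpa [Real.dist_eq] using (jump_lt x trivial).le)
  have integral_eq : ∫ ξ, (g ξ - g x) ∂(κ h x)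
      = ∫ ξ in {ξ | δ < ‖ξ - x‖} ∩ tsupport g, g ξ ∂(κ h x) := by
    simp only [image_eq_zero_of_notMem_tsupport off_support, sub_zero]
    refine (setIntegral_eq_integral_of_forall_compl_eq_zero fun ξ hξ => ?_).symm
    exact image_eq_zero_of_notMem_tsupport fun hξ' => hξ ⟨far ξ hξ', hξ'⟩
  rw [diffusionOp_eq_zero off_support, dist_zero_left, integral_eq, norm_div,
    Real.norm_of_nonneg hh.le]
  calc _ ≤ M * (κ h x).real ({ξ | δ < ‖ξ - x‖} ∩ tsupport g) / h := by
        gcongr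
        exact norm_setIntegral_le_of_norm_le_const (measure_lt_top _ _) fun ξ _ => hM ξ
    _ ≤ M * η := by
        rw [mul_div_assoc]
        exact mul_le_mul_of_nonneg_left jump_le ((norm_nonneg _).trans (hM x))
    _ < ε := hηε

theorem tendstoUniformly_generator (hκ : HasLocalMoments κ D β A) (hD : IsOpen D)
    (hg : ContDiff ℝ 2 g) (hgc : HasCompactSupport g) (hgD : tsupport g ⊆ D) :
    TendstoUniformly (fun h x => (∫ ξ, (g ξ - g x) ∂(κ h x)) / h)
      (fun x => diffusionOp (β x) (A x) g x) (𝓝[>] 0) := by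
  obtain ⟨δ, hδ, thickening⟩ := hgc.isCompact.exists_cthickening_subset_open hD hgD
  have near := Metric.tendstoUniformlyOn_iff.1
    (hκ.tendstoUniformlyOn_generator hgc.isCompact.cthickening thickening hg hgc)
  have far := Metric.tendstoUniformlyOn_iff.1
    (hκ.tendstoUniformlyOn_generator_far hg.continuous hgc hgD hδ)
  rw [Metric.tendstoUniformly_iff]
  intro ε hε
  filter_upwards [near ε hε, far ε hε] with h h_near h_far x
  by_cases hx : x ∈ Metric.cthickening δ (tsupport g)
  · exact h_near x hx
  · exact h_far x hx

end HasLocalMoments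

end LocalMoments

/-- The bounded measurable functions, the class of test functions of the Markov property. -/
def BoundedMeasurable {α : Type*} [m : MeasurableSpace α] (g : α → ℝ) : Prop :=
  Measurable g ∧ ∃ C, ∀ x, |g x| ≤ C

section BoundedMeasurable

variable {α : Type*} {mα : MeasurableSpace α} {g u : α → ℝ}

namespace BoundedMeasurable

theorem const (c : ℝ) : BoundedMeasurable fun _ : α => c := ⟨measurable_const, |c|, fun _ => le_rfl⟩

theorem add (hg : BoundedMeasurable g) (hu : BoundedMeasurable u) :
    BoundedMeasurable fun x => g x + u x :=
  let ⟨C, hC⟩ := hg.2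
  let ⟨C', hC'⟩ := hu.2
  ⟨hg.1.add hu.1, C + C', fun x => (abs_add_le _ _).trans (add_le_add (hC x) (hC' x))⟩

theorem mul (hg : BoundedMeasurable g) (hu : BoundedMeasurable u) :
    BoundedMeasurable fun x => g x * u x :=
  let ⟨C, hC⟩ := hg.2
  let ⟨C', hC'⟩ := hu.2
  ⟨hg.1.mul hu.1, C * C', fun x => (abs_mul _ _).trans_le <|
    mul_le_mul (hC x) (hC' x) (abs_nonneg _) ((abs_nonneg _).trans (hC x))⟩

theorem sub (hg : BoundedMeasurable g) (hu : BoundedMeasurable u) :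
    BoundedMeasurable fun x => g x - u x := by
  simpa [sub_eq_add_neg] using hg.add ((const (-1)).mul hu)

theorem sum {ι : Type*} [Fintype ι] {v : ι → α → ℝ} (h : ∀ i, BoundedMeasurable (v i)) :
    BoundedMeasurable fun x => ∑ i, v i x := by
  choose C hC using fun i => (h i).2
  exact ⟨Finset.measurable_fun_sum _ fun i _ => (h i).1, ∑ i, C i, fun x =>
    (Finset.abs_sum_le_sum_abs _ _).trans (Finset.sum_le_sum fun i _ => hC i x)⟩

theorem comp {β : Type*} {_ : MeasurableSpace β} (hg : BoundedMeasurable g) {k : β → α}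
    (hk : Measurable k) : BoundedMeasurable fun y => g (k y) :=
  ⟨hg.1.comp hk, hg.2.imp fun _ hC y => hC (k y)⟩

theorem mono {m : MeasurableSpace α} (hg : BoundedMeasurable (m := m) g) (hm : m ≤ mα) :
    BoundedMeasurable (m := mα) g :=
  ⟨Measurable.mono hg.1 hm le_rfl, hg.2⟩

theorem memLp {μ : Measure α} [IsFiniteMeasure μ] (hg : BoundedMeasurable g) (q : ℝ≥0∞) :
    MemLp g q μ :=
  let ⟨C, hC⟩ := hg.2
  .of_bound hg.1.aestronglyMeasurable C (ae_of_all _ hC)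

theorem integrable {μ : Measure α} [IsFiniteMeasure μ] (hg : BoundedMeasurable g) :
    Integrable g μ :=
  memLp_one_iff_integrable.1 (hg.memLp 1)

end BoundedMeasurable

theorem eventually_abs_le_of_zero_off {Z : Type*} [TopologicalSpace Z] [R1Space Z] {g : Z → ℝ}
    {K : Set Z} (hK : IsCompact K) (hg : Continuous g) (hg0 : ∀ z ∉ K, g z = 0) :
    ∀ᶠ C in atTop, ∀ z, |g z| ≤ C :=
  let ⟨C, hC⟩ := hg.bounded_above_of_compact_support (HasCompactSupport.intro hK hg0)
  (eventually_ge_atTop C).mono fun _ h z => (hC z).trans h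

theorem boundedMeasurable_of_zero_off {Z : Type*} [TopologicalSpace Z] [R1Space Z]
    [MeasurableSpace Z] [OpensMeasurableSpace Z] {g : Z → ℝ} {K : Set Z} (hK : IsCompact K)
    (hg : Continuous g) (hg0 : ∀ z ∉ K, g z = 0) : BoundedMeasurable g :=
  ⟨hg.measurable, (eventually_abs_le_of_zero_off hK hg hg0).exists⟩

end BoundedMeasurable

/-! ### The operator on compactly supported functions -/

section Operator

variable {p₀ d : ℕ} {hp : p₀ ≤ d} {B : Matrix (Fin d) (Fin d) ℝ} {T₀ : ℝ} {D : Set (Euc d)}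
  {a : Fin p₀ → Fin p₀ → ℝ × Euc d → ℝ} {b : Fin p₀ → ℝ × Euc d → ℝ} {K : Set (ℝ × Euc d)}
  {f : ℝ × Euc d → ℝ}

theorem LocBounded.eventually_abs_le {c : ℝ × Euc d → ℝ} (hc : LocBounded T₀ D c)
    (hK : IsCompact K) (hKD : K ⊆ Ioo 0 T₀ ×ˢ D) : ∀ᶠ C in atTop, ∀ z ∈ K, |c z| ≤ C :=
  let ⟨C, hC⟩ := hc.2 K hK (hKD.trans (prod_mono Ioo_subset_Ico_self subset_rfl))
  (eventually_ge_atTop C).mono fun _ h z hz => (hC z hz).trans h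

theorem LocBounded.boundedMeasurable_mul {c : ℝ × Euc d → ℝ} (hc : LocBounded T₀ D c)
    (hD : IsOpen D) (hK : IsCompact K) (hKD : K ⊆ Ioo 0 T₀ ×ˢ D) {u : ℝ × Euc d → ℝ}
    (hu : BoundedMeasurable u) (hu0 : ∀ z ∉ K, u z = 0) :
    BoundedMeasurable fun z => c z * u z := by
  have hS : MeasurableSet (Ico 0 T₀ ×ˢ D : Set (ℝ × Euc d)) :=
    measurableSet_Ico.prod hD.measurableSet
  have zero_off : ((Ico 0 T₀ ×ˢ D : Set (ℝ × Euc d))ᶜ).domRestrict (fun z => c z * u z) = 0 := by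
    funext z
    have : u z = 0 := hu0 z fun hz => z.2 ⟨Ioo_subset_Ico_self (hKD hz).1, (hKD hz).2⟩
    simp [this]
  obtain ⟨A, hA, hA0⟩ := ((hc.eventually_abs_le hK hKD).and (eventually_ge_atTop 0)).exists
  obtain ⟨C, hC⟩ := hu.2
  refine ⟨measurable_of_restrict_of_restrict_compl hS (hc.1.mul (hu.1.comp measurable_subtype_coe))
    (zero_off ▸ measurable_const), A * C, fun z => ?_⟩
  by_cases hz : z ∈ K
  · rw [abs_mul]
    exact mul_le_mul (hA z hz) (hC z) (abs_nonneg _) hA0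
  · simpa [hu0 z hz] using mul_nonneg hA0 ((abs_nonneg _).trans (hC z))

/-- The function and its intrinsic derivatives of order at most two are bounded by `C`. -/
structure IntrinsicBound (hp : p₀ ≤ d) (B : Matrix (Fin d) (Fin d) ℝ) (C : ℝ)
    (f : ℝ × Euc d → ℝ) : Prop where
  abs_le : ∀ z, |f z| ≤ C
  abs_dx_le : ∀ i z, |derivDx hp i f z| ≤ C
  abs_dxx_le : ∀ i j z, |derivDx hp i (derivDx hp j f) z| ≤ C
  abs_y_le : ∀ z, |derivY B f z| ≤ C

theorem IntrinsicC2.exists_intrinsicBound (hf : IntrinsicC2 hp B f) (hK : IsCompact K)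
    (hf0 : ∀ z ∉ K, f z = 0) : ∃ C, IntrinsicBound hp B C f := by
  have zero_dx := fun i => derivDx_eq_zero_off (hp := hp) hK.isClosed hf0 i
  obtain ⟨C, h, hx, hxx, hy⟩ := ((eventually_abs_le_of_zero_off hK hf.cont hf0).and <|
    (eventually_all.2 fun i => eventually_abs_le_of_zero_off hK (hf.contDx i) (zero_dx i)).and <|
    (eventually_all.2 fun i => eventually_all.2 fun j => eventually_abs_le_of_zero_off hK
      (hf.contDxx i j) (derivDx_eq_zero_off hK.isClosed (zero_dx j) i)).and <|
    eventually_abs_le_of_zero_off hK hf.contY (derivY_eq_zero_off hK.isClosed hf0)).exists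
  exact ⟨C, h, hx, hxx, hy⟩

theorem opL_eq_zero_off (hK : IsClosed K) (hf0 : ∀ z ∉ K, f z = 0) {z : ℝ × Euc d} (hz : z ∉ K) :
    opL hp B a b f z = 0 := by
  have zero_dx := fun i => derivDx_eq_zero_off (hp := hp) hK hf0 i
  simp [opL, zero_dx _ z hz, derivDx_eq_zero_off hK (zero_dx _) _ z hz,
    derivY_eq_zero_off hK hf0 z hz]

theorem abs_opL_le {A C : ℝ} {z : ℝ × Euc d} (hA : 0 ≤ A) (ha : ∀ i j, |a i j z| ≤ A)
    (hb : ∀ i, |b i z| ≤ A) (hf : IntrinsicBound hp B C f) :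
    |opL hp B a b f z| ≤ 1 / 2 * (p₀ * (p₀ * (A * C))) + p₀ * (A * C) + C := by
  have second := abs_sum_le_card_mul fun i => abs_sum_le_card_mul fun j => (abs_mul _ _).trans_le <|
    mul_le_mul (ha i j) (hf.abs_dxx_le i j z) (abs_nonneg _) hA
  have first := abs_sum_le_card_mul fun i => (abs_mul _ _).trans_le <|
    mul_le_mul (hb i) (hf.abs_dx_le i z) (abs_nonneg _) hA
  simp only [Fintype.card_fin] at first second
  refine (abs_add_le _ _).trans (add_le_add ((abs_add_le _ _).trans (add_le_add ?_ first))
    (hf.abs_y_le z))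
  rw [abs_mul, abs_of_pos one_half_pos]
  gcongr

theorem exists_bound_opL (ha : ∀ i j, LocBounded T₀ D (a i j)) (hb : ∀ i, LocBounded T₀ D (b i))
    (hK : IsCompact K) (hKD : K ⊆ Ioo 0 T₀ ×ˢ D) (C : ℝ) :
    ∃ C', ∀ f : ℝ × Euc d → ℝ, (∀ z ∉ K, f z = 0) → IntrinsicBound hp B C f →
      ∀ z, |opL hp B a b f z| ≤ C' := by
  obtain ⟨A, haA, hbA, hA⟩ := ((eventually_all.2 fun i => eventually_all.2 fun j =>
    (ha i j).eventually_abs_le hK hKD).and <| (eventually_all.2 fun i =>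
    (hb i).eventually_abs_le hK hKD).and (eventually_ge_atTop 0)).exists
  refine ⟨1 / 2 * (p₀ * (p₀ * (A * C))) + p₀ * (A * C) + C, fun f hf0 hf z => ?_⟩
  by_cases hz : z ∈ K
  · exact abs_opL_le hA (fun i j => haA i j z hz) (fun i => hbA i z hz) hf
  · have hC : 0 ≤ C := (abs_nonneg _).trans (hf.abs_le z)
    rw [opL_eq_zero_off hK.isClosed hf0 hz, abs_zero]
    positivity

section Measurability

variable (hD : IsOpen D) (hK : IsCompact K) (hKD : K ⊆ Ioo 0 T₀ ×ˢ D)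
  (ha : ∀ i j, LocBounded T₀ D (a i j)) (hf : IntrinsicC2 hp B f) (hf0 : ∀ z ∉ K, f z = 0)

include hK hf hf0

theorem IntrinsicC2.boundedMeasurable_derivDx (i : Fin p₀) : BoundedMeasurable (derivDx hp i f) :=
  boundedMeasurable_of_zero_off hK (hf.contDx i) (derivDx_eq_zero_off hK.isClosed hf0 i)

include hD hKD ha

theorem IntrinsicC2.boundedMeasurable_opL (hb : ∀ i, LocBounded T₀ D (b i)) :
    BoundedMeasurable (opL hp B a b f) := by
  have zero_dx := fun i => derivDx_eq_zero_off (hp := hp) hK.isClosed hf0 i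
  have zero_dxx := fun i j => derivDx_eq_zero_off (hp := hp) hK.isClosed (zero_dx j) i
  have second : BoundedMeasurable fun z => ∑ i, ∑ j, a i j z * derivDx hp i (derivDx hp j f) z :=
    .sum fun i => .sum fun j => (ha i j).boundedMeasurable_mul hD hK hKD
      (boundedMeasurable_of_zero_off hK (hf.contDxx i j) (zero_dxx i j)) (zero_dxx i j)
  have first : BoundedMeasurable fun z => ∑ i, b i z * derivDx hp i f z :=
    .sum fun i => (hb i).boundedMeasurable_mul hD hK hKD
      (hf.boundedMeasurable_derivDx hK hf0 i) (zero_dx i)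
  exact (((BoundedMeasurable.const _).mul second).add first).add
    (boundedMeasurable_of_zero_off hK hf.contY (derivY_eq_zero_off hK.isClosed hf0))

theorem IntrinsicC2.boundedMeasurable_energyDensity : BoundedMeasurable (energyDensity hp a f) :=
  .sum fun i => .sum fun j => ((ha i j).boundedMeasurable_mul hD hK hKD
    (hf.boundedMeasurable_derivDx hK hf0 i) (derivDx_eq_zero_off hK.isClosed hf0 i)).mul
      (hf.boundedMeasurable_derivDx hK hf0 j)

end Measurability

theorem sum_dite_lt (hp : p₀ ≤ d) (u : Fin p₀ → ℝ) (c : Fin d → ℝ) :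
    ∑ i : Fin d, (if h : (i : ℕ) < p₀ then u ⟨i, h⟩ else 0) * c i
      = ∑ i : Fin p₀, u i * c (Fin.castLE hp i) := by
  obtain ⟨k, rfl⟩ := Nat.exists_eq_add_of_le hp
  simp only [dite_mul, zero_mul, Fin.sum_univ_add, Fin.val_castAdd, Fin.is_lt, ↓reduceDIte, Fin.eta,
    Fin.val_natAdd, add_lt_iff_neg_left, not_lt_zero, Finset.sum_const_zero, add_zero]
  rfl

theorem sum_sum_dite_lt (hp : p₀ ≤ d) (u : Fin p₀ → Fin p₀ → ℝ) (c : Fin d → Fin d → ℝ) :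
    ∑ i : Fin d, ∑ j : Fin d,
        (if h : (i : ℕ) < p₀ ∧ (j : ℕ) < p₀ then u ⟨i, h.1⟩ ⟨j, h.2⟩ else 0) * c i j
      = ∑ i : Fin p₀, ∑ j : Fin p₀, u i j * c (Fin.castLE hp i) (Fin.castLE hp j) := by
  obtain ⟨k, rfl⟩ := Nat.exists_eq_add_of_le hp
  simp only [dite_mul, zero_mul, Fin.sum_univ_add, Fin.val_castAdd, Fin.is_lt, and_true, Fin.eta,
    Finset.sum_dite_irrel, Finset.sum_const_zero, Fin.val_natAdd, add_lt_iff_neg_left, not_lt_zero,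
    and_false, ↓reduceDIte, add_zero]
  rfl

theorem derivDx_eq_fderiv {s : ℝ} (hf : Differentiable ℝ fun x => f (s, x)) (i : Fin p₀)
    (x : Euc d) : derivDx hp i f (s, x) = fderiv ℝ (fun x => f (s, x)) x (basisVec hp i) :=
  (hf x).lineDeriv_eq_fderiv

theorem derivDx_derivDx_eq_fderiv {s : ℝ} (hf : ContDiff ℝ 2 fun x => f (s, x)) (i j : Fin p₀)
    (x : Euc d) : derivDx hp i (derivDx hp j f) (s, x)
      = fderiv ℝ (fderiv ℝ fun x => f (s, x)) x (basisVec hp i) (basisVec hp j) := by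
  have hDf : Differentiable ℝ (fderiv ℝ fun x => f (s, x)) :=
    (hf.fderiv_right (m := 1) (by norm_num)).differentiable (by norm_num)
  have slice : (fun x => derivDx hp j f (s, x))
      = fun x => fderiv ℝ (fun x => f (s, x)) x (basisVec hp j) :=
    funext (derivDx_eq_fderiv (hf.differentiable (by norm_num)) j)
  have hslice : Differentiable ℝ fun x => derivDx hp j f (s, x) := by rw [slice]; fun_prop
  rw [derivDx_eq_fderiv hslice, slice, fderiv_clm_apply (hDf x) (by fun_prop)]
  simp

/-- The local drift `(1_{i ≤ p₀} b_i(s,x) + (Bx)_i)_i`. -/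
noncomputable def driftAt (B : Matrix (Fin d) (Fin d) ℝ) (b : Fin p₀ → ℝ × Euc d → ℝ) (s : ℝ)
    (x : Euc d) (i : Fin d) : ℝ :=
  (if h : (i : ℕ) < p₀ then b ⟨i, h⟩ (s, x) else 0) + matOp B x i

/-- The local covariance `(1_{i,j ≤ p₀} a_{ij}(s,x))_{ij}`. -/
noncomputable def diffusionAt (a : Fin p₀ → Fin p₀ → ℝ × Euc d → ℝ) (s : ℝ) (x : Euc d)
    (i j : Fin d) : ℝ :=
  if h : (i : ℕ) < p₀ ∧ (j : ℕ) < p₀ then a ⟨i, h.1⟩ ⟨j, h.2⟩ (s, x) else 0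

theorem diffusionOp_eq_opL {s : ℝ} (hf : ContDiff ℝ 2 fun x => f (s, x)) (x : Euc d) :
    diffusionOp (driftAt B b s x) (diffusionAt a s x) (fun x => f (s, x)) x
      = opL hp B a b f (s, x) - derivY B f (s, x)
        + fderiv ℝ (fun x => f (s, x)) x (matOp B x) := by
  rw [clm_apply_eq_sum_single (fderiv ℝ (fun x => f (s, x)) x) (matOp B x)]
  simp only [diffusionOp, driftAt, diffusionAt, add_mul, Finset.sum_add_distrib, opL]
  rw [sum_dite_lt hp fun i => b i (s, x), sum_sum_dite_lt hp fun i j => a i j (s, x)]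
  simp only [derivDx_derivDx_eq_fderiv hf, derivDx_eq_fderiv (hf.differentiable two_ne_zero),
    basisVec, smul_eq_mul, mul_comm (matOp B x _)]
  ring

variable {Ω : Type*} {M : ContMarkovProcess d T₀ Ω}

theorem IsLocalDiffusion.hasLocalMoments (hM : IsLocalDiffusion hp M D B a b) {s : ℝ} (hs : 0 ≤ s)
    (hsT : s < T₀) :
    HasLocalMoments (fun h => M.p s (s + h)) D (driftAt B b s) (diffusionAt a s) where
  isMarkovKernel := by
    filter_upwards [Ioo_mem_nhdsGT (sub_pos.2 hsT)] with h hh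
    exact M.isMarkovKernel s (s + h) hs (by linarith [hh.1]) (by linarith [hh.2])
  bounded_diffusion i H hH hHD := by
    by_cases h : (i : ℕ) < p₀
    · obtain ⟨C, hC⟩ := (hM.locBounded_a ⟨i, h⟩ ⟨i, h⟩).2 (({s} : Set ℝ) ×ˢ H)
        (isCompact_singleton.prod hH)
        (Set.prod_mono (Set.singleton_subset_iff.2 ⟨hs, hsT⟩) hHD)
      exact ⟨C, fun x hx => by simpa [diffusionAt, h] using hC (s, x) ⟨rfl, hx⟩⟩
    · exact ⟨0, fun x _ => by simp [diffusionAt, h]⟩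
  jump_into δ hδ H hH hHD := by
    simpa only [add_sub_cancel_left] using (hM.lim_jump_into s hs hsT δ hδ H hH hHD).1
  jump_from δ hδ H hH hHD := by
    simpa only [add_sub_cancel_left] using (hM.lim_jump_from s hs hsT δ hδ H hH hHD).1
  drift δ hδ H hH hHD i := by
    simpa only [truncMean, driftAt, add_sub_cancel_left] using
      (hM.lim_drift s hs hsT δ hδ H hH hHD i).1
  diffusion δ hδ H hH hHD i j := by
    simpa only [truncCov, diffusionAt, add_sub_cancel_left] using
      (hM.lim_diffusion s hs hsT δ hδ H hH hHD i j).1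

end Operator

/-! ### Markov processes under a fixed law -/

/-- Under the law `P`, the process `Z` on `[t, T₀[` has continuous paths, is adapted to `F` and is
Markov with transition kernels `p`. This is what remains of a `ContMarkovProcess` once the starting
point is fixed. -/
structure IsMarkovUnder {Ω E : Type*} {mΩ : MeasurableSpace Ω} [MeasurableSpace E]
    [TopologicalSpace E] (P : Measure Ω) (F : ℝ → MeasurableSpace Ω) (Z : ℝ → Ω → E)
    (p : ℝ → ℝ → Kernel E E) (t T₀ : ℝ) : Prop where
  le : ∀ s ∈ Ico t T₀, F s ≤ mΩ
  mono : ∀ s ∈ Ico t T₀, ∀ T ∈ Ico t T₀, s ≤ T → F s ≤ F T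
  adapted : ∀ s ∈ Ico t T₀, Measurable[F s] (Z s)
  cont : ∀ ω, ContinuousOn (fun s => Z s ω) (Ico t T₀)
  kernel : ∀ s T, t ≤ s → s < T → T < T₀ → IsMarkovKernel (p s T)
  markov : ∀ s T, t ≤ s → s < T → T < T₀ → ∀ A : Set E, MeasurableSet A →
    P⟦Z T ⁻¹' A | F s⟧ =ᵐ[P] fun ω => (p s T (Z s ω)).real A

/-- The path frozen outside `[t, T]`, which is continuous on the whole line. -/
def clampPath {Ω E : Type*} (Z : ℝ → Ω → E) (t T : ℝ) (u : ℝ) (ω : Ω) : E :=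
  Z (max t (min u T)) ω

theorem clampPath_eq {Ω E : Type*} {Z : ℝ → Ω → E} {t T u : ℝ} (hu : u ∈ Icc t T) :
    clampPath Z t T u = Z u := by
  funext ω
  rw [clampPath, min_eq_left hu.2, max_eq_right hu.1]

theorem integral_comp_clampPath {Ω E : Type*} {Z : ℝ → Ω → E} {t r T : ℝ} {L : ℝ × E → ℝ}
    (hr : t ≤ r) (hrT : r ≤ T) (ω : Ω) : ∫ u in r..T, L (u, Z u ω) =
      ∫ u in r..T, L (u, clampPath Z t T u ω) := by
  refine intervalIntegral.integral_congr fun u hu => ?_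
  rw [uIcc_of_le hrT] at hu
  simp only [clampPath_eq (Icc_subset_Icc_left hr hu)]

section Markov

variable {Ω E : Type*} {mΩ : MeasurableSpace Ω} [MeasurableSpace E] [TopologicalSpace E]
  {P : Measure Ω} {F : ℝ → MeasurableSpace Ω} {Z : ℝ → Ω → E} {p : ℝ → ℝ → Kernel E E}
  {t T₀ r s T : ℝ} {L : ℝ × E → ℝ}

theorem integral_kernel_comp {α β : Type*} {mα : MeasurableSpace α} {mβ : MeasurableSpace β}
    {κ : Kernel α β} {μ : Measure α} [IsFiniteMeasure μ] [IsMarkovKernel κ] {g : β → ℝ}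
    (hg : Integrable g (κ ∘ₘ μ)) : ∫ y, g y ∂(κ ∘ₘ μ) = ∫ x, ∫ y, g y ∂(κ x) ∂μ := by
  rw [Measure.comp_eq_comp_const_apply] at hg ⊢
  rw [Kernel.integral_comp hg, Kernel.const_apply]

theorem BoundedMeasurable.integral_kernel {α β : Type*} {mα : MeasurableSpace α}
    {mβ : MeasurableSpace β} {κ : Kernel α β} [IsMarkovKernel κ] {g : β → ℝ}
    (hg : BoundedMeasurable g) : BoundedMeasurable fun x => ∫ y, g y ∂(κ x) :=
  let ⟨C, hC⟩ := hg.2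
  ⟨(StronglyMeasurable.integral_kernel hg.1.stronglyMeasurable).measurable, C, fun x => by
    simpa using norm_integral_le_of_norm_le_const (f := g) (ae_of_all (κ x) hC)⟩

namespace IsMarkovUnder

theorem measurable (h : IsMarkovUnder P F Z p t T₀) (hs : s ∈ Ico t T₀) : Measurable (Z s) :=
  (h.adapted s hs).mono (h.le s hs) le_rfl

theorem boundedMeasurable_comp (h : IsMarkovUnder P F Z p t T₀) (hs : s ∈ Ico t T₀) {g : E → ℝ}
    (hg : BoundedMeasurable g) : BoundedMeasurable (m := F s) fun ω => g (Z s ω) :=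
  hg.comp (h.adapted s hs)

theorem map_eq_comp [IsProbabilityMeasure P] (h : IsMarkovUnder P F Z p t T₀) (hs : t ≤ s)
    (hsT : s < T) (hT : T < T₀) {S : Set Ω} (hS : MeasurableSet[F s] S) :
    (P.restrict S).map (Z T) = p s T ∘ₘ (P.restrict S).map (Z s) := by
  have hs' : s ∈ Ico t T₀ := ⟨hs, hsT.trans hT⟩
  have hT' : T ∈ Ico t T₀ := ⟨hs.trans hsT.le, hT⟩
  have := h.kernel s T hs hsT hT
  ext A hA
  have hZA : MeasurableSet (Z T ⁻¹' A) := h.measurable hT' hA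
  have mean_eq : ∫ ω in S, (p s T (Z s ω)).real A ∂P = (P.restrict S).real (Z T ⁻¹' A) := by
    rw [← setIntegral_congr_ae (h.le s hs' S hS)
        ((h.markov s T hs hsT hT A hA).mono fun ω hω _ => hω),
      setIntegral_condExp (h.le s hs') ((integrable_const _).indicator hZA) hS,
      integral_indicator hZA]
    simp
  have kernel_bounded : BoundedMeasurable fun ω => (p s T (Z s ω)).real A :=
    ⟨(((p s T).measurable_coe hA).comp (h.measurable hs')).ennreal_toReal, 1, fun ω =>
      (abs_of_nonneg measureReal_nonneg).trans_le measureReal_le_one⟩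
  rw [Measure.map_apply (h.measurable hT') hA, Measure.bind_apply hA (p s T).aemeasurable,
    lintegral_map ((p s T).measurable_coe hA) (h.measurable hs'), ← ofReal_measureReal, ← mean_eq,
    ofReal_integral_eq_lintegral_ofReal kernel_bounded.integrable
      (ae_of_all _ fun ω => measureReal_nonneg)]
  exact lintegral_congr fun ω => ofReal_measureReal

theorem condExp_comp [IsProbabilityMeasure P] (h : IsMarkovUnder P F Z p t T₀) (hs : t ≤ s)
    (hsT : s < T) (hT : T < T₀) {g : E → ℝ} (hg : BoundedMeasurable g) :
    P[fun ω => g (Z T ω) | F s] =ᵐ[P] fun ω => ∫ ξ, g ξ ∂(p s T (Z s ω)) := by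
  have hs' : s ∈ Ico t T₀ := ⟨hs, hsT.trans hT⟩
  have hT' : T ∈ Ico t T₀ := ⟨hs.trans hsT.le, hT⟩
  have := h.kernel s T hs hsT hT
  have mean_bounded := hg.integral_kernel (κ := p s T)
  have adapted_mean := h.boundedMeasurable_comp hs' mean_bounded
  refine (ae_eq_condExp_of_forall_setIntegral_eq (h.le s hs')
    ((h.boundedMeasurable_comp hT' hg).mono (h.le T hT')).integrable
    (fun S _ _ => (adapted_mean.mono (h.le s hs')).integrable.integrableOn) (fun S hS _ => ?_)
    adapted_mean.1.stronglyMeasurable.aestronglyMeasurable).symm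
  rw [← integral_map (φ := Z s) (h.measurable hs').aemeasurable
      mean_bounded.1.aestronglyMeasurable,
    ← integral_map (φ := Z T) (h.measurable hT').aemeasurable hg.1.aestronglyMeasurable,
    h.map_eq_comp hs hsT hT hS, integral_kernel_comp hg.integrable]

theorem integral_mul [IsProbabilityMeasure P] (h : IsMarkovUnder P F Z p t T₀) (hs : t ≤ s)
    (hsT : s < T) (hT : T < T₀) {W : Ω → ℝ} (hW : BoundedMeasurable (m := F s) W) {g : E → ℝ}
    (hg : BoundedMeasurable g) :
    ∫ ω, W ω * g (Z T ω) ∂P = ∫ ω, W ω * ∫ ξ, g ξ ∂(p s T (Z s ω)) ∂P := by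
  have hT' : T ∈ Ico t T₀ := ⟨hs.trans hsT.le, hT⟩
  have hle := h.le s ⟨hs, hsT.trans hT⟩
  obtain ⟨C, hC⟩ := hW.2
  rw [← integral_condExp hle]
  refine integral_congr_ae ?_
  filter_upwards [condExp_stronglyMeasurable_mul_of_bound hle hW.1.stronglyMeasurable
      ((h.boundedMeasurable_comp hT' hg).mono (h.le T hT')).integrable C (ae_of_all _ hC),
    h.condExp_comp hs hsT hT hg] with ω pull_out mean
  rw [← mean]
  exact pull_out

end IsMarkovUnder

theorem max_min_mem_Ico (hT : T ∈ Ico t T₀) (u : ℝ) : max t (min u T) ∈ Ico t T₀ :=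
  ⟨le_max_left _ _, max_lt (hT.1.trans_lt hT.2) ((min_le_right _ _).trans_lt hT.2)⟩

namespace IsMarkovUnder

theorem continuous_clampPath (h : IsMarkovUnder P F Z p t T₀) (hT : T ∈ Ico t T₀) (ω : Ω) :
    Continuous fun u => clampPath Z t T u ω :=
  (h.cont ω).comp_continuous (f := fun u => max t (min u T)) (by fun_prop) (max_min_mem_Ico hT)

variable [BorelSpace E]

theorem intervalIntegrable (h : IsMarkovUnder P F Z p t T₀) (hT : T ∈ Ico t T₀)
    (hL : BoundedMeasurable L) (hr : t ≤ r) (hrT : r ≤ T) (ω : Ω) :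
    IntervalIntegrable (fun u => L (u, Z u ω)) volume r T := by
  have frozen : BoundedMeasurable fun u => L (u, clampPath Z t T u ω) :=
    hL.comp (measurable_id.prodMk (h.continuous_clampPath hT ω).measurable)
  have : IsFiniteMeasure (volume.restrict (uIoc r T)) := ⟨by simp⟩
  refine (intervalIntegrable_iff.2 frozen.integrable).congr fun u hu => ?_
  rw [uIoc_of_le hrT] at hu
  simp only [clampPath_eq (Icc_subset_Icc_left hr (Ioc_subset_Icc_self hu))]

variable [TopologicalSpace.PseudoMetrizableSpace E]

theorem boundedMeasurable_comp_clampPath (h : IsMarkovUnder P F Z p t T₀) (hT : T ∈ Ico t T₀)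
    (hL : BoundedMeasurable L) :
    BoundedMeasurable (m := Prod.instMeasurableSpace (m₂ := F T))
      fun q : ℝ × Ω => L (q.1, clampPath Z t T q.1 q.2) := by
  have hZ := measurable_uncurry_of_continuous_of_measurable (m := F T) (h.continuous_clampPath hT)
    fun u => (h.adapted _ (max_min_mem_Ico hT u)).mono
      (h.mono _ (max_min_mem_Ico hT u) T hT (max_le hT.1 (min_le_right _ _))) le_rfl
  let _ := F T
  exact hL.comp (measurable_fst.prodMk hZ)

theorem boundedMeasurable_integral (h : IsMarkovUnder P F Z p t T₀) (hT : T ∈ Ico t T₀)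
    (hL : BoundedMeasurable L) (hr : t ≤ r) (hrT : r ≤ T) :
    BoundedMeasurable (m := F T) fun ω => ∫ u in r..T, L (u, Z u ω) := by
  obtain ⟨C, hC⟩ := hL.2
  refine ⟨?_, C * |T - r|, fun ω =>
    intervalIntegral.norm_integral_le_of_norm_le_const (f := fun u => L (u, Z u ω)) fun u _ => hC _⟩
  simp only [integral_comp_clampPath (Z := Z) (L := L) hr hrT, intervalIntegral.integral_of_le hrT]
  have hm := (h.boundedMeasurable_comp_clampPath hT hL).1
  let _ := F T
  exact hm.stronglyMeasurable.integral_prod_left'.measurable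

theorem integrable_mul_comp_clampPath [IsProbabilityMeasure P] (h : IsMarkovUnder P F Z p t T₀)
    (hT : T ∈ Ico t T₀) (hL : BoundedMeasurable L) {W : Ω → ℝ} (hW : BoundedMeasurable W) (r : ℝ) :
    Integrable (Function.uncurry fun u ω => W ω * L (u, clampPath Z t T u ω))
      ((volume.restrict (uIoc r T)).prod P) := by
  have : IsFiniteMeasure (volume.restrict (uIoc r T)) := ⟨by simp⟩
  exact ((hW.comp measurable_snd).mul ((h.boundedMeasurable_comp_clampPath hT hL).mono
    (sup_le_sup le_rfl (MeasurableSpace.comap_mono (h.le T hT))))).integrable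

theorem intervalIntegrable_integral [IsProbabilityMeasure P] (h : IsMarkovUnder P F Z p t T₀)
    (hT : T ∈ Ico t T₀) (hL : BoundedMeasurable L) {W : Ω → ℝ} (hW : BoundedMeasurable W)
    (hr : t ≤ r) (hrT : r ≤ T) :
    IntervalIntegrable (fun u => ∫ ω, W ω * L (u, Z u ω) ∂P) volume r T := by
  refine (intervalIntegrable_iff.2
    (h.integrable_mul_comp_clampPath hT hL hW r).integral_prod_left).congr fun u hu => ?_
  rw [uIoc_of_le hrT] at hu
  simp only [Function.uncurry,
    clampPath_eq (Icc_subset_Icc_left hr (Ioc_subset_Icc_self hu))]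

theorem integral_swap [IsProbabilityMeasure P] (h : IsMarkovUnder P F Z p t T₀)
    (hT : T ∈ Ico t T₀) (hL : BoundedMeasurable L) {W : Ω → ℝ} (hW : BoundedMeasurable W)
    (hr : t ≤ r) (hrT : r ≤ T) :
    ∫ u in r..T, ∫ ω, W ω * L (u, Z u ω) ∂P = ∫ ω, W ω * (∫ u in r..T, L (u, Z u ω)) ∂P := by
  calc ∫ u in r..T, ∫ ω, W ω * L (u, Z u ω) ∂P
      = ∫ u in r..T, ∫ ω, W ω * L (u, clampPath Z t T u ω) ∂P := by
        refine intervalIntegral.integral_congr fun u hu => ?_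
        rw [uIcc_of_le hrT] at hu
        simp only [clampPath_eq (Icc_subset_Icc_left hr hu)]
    _ = ∫ ω, (∫ u in r..T, W ω * L (u, clampPath Z t T u ω)) ∂P :=
        intervalIntegral_integral_swap (h.integrable_mul_comp_clampPath hT hL hW r)
    _ = ∫ ω, W ω * (∫ u in r..T, L (u, Z u ω)) ∂P := by
        simp only [intervalIntegral.integral_const_mul,
          ← integral_comp_clampPath (Z := Z) (L := L) hr hrT]

end IsMarkovUnder

end Markov

/-! ### Right derivatives of expectations -/

section RightDerivative

theorem HasDerivAlong.tendsto_quotient {V : Type*} [TopologicalSpace V] {φ : Flow ℝ V} {u v : V → ℝ}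
    (h : HasDerivAlong φ u v) (hv : Continuous v) {w : ℝ → V} {z : V}
    (hw : Tendsto w (𝓝[>] 0) (𝓝 z)) :
    Tendsto (fun δ => (u (φ δ (w δ)) - u (w δ)) / δ) (𝓝[>] 0) (𝓝 (v z)) := by
  have mean_value : ∀ δ > 0, ∃ θ ∈ Ioo 0 δ, v (φ θ (w δ)) = (u (φ δ (w δ)) - u (w δ)) / δ :=
    fun δ hδ => by
      simpa [φ.map_zero_apply] using exists_hasDerivAt_eq_slope (fun η => u (φ η (w δ)))
        (fun η => v (φ η (w δ))) hδ
        (fun η _ => (h.hasDerivAt (w δ) η).continuousAt.continuousWithinAt)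
        fun η _ => h.hasDerivAt (w δ) η
  choose! θ hθ hθ_eq using mean_value
  have θ_tendsto : Tendsto θ (𝓝[>] 0) (𝓝 0) :=
    tendsto_of_tendsto_of_tendsto_of_le_of_le' tendsto_const_nhds
      (tendsto_id.mono_left nhdsWithin_le_nhds)
      (eventually_mem_nhdsWithin.mono fun δ hδ => (hθ δ hδ).1.le)
      (eventually_mem_nhdsWithin.mono fun δ hδ => (hθ δ hδ).2.le)
  have joint : Continuous fun q : ℝ × V => v (φ q.1 q.2) :=
    hv.comp (φ.continuous continuous_fst continuous_snd)
  have := (joint.tendsto' (0, z) (v z) (by simp [φ.map_zero_apply])).comp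
    (θ_tendsto.prodMk_nhds hw)
  exact this.congr' (eventually_mem_nhdsWithin.mono fun δ hδ => hθ_eq δ hδ)

theorem tendsto_integral_quotient {Ω V : Type*} {mΩ : MeasurableSpace Ω} {P : Measure Ω}
    [IsFiniteMeasure P] [TopologicalSpace V] [MeasurableSpace V] [OpensMeasurableSpace V]
    {φ : Flow ℝ V} {u v : V → ℝ} (h : HasDerivAlong φ u v) (hu : Continuous u) (hv : Continuous v)
    (hvb : ∃ C, ∀ z, |v z| ≤ C) {W : Ω → ℝ} (hW : BoundedMeasurable W) {w : ℝ → Ω → V} {z : Ω → V}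
    (hw : ∀ ω, Tendsto (fun δ => w δ ω) (𝓝[>] 0) (𝓝 (z ω)))
    (hwm : ∀ᶠ δ in 𝓝[>] (0 : ℝ), Measurable (w δ)) :
    Tendsto (fun δ => (∫ ω, W ω * (u (φ δ (w δ ω)) - u (w δ ω)) ∂P) / δ) (𝓝[>] 0)
      (𝓝 (∫ ω, W ω * v (z ω) ∂P)) := by
  obtain ⟨C, hC⟩ := hvb
  obtain ⟨C', hC'⟩ := hW.2
  simp only [← integral_div, mul_div_assoc]
  refine tendsto_integral_filter_of_dominated_convergence (fun _ => C' * C) ?_ ?_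
    (integrable_const _) (ae_of_all _ fun ω => (h.tendsto_quotient hv (hw ω)).const_mul _)
  · filter_upwards [hwm] with δ hδ
    have increment : Continuous fun z => u (φ δ z) - u z :=
      (hu.comp (φ.continuous continuous_const continuous_id)).sub hu
    exact (hW.1.mul ((increment.measurable.comp hδ).div_const δ)).aestronglyMeasurable
  · filter_upwards [self_mem_nhdsWithin] with δ (hδ : 0 < δ)
    refine ae_of_all _ fun ω => ?_
    rw [norm_mul, norm_div, Real.norm_of_nonneg hδ.le]
    refine mul_le_mul (hC' ω) ?_ (by positivity) ((abs_nonneg _).trans (hC' ω))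
    rw [div_le_iff₀ hδ]
    exact (h.norm_sub_le hC δ _).trans_eq (by rw [abs_of_pos hδ])

theorem eventually_mem_Ico {t r T₀ : ℝ} (hr : r ∈ Ico t T₀) :
    ∀ᶠ δ in 𝓝[>] (0 : ℝ), 0 < δ ∧ r + δ ∈ Ico t T₀ := by
  filter_upwards [Ioo_mem_nhdsGT (sub_pos.2 hr.2)] with δ hδ
  exact ⟨hδ.1, by linarith [hr.1, hδ.1], by linarith [hδ.2]⟩

namespace IsMarkovUnder

section General

variable {Ω E : Type*} {mΩ : MeasurableSpace Ω} [MeasurableSpace E] [TopologicalSpace E]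
  {P : Measure Ω} {F : ℝ → MeasurableSpace Ω} {Z : ℝ → Ω → E} {p : ℝ → ℝ → Kernel E E}
  {t T₀ r s T : ℝ}

theorem tendsto_path (h : IsMarkovUnder P F Z p t T₀) (hr : r ∈ Ico t T₀) (ω : Ω) :
    Tendsto (fun δ => Z (r + δ) ω) (𝓝[>] 0) (𝓝 (Z r ω)) := by
  have shift : Tendsto (fun δ : ℝ => r + δ) (𝓝[>] 0) (𝓝 r) :=
    (Continuous.tendsto' (by fun_prop) 0 r (add_zero r)).mono_left nhdsWithin_le_nhds
  exact (h.cont ω r hr).tendsto.comp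
    (tendsto_nhdsWithin_iff.2 ⟨shift, (eventually_mem_Ico hr).mono fun _ => And.right⟩)

variable [IsProbabilityMeasure P] {W : Ω → ℝ} {g G : E → ℝ}

theorem integral_mul_increment (h : IsMarkovUnder P F Z p t T₀) (hs : t ≤ s) (hsT : s < T)
    (hT : T < T₀) (hW : BoundedMeasurable (m := F s) W) (hg : BoundedMeasurable g) :
    ∫ ω, W ω * (g (Z T ω) - g (Z s ω)) ∂P =
      ∫ ω, W ω * ∫ ξ, (g ξ - g (Z s ω)) ∂(p s T (Z s ω)) ∂P := by
  have := h.kernel s T hs hsT hT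
  have hs' : s ∈ Ico t T₀ := ⟨hs, hsT.trans hT⟩
  have hW' := hW.mono (h.le s hs')
  have hZs := h.measurable hs'
  have hZT := h.measurable ⟨hs.trans hsT.le, hT⟩
  simp only [integral_sub hg.integrable (integrable_const _), integral_const, probReal_univ,
    one_smul, mul_sub]
  rw [integral_sub (hW'.mul (hg.comp hZT)).integrable (hW'.mul (hg.comp hZs)).integrable,
    integral_sub (hW'.mul (hg.integral_kernel.comp hZs)).integrable
      (hW'.mul (hg.comp hZs)).integrable,
    h.integral_mul hs hsT hT hW hg]

theorem tendsto_generator (h : IsMarkovUnder P F Z p t T₀) (hr : r ∈ Ico t T₀)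
    (hW : BoundedMeasurable (m := F r) W) (hg : BoundedMeasurable g) (hG : BoundedMeasurable G)
    (hgen : TendstoUniformly (fun δ x => (∫ ξ, (g ξ - g x) ∂(p r (r + δ) x)) / δ) G (𝓝[>] 0)) :
    Tendsto (fun δ => (∫ ω, W ω * (g (Z (r + δ) ω) - g (Z r ω)) ∂P) / δ) (𝓝[>] 0)
      (𝓝 (∫ ω, W ω * G (Z r ω) ∂P)) := by
  obtain ⟨C, hC⟩ := hW.2
  obtain ⟨C', hC'⟩ := hG.2
  have markov : ∀ᶠ δ in 𝓝[>] (0 : ℝ), IsMarkovKernel (p r (r + δ)) ∧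
      (∫ ω, W ω * (g (Z (r + δ) ω) - g (Z r ω)) ∂P) / δ =
        ∫ ω, W ω * ((∫ ξ, (g ξ - g (Z r ω)) ∂(p r (r + δ) (Z r ω))) / δ) ∂P := by
    filter_upwards [eventually_mem_Ico hr] with δ ⟨hδ, hrδ⟩
    have later : r < r + δ := by linarith
    refine ⟨h.kernel r (r + δ) hr.1 later hrδ.2, ?_⟩
    rw [h.integral_mul_increment hr.1 later hrδ.2 hW hg, ← integral_div]
    simp only [mul_div_assoc]
  refine Tendsto.congr' (markov.mono fun δ hδ => hδ.2.symm) ?_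
  refine tendsto_integral_filter_of_dominated_convergence (fun _ => C * (1 + C')) ?_ ?_
    (integrable_const _) (ae_of_all _ fun ω => (hgen.tendsto_at _).const_mul _)
  · filter_upwards [markov] with δ ⟨_, _⟩
    simp only [integral_sub hg.integrable (integrable_const _), integral_const, probReal_univ,
      one_smul]
    exact ((hW.mono (h.le r hr)).1.mul <| ((hg.integral_kernel.sub hg).1.comp
      (h.measurable hr)).div_const δ).aestronglyMeasurable
  · filter_upwards [Metric.tendstoUniformly_iff.1 hgen 1 one_pos] with δ hδ
    refine ae_of_all _ fun ω => ?_
    rw [norm_mul]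
    refine mul_le_mul (hC ω) ?_ (norm_nonneg _) ((abs_nonneg _).trans (hC ω))
    have near := hδ (Z r ω)
    rw [dist_comm, dist_eq_norm] at near
    exact (norm_le_norm_sub_add _ _).trans (add_le_add near.le (hC' _))

end General

end IsMarkovUnder

end RightDerivative

section SpatiallySmooth

variable {d : ℕ}

/-- The flow `x ↦ e^{δB}x` of the linear field `⟨Bx, ∇_x⟩` on `ℝ^d`. -/
noncomputable def linearFlow (B : Matrix (Fin d) (Fin d) ℝ) : Flow ℝ (Euc d) where
  toFun δ x := expB B δ x
  cont' := by fun_prop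
  map_add' := expB_add_apply B
  map_zero' x := by simp

theorem linearFlow_apply (B : Matrix (Fin d) (Fin d) ℝ) (δ : ℝ) (x : Euc d) :
    linearFlow B δ x = expB B δ x := rfl

theorem hasDerivAlong_linearFlow (B : Matrix (Fin d) (Fin d) ℝ) {g : Euc d → ℝ}
    (hg : Differentiable ℝ g) :
    HasDerivAlong (linearFlow B) g fun x => fderiv ℝ g x (matOp B x) := by
  intro x
  have curve : HasDerivAt (fun δ => expB B δ x) (matOp B x) 0 := by
    simpa using (hasDerivAt_expB B 0).clm_apply (hasDerivAt_const 0 x)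
  have outer : HasFDerivAt g (fderiv ℝ g x) (expB B 0 x) := by simpa using (hg x).hasFDerivAt
  exact outer.comp_hasDerivAt 0 curve

theorem hasCompactSupport_slice {T₀ : ℝ} {D : Set (Euc d)} {K : Set (ℝ × Euc d)} (hK : IsCompact K)
    (hKD : K ⊆ Ioo 0 T₀ ×ˢ D) {f : ℝ × Euc d → ℝ} (hf0 : ∀ z ∉ K, f z = 0) (s : ℝ) :
    HasCompactSupport (fun x => f (s, x)) ∧ tsupport (fun x => f (s, x)) ⊆ D := by
  have compact_slice : IsCompact ((fun x : Euc d => (s, x)) ⁻¹' K) :=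
    (hK.image continuous_snd).of_isClosed_subset (hK.isClosed.preimage (by fun_prop))
      fun x hx => ⟨(s, x), hx, rfl⟩
  have slice_zero : ∀ x ∉ (fun x : Euc d => (s, x)) ⁻¹' K, f (s, x) = 0 := fun x hx => hf0 _ hx
  refine ⟨HasCompactSupport.intro compact_slice slice_zero, fun x hx => ?_⟩
  have support_subset : Function.support (fun x => f (s, x)) ⊆ (fun x : Euc d => (s, x)) ⁻¹' K :=
    Function.support_subset_iff'.2 slice_zero
  exact (hKD (closure_minimal support_subset compact_slice.isClosed hx)).2

variable {p₀ : ℕ} {hp : p₀ ≤ d} {B : Matrix (Fin d) (Fin d) ℝ} {D : Set (Euc d)}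
  {a : Fin p₀ → Fin p₀ → ℝ × Euc d → ℝ} {b : Fin p₀ → ℝ × Euc d → ℝ} {K : Set (ℝ × Euc d)}
  {f : ℝ × Euc d → ℝ} {Ω Ω' : Type*} {mΩ : MeasurableSpace Ω} {P : Measure Ω}
  {F : ℝ → MeasurableSpace Ω} {Z : ℝ → Ω → Euc d} {t T₀ r : ℝ} {W : Ω → ℝ}

theorem boundedMeasurable_fderiv_matOp (hK : IsCompact K) (hKD : K ⊆ Ioo 0 T₀ ×ˢ D)
    (hf0 : ∀ z ∉ K, f z = 0) (hfr : ContDiff ℝ 2 fun x => f (r, x)) :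
    Continuous (fun x => fderiv ℝ (fun x => f (r, x)) x (matOp B x)) ∧
    BoundedMeasurable fun x => fderiv ℝ (fun x => f (r, x)) x (matOp B x) := by
  have cont : Continuous fun x => fderiv ℝ (fun x => f (r, x)) x (matOp B x) :=
    (hfr.continuous_fderiv two_ne_zero).clm_apply (matOp B).continuous
  refine ⟨cont, boundedMeasurable_of_zero_off (hasCompactSupport_slice hK hKD hf0 r).1 cont
    fun x hx => ?_⟩
  rw [image_eq_zero_of_notMem_tsupport fun h => hx (tsupport_fderiv_subset ℝ h),
    zero_apply]

theorem integral_mul_sub_add [IsFiniteMeasure P] {u v w : Ω → ℝ} (hW : BoundedMeasurable W)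
    (hu : BoundedMeasurable u) (hv : BoundedMeasurable v) (hw : BoundedMeasurable w) :
    ∫ ω, W ω * u ω ∂P - ∫ ω, W ω * v ω ∂P + ∫ ω, W ω * w ω ∂P =
      ∫ ω, W ω * (u ω - v ω + w ω) ∂P := by
  simp only [mul_add, mul_sub]
  rw [← integral_sub (hW.mul hu).integrable (hW.mul hv).integrable,
    ← integral_add ((hW.mul hu).sub (hW.mul hv)).integrable (hW.mul hw).integrable]

namespace IsMarkovUnder

theorem tendsto_pullback {p : ℝ → ℝ → Kernel (Euc d) (Euc d)} (h : IsMarkovUnder P F Z p t T₀)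
    (hr : r ∈ Ico t T₀) (B : Matrix (Fin d) (Fin d) ℝ) (ω : Ω) :
    Tendsto (fun δ => expB B (-δ) (Z (r + δ) ω)) (𝓝[>] 0) (𝓝 (Z r ω)) := by
  have joint : Continuous fun q : ℝ × Euc d => expB B (-q.1) q.2 := by fun_prop
  exact (joint.tendsto' (0, Z r ω) (Z r ω) (by simp)).comp
    ((tendsto_id.mono_left nhdsWithin_le_nhds).prodMk_nhds (h.tendsto_path hr ω))

theorem eventually_measurable_pullback {p : ℝ → ℝ → Kernel (Euc d) (Euc d)}
    (h : IsMarkovUnder P F Z p t T₀) (hr : r ∈ Ico t T₀) (B : Matrix (Fin d) (Fin d) ℝ) :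
    ∀ᶠ δ in 𝓝[>] (0 : ℝ), Measurable fun ω => expB B (-δ) (Z (r + δ) ω) :=
  (eventually_mem_Ico hr).mono fun δ hδ =>
    (expB B (-δ)).continuous.measurable.comp (h.measurable hδ.2)

variable [IsProbabilityMeasure P]

theorem tendsto_yFlow_increment {p : ℝ → ℝ → Kernel (Euc d) (Euc d)}
    (h : IsMarkovUnder P F Z p t T₀) (hr : r ∈ Ico t T₀) (hW : BoundedMeasurable W)
    (hf : IntrinsicC2 hp B f) (hK : IsCompact K) (hf0 : ∀ z ∉ K, f z = 0) :
    Tendsto (fun δ => (∫ ω, W ω * (f (r + δ, Z (r + δ) ω) -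
      f (r, expB B (-δ) (Z (r + δ) ω))) ∂P) / δ) (𝓝[>] 0)
      (𝓝 (∫ ω, W ω * derivY B f (r, Z r ω) ∂P)) := by
  have bdd := boundedMeasurable_of_zero_off hK hf.contY (derivY_eq_zero_off hK.isClosed hf0)
  simpa [yFlow_apply] using tendsto_integral_quotient (P := P) hf.hasY hf.cont hf.contY bdd.2 hW
    (w := fun δ ω => (r, expB B (-δ) (Z (r + δ) ω)))
    (fun ω => tendsto_const_nhds.prodMk_nhds (h.tendsto_pullback hr B ω))
    ((h.eventually_measurable_pullback hr B).mono fun δ => measurable_const.prodMk)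

theorem tendsto_linearFlow_increment {p : ℝ → ℝ → Kernel (Euc d) (Euc d)}
    (h : IsMarkovUnder P F Z p t T₀) (hr : r ∈ Ico t T₀) (hW : BoundedMeasurable W)
    (hK : IsCompact K) (hKD : K ⊆ Ioo 0 T₀ ×ˢ D) (hf0 : ∀ z ∉ K, f z = 0)
    (hfr : ContDiff ℝ 2 fun x => f (r, x)) :
    Tendsto (fun δ => (∫ ω, W ω * (f (r, Z (r + δ) ω) -
      f (r, expB B (-δ) (Z (r + δ) ω))) ∂P) / δ) (𝓝[>] 0)
      (𝓝 (∫ ω, W ω * fderiv ℝ (fun x => f (r, x)) (Z r ω) (matOp B (Z r ω)) ∂P)) := by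
  obtain ⟨cont, bdd⟩ := boundedMeasurable_fderiv_matOp (B := B) hK hKD hf0 hfr
  simpa [linearFlow_apply] using tendsto_integral_quotient (P := P)
    (hasDerivAlong_linearFlow B (hfr.differentiable two_ne_zero)) hfr.continuous cont bdd.2 hW
    (h.tendsto_pullback hr B) (h.eventually_measurable_pullback hr B)

/-- The increment of `f` along the path splits into an increment along `Y` from the point
`e^{-δB} Z_{r+δ}`, minus an increment along the linear field from the same point, plus an increment
in space at the fixed time `r`; only the last one involves the transition probabilities. -/
theorem tendsto_opL {M : ContMarkovProcess d T₀ Ω'} (h : IsMarkovUnder P F Z M.p t T₀) (ht : 0 ≤ t)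
    (hM : IsLocalDiffusion hp M D B a b) (hD : IsOpen D) (hK : IsCompact K)
    (hKD : K ⊆ Ioo 0 T₀ ×ˢ D) (hf : IntrinsicC2 hp B f) (hf0 : ∀ z ∉ K, f z = 0)
    (hfr : ContDiff ℝ 2 fun x => f (r, x)) (hr : r ∈ Ico t T₀)
    (hW : BoundedMeasurable (m := F r) W) :
    Tendsto (fun δ => (∫ ω, W ω * (f (r + δ, Z (r + δ) ω) - f (r, Z r ω)) ∂P) / δ) (𝓝[>] 0)
      (𝓝 (∫ ω, W ω * opL hp B a b f (r, Z r ω) ∂P)) := by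
  have hW' := hW.mono (h.le r hr)
  have f_bdd := boundedMeasurable_of_zero_off hK hf.cont hf0
  have Y_bdd := boundedMeasurable_of_zero_off hK hf.contY (derivY_eq_zero_off hK.isClosed hf0)
  have L_bdd := hf.boundedMeasurable_opL hD hK hKD hM.locBounded_a hf0 hM.locBounded_b
  have linear_bdd := (boundedMeasurable_fderiv_matOp (B := B) hK hKD hf0 hfr).2
  have at_r : Measurable fun x : Euc d => (r, x) := measurable_prodMk_left
  have generator := (hM.hasLocalMoments (ht.trans hr.1) hr.2).tendstoUniformly_generator hD hfr
    (hasCompactSupport_slice hK hKD hf0 r).1 (hasCompactSupport_slice hK hKD hf0 r).2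
  simp only [diffusionOp_eq_opL (hp := hp) hfr] at generator
  have space := h.tendsto_generator hr hW (f_bdd.comp at_r)
    (((L_bdd.comp at_r).sub (Y_bdd.comp at_r)).add linear_bdd) generator
  have hZr := h.measurable hr
  have on_path {g : ℝ × Euc d → ℝ} (hg : BoundedMeasurable g) :
      BoundedMeasurable fun ω => g (r, Z r ω) := hg.comp (at_r.comp hZr)
  have sum := ((h.tendsto_yFlow_increment hr hW' hf hK hf0).sub
    (h.tendsto_linearFlow_increment (B := B) hr hW' hK hKD hf0 hfr)).add space
  rw [integral_mul_sub_add hW' (on_path Y_bdd) (linear_bdd.comp hZr)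
    (((on_path L_bdd).sub (on_path Y_bdd)).add (linear_bdd.comp hZr))] at sum
  have telescope (y l L : ℝ) : y - l + (L - y + l) = L := by ring
  simp only [telescope] at sum
  refine sum.congr' ?_
  filter_upwards [eventually_mem_Ico hr, h.eventually_measurable_pullback hr B] with δ hδ hw
  have f_at (s : ℝ) {w : Ω → Euc d} (hw : Measurable w) : BoundedMeasurable fun ω => f (s, w ω) :=
    f_bdd.comp (measurable_const.prodMk hw)
  have hZ := h.measurable hδ.2
  rw [← sub_div, ← add_div, integral_mul_sub_add hW' ((f_at (r + δ) hZ).sub (f_at r hw))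
    ((f_at r hZ).sub (f_at r hw)) ((f_at r hZ).sub (f_at r hZr))]
  have split_increment (u v w v₀ : ℝ) : u - w - (v - w) + (v - v₀) = u - v₀ := by ring
  simp only [split_increment]

end IsMarkovUnder

end SpatiallySmooth

/-! ### Dynkin's formula -/

section DynkinFormula

theorem hasDerivWithinAt_Ioi_of_tendsto {g : ℝ → ℝ} {g' s : ℝ}
    (h : Tendsto (fun δ => (g (s + δ) - g s) / δ) (𝓝[>] 0) (𝓝 g')) :
    HasDerivWithinAt g g' (Ioi s) s := by
  rw [hasDerivWithinAt_iff_tendsto_slope' self_notMem_Ioi]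
  have shift : Tendsto (fun y => y - s) (𝓝[>] s) (𝓝[>] 0) := by
    rw [Tendsto, map_subRight_nhdsGT, sub_self]
  exact (h.comp shift).congr fun y => by
    simp only [Function.comp_apply, add_sub_cancel, slope_def_field]

theorem tendsto_integral_mul_of_bounded {Ω : Type*} {mΩ : MeasurableSpace Ω} {P : Measure Ω}
    [IsFiniteMeasure P] {W : Ω → ℝ} (hW : BoundedMeasurable W) {v : ℕ → Ω → ℝ} {u : Ω → ℝ} {C : ℝ}
    (hv : ∀ n, Measurable (v n)) (hvC : ∀ n ω, |v n ω| ≤ C)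
    (hvu : ∀ ω, Tendsto (fun n => v n ω) atTop (𝓝 (u ω))) :
    Tendsto (fun n => ∫ ω, W ω * v n ω ∂P) atTop (𝓝 (∫ ω, W ω * u ω ∂P)) := by
  obtain ⟨C', hC'⟩ := hW.2
  refine tendsto_integral_of_dominated_convergence (fun _ => C' * C)
    (fun n => (hW.1.mul (hv n)).aestronglyMeasurable) (integrable_const _)
    (fun n => ae_of_all _ fun ω => ?_) (ae_of_all _ fun ω => (hvu ω).const_mul _)
  rw [norm_mul]
  exact mul_le_mul (hC' ω) (hvC n ω) (norm_nonneg _) ((abs_nonneg _).trans (hC' ω))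

section Path

variable {Ω E : Type*} {mΩ : MeasurableSpace Ω} [MeasurableSpace E] [TopologicalSpace E]
  {P : Measure Ω} {F : ℝ → MeasurableSpace Ω} {Z : ℝ → Ω → E}
  {p : ℝ → ℝ → Kernel E E} {t T₀ r T : ℝ} {W : Ω → ℝ} {f : ℝ × E → ℝ}

/-- Dynkin's formula for `f` along `Z`, with `L` in the role of the generator applied to `f`. The
conditional expectation given `F r` is expressed by testing against bounded `F r`-measurable
weights `W`. -/
def IsDynkinPair (P : Measure Ω) (F : ℝ → MeasurableSpace Ω) (Z : ℝ → Ω → E) (t T₀ : ℝ)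
    (f L : ℝ × E → ℝ) : Prop :=
  ∀ r ∈ Ico t T₀, ∀ T ∈ Ico t T₀, r ≤ T → ∀ W : Ω → ℝ, BoundedMeasurable (m := F r) W →
    ∫ ω, W ω * (f (T, Z T ω) - f (r, Z r ω)) ∂P = ∫ ω, W ω * (∫ u in r..T, L (u, Z u ω)) ∂P

namespace IsMarkovUnder

theorem boundedMeasurable_path (h : IsMarkovUnder P F Z p t T₀) (hr : r ∈ Ico t T₀)
    (hf : BoundedMeasurable f) : BoundedMeasurable (m := F r) fun ω => f (r, Z r ω) :=
  h.boundedMeasurable_comp hr (hf.comp measurable_prodMk_left)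

variable [IsProbabilityMeasure P]

theorem integral_mul_path_sub (h : IsMarkovUnder P F Z p t T₀) (hr : r ∈ Ico t T₀)
    (hT : T ∈ Ico t T₀) (hW : BoundedMeasurable W) (hf : BoundedMeasurable f) :
    ∫ ω, W ω * (f (T, Z T ω) - f (r, Z r ω)) ∂P =
      ∫ ω, W ω * f (T, Z T ω) ∂P - ∫ ω, W ω * f (r, Z r ω) ∂P := by
  have integrable (s) (hs : s ∈ Ico t T₀) : Integrable (fun ω => W ω * f (s, Z s ω)) P :=
    (hW.mul ((h.boundedMeasurable_path hs hf).mono (h.le s hs))).integrable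
  simp only [mul_sub]
  exact integral_sub (integrable T hT) (integrable r hr)

theorem continuousOn_integral_mul_path (h : IsMarkovUnder P F Z p t T₀) (hW : BoundedMeasurable W)
    (hfc : Continuous f) (hf : BoundedMeasurable f) :
    ContinuousOn (fun s => ∫ ω, W ω * f (s, Z s ω) ∂P) (Ico t T₀) := by
  obtain ⟨C, hC⟩ := hf.2
  obtain ⟨C', hC'⟩ := hW.2
  intro s hs
  refine continuousWithinAt_of_dominated (bound := fun _ => C' * C) ?_
    (Eventually.of_forall fun u => ae_of_all _ fun ω => ?_) (integrable_const _)
    (ae_of_all _ fun ω => ?_)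
  · filter_upwards [self_mem_nhdsWithin] with u hu
    exact (hW.1.mul ((h.boundedMeasurable_path hu hf).mono (h.le u hu)).1).aestronglyMeasurable
  · rw [norm_mul]
    exact mul_le_mul (hC' ω) (hC _) (norm_nonneg _) ((abs_nonneg _).trans (hC' ω))
  · exact continuousWithinAt_const.mul
      (hfc.continuousAt.comp_continuousWithinAt (continuousWithinAt_id.prodMk (h.cont ω s hs)))

end IsMarkovUnder

end Path

variable {d p₀ : ℕ} {hp : p₀ ≤ d} {B : Matrix (Fin d) (Fin d) ℝ} {D : Set (Euc d)}
  {a : Fin p₀ → Fin p₀ → ℝ × Euc d → ℝ} {b : Fin p₀ → ℝ × Euc d → ℝ} {K : Set (ℝ × Euc d)}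
  {f : ℝ × Euc d → ℝ} {Ω Ω' : Type*} {mΩ : MeasurableSpace Ω} {P : Measure Ω}
  [IsProbabilityMeasure P] {F : ℝ → MeasurableSpace Ω} {Z : ℝ → Ω → Euc d} {t T₀ r T : ℝ}
  {W : Ω → ℝ} {M : ContMarkovProcess d T₀ Ω'}

theorem IsMarkovUnder.hasDerivWithinAt_integral_mul_path (h : IsMarkovUnder P F Z M.p t T₀)
    (ht : 0 ≤ t) (hM : IsLocalDiffusion hp M D B a b) (hD : IsOpen D) (hK : IsCompact K)
    (hKD : K ⊆ Ioo 0 T₀ ×ˢ D) (hf : IntrinsicC2 hp B f) (hf0 : ∀ z ∉ K, f z = 0)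
    (hfr : ContDiff ℝ 2 fun x => f (r, x)) (hr : r ∈ Ico t T₀)
    (hW : BoundedMeasurable (m := F r) W) :
    HasDerivWithinAt (fun s => ∫ ω, W ω * f (s, Z s ω) ∂P)
      (∫ ω, W ω * opL hp B a b f (r, Z r ω) ∂P) (Ioi r) r := by
  refine hasDerivWithinAt_Ioi_of_tendsto
    ((h.tendsto_opL ht hM hD hK hKD hf hf0 hfr hr hW).congr' ?_)
  filter_upwards [eventually_mem_Ico hr] with δ hδ
  rw [h.integral_mul_path_sub hr hδ.2 (hW.mono (h.le r hr))
    (boundedMeasurable_of_zero_off hK hf.cont hf0)]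

theorem IsMarkovUnder.dynkin_of_contDiff (h : IsMarkovUnder P F Z M.p t T₀) (ht : 0 ≤ t)
    (hM : IsLocalDiffusion hp M D B a b) (hD : IsOpen D) (hK : IsCompact K)
    (hKD : K ⊆ Ioo 0 T₀ ×ˢ D) (hf : IntrinsicC2 hp B f) (hf0 : ∀ z ∉ K, f z = 0)
    (hfx : ∀ s, ContDiff ℝ 2 fun x => f (s, x)) :
    IsDynkinPair P F Z t T₀ f (opL hp B a b f) := by
  intro r hr T hT hrT W hW
  have hW' := hW.mono (h.le r hr)
  have f_bdd := boundedMeasurable_of_zero_off hK hf.cont hf0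
  have L_bdd := hf.boundedMeasurable_opL hD hK hKD hM.locBounded_a hf0 hM.locBounded_b
  have mem_Ico (s) (hs : s ∈ Icc r T) : s ∈ Ico t T₀ :=
    ⟨hr.1.trans hs.1, hs.2.trans_lt hT.2⟩
  have deriv (s) (hs : s ∈ Ioo r T) : HasDerivWithinAt (fun s => ∫ ω, W ω * f (s, Z s ω) ∂P)
      (∫ ω, W ω * opL hp B a b f (s, Z s ω) ∂P) (Ioi s) s :=
    have hs' := mem_Ico s (Ioo_subset_Icc_self hs)
    h.hasDerivWithinAt_integral_mul_path ht hM hD hK hKD hf hf0 (hfx s) hs'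
      (hW.mono (h.mono r hr s hs' hs.1.le))
  rw [h.integral_mul_path_sub hr hT hW' f_bdd, ← h.integral_swap hT L_bdd hW' hr.1 hrT]
  exact (intervalIntegral.integral_eq_sub_of_hasDeriv_right_of_le hrT
    ((h.continuousOn_integral_mul_path hW' hf.cont f_bdd).mono mem_Ico) deriv
    (h.intervalIntegrable_integral hT L_bdd hW' hr.1 hrT)).symm

section Mollify

variable (φ : ContDiffBump (0 : Euc d)) {C : ℝ}

namespace IntrinsicC2

theorem hasDerivAlong_dxFlow_mollify (hf : IntrinsicC2 hp B f) (hC : IntrinsicBound hp B C f)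
    (i : Fin p₀) :
    HasDerivAlong (dxFlow hp i) (mollify B φ f) (mollify B φ (derivDx hp i f)) :=
  (hf.hasDx i).mollify φ (leftShift_dxFlow B hp i) hf.cont (hf.contDx i) (hC.abs_dx_le i)

theorem hasDerivAlong_dxFlow_mollify_derivDx (hf : IntrinsicC2 hp B f)
    (hC : IntrinsicBound hp B C f) (i j : Fin p₀) :
    HasDerivAlong (dxFlow hp i) (mollify B φ (derivDx hp j f))
      (mollify B φ (derivDx hp i (derivDx hp j f))) :=
  (hf.hasDxx i j).mollify φ (leftShift_dxFlow B hp i) (hf.contDx j) (hf.contDxx i j)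
    (hC.abs_dxx_le i j)

theorem hasDerivAlong_yFlow_mollify (hf : IntrinsicC2 hp B f) (hC : IntrinsicBound hp B C f) :
    HasDerivAlong (yFlow B) (mollify B φ f) (mollify B φ (derivY B f)) :=
  hf.hasY.mollify φ (leftShift_yFlow B) hf.cont hf.contY hC.abs_y_le

theorem derivDx_mollify (hf : IntrinsicC2 hp B f) (hC : IntrinsicBound hp B C f) (i : Fin p₀) :
    derivDx hp i (mollify B φ f) = mollify B φ (derivDx hp i f) :=
  (hf.hasDerivAlong_dxFlow_mollify φ hC i).derivDx_eq

theorem derivDx_derivDx_mollify (hf : IntrinsicC2 hp B f) (hC : IntrinsicBound hp B C f)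
    (i j : Fin p₀) : derivDx hp i (derivDx hp j (mollify B φ f)) =
      mollify B φ (derivDx hp i (derivDx hp j f)) := by
  rw [hf.derivDx_mollify φ hC, (hf.hasDerivAlong_dxFlow_mollify_derivDx φ hC i j).derivDx_eq]

theorem derivY_mollify (hf : IntrinsicC2 hp B f) (hC : IntrinsicBound hp B C f) :
    derivY B (mollify B φ f) = mollify B φ (derivY B f) :=
  (hf.hasDerivAlong_yFlow_mollify φ hC).derivY_eq

theorem intrinsicC2_mollify (hf : IntrinsicC2 hp B f) (hC : IntrinsicBound hp B C f) :
    IntrinsicC2 hp B (mollify B φ f) where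
  cont := continuous_mollify φ hf.cont hC.abs_le
  hasDx i := by
    rw [hf.derivDx_mollify φ hC]
    exact hf.hasDerivAlong_dxFlow_mollify φ hC i
  contDx i := by
    rw [hf.derivDx_mollify φ hC]
    exact continuous_mollify φ (hf.contDx i) (hC.abs_dx_le i)
  hasDxx i j := by
    rw [hf.derivDx_derivDx_mollify φ hC, hf.derivDx_mollify φ hC]
    exact hf.hasDerivAlong_dxFlow_mollify_derivDx φ hC i j
  contDxx i j := by
    rw [hf.derivDx_derivDx_mollify φ hC]
    exact continuous_mollify φ (hf.contDxx i j) (hC.abs_dxx_le i j)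
  hasY := by
    rw [hf.derivY_mollify φ hC]
    exact hf.hasDerivAlong_yFlow_mollify φ hC
  contY := by
    rw [hf.derivY_mollify φ hC]
    exact continuous_mollify φ hf.contY hC.abs_y_le

theorem intrinsicBound_mollify (hf : IntrinsicC2 hp B f) (hC : IntrinsicBound hp B C f) :
    IntrinsicBound hp B C (mollify B φ f) where
  abs_le := abs_mollify_le φ hC.abs_le
  abs_dx_le i := by
    rw [hf.derivDx_mollify φ hC]
    exact abs_mollify_le φ (hC.abs_dx_le i)
  abs_dxx_le i j := by
    rw [hf.derivDx_derivDx_mollify φ hC]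
    exact abs_mollify_le φ (hC.abs_dxx_le i j)
  abs_y_le := by
    rw [hf.derivY_mollify φ hC]
    exact abs_mollify_le φ hC.abs_y_le

theorem tendsto_opL_mollify {ι : Type*} {l : Filter ι} {φ : ι → ContDiffBump (0 : Euc d)}
    (hφ : Tendsto (fun n => (φ n).rOut) l (𝓝 0)) (hf : IntrinsicC2 hp B f)
    (hC : IntrinsicBound hp B C f) (a : Fin p₀ → Fin p₀ → ℝ × Euc d → ℝ)
    (b : Fin p₀ → ℝ × Euc d → ℝ) (z : ℝ × Euc d) :
    Tendsto (fun n => opL hp B a b (mollify B (φ n) f) z) l (𝓝 (opL hp B a b f z)) := by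
  simp only [opL, hf.derivDx_mollify _ hC, hf.derivY_mollify _ hC,
    (hf.hasDerivAlong_dxFlow_mollify_derivDx _ hC _ _).derivDx_eq]
  exact (((tendsto_finsetSum _ fun i _ => tendsto_finsetSum _ fun j _ =>
    (tendsto_mollify hφ (hf.contDxx i j) z).const_mul _).const_mul _).add
    (tendsto_finsetSum _ fun i _ => (tendsto_mollify hφ (hf.contDx i) z).const_mul _)).add
    (tendsto_mollify hφ hf.contY z)

end IntrinsicC2

end Mollify

theorem exists_contDiffBump_seq (E : Type*) [NormedAddCommGroup E] [NormedSpace ℝ E] {ρ : ℝ}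
    (hρ : 0 < ρ) : ∃ φ : ℕ → ContDiffBump (0 : E), (∀ n, (φ n).rOut ≤ ρ) ∧
      Tendsto (fun n => (φ n).rOut) atTop (𝓝 0) :=
  ⟨fun n => ⟨ρ / (n + 1) / 2, ρ / (n + 1), by positivity, half_lt_self (by positivity)⟩,
    fun n => div_le_self hρ.le (by simp),
    ((tendsto_const_div_atTop_nhds_zero_nat ρ).comp (tendsto_add_atTop_nat 1)).congr fun n => by
      simp⟩

theorem IntrinsicC2.exists_contDiff_seq (hf : IntrinsicC2 hp B f) {Q : Set (ℝ × Euc d)}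
    (hQ : IsOpen Q) (hK : IsCompact K) (hKQ : K ⊆ Q) (hf0 : ∀ z ∉ K, f z = 0) :
    ∃ (g : ℕ → ℝ × Euc d → ℝ) (K' : Set (ℝ × Euc d)) (C : ℝ), IsCompact K' ∧ K' ⊆ Q ∧
      (∀ n, IntrinsicC2 hp B (g n) ∧ IntrinsicBound hp B C (g n) ∧ (∀ z ∉ K', g n z = 0) ∧
        ∀ s, ContDiff ℝ 2 fun x => g n (s, x)) ∧
      (∀ z, Tendsto (fun n => g n z) atTop (𝓝 (f z))) ∧
      ∀ a b z, Tendsto (fun n => opL hp B a b (g n) z) atTop (𝓝 (opL hp B a b f z)) := by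
  obtain ⟨C, hC⟩ := hf.exists_intrinsicBound hK hf0
  obtain ⟨ρ, hρ, K', hK', hK'Q, off_K'⟩ := exists_compact_leftShift (B := B) hQ hK hKQ
  obtain ⟨φ, φ_le, hφ⟩ := exists_contDiffBump_seq (Euc d) hρ
  exact ⟨fun n => mollify B (φ n) f, K', C, hK', hK'Q, fun n => ⟨hf.intrinsicC2_mollify (φ n) hC,
    hf.intrinsicBound_mollify (φ n) hC,
    fun z hz => mollify_eq_zero (φ n) fun y hy => hf0 _ (off_K' z hz y (hy.trans (φ_le n))),
    fun s => contDiff_mollify (φ n) hf.cont s 2⟩, tendsto_mollify hφ hf.cont,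
    hf.tendsto_opL_mollify hφ hC⟩

theorem IsMarkovUnder.dynkin (h : IsMarkovUnder P F Z M.p t T₀) (ht : 0 ≤ t)
    (hM : IsLocalDiffusion hp M D B a b) (hD : IsOpen D) (hK : IsCompact K)
    (hKD : K ⊆ Ioo 0 T₀ ×ˢ D) (hf : IntrinsicC2 hp B f) (hf0 : ∀ z ∉ K, f z = 0) :
    IsDynkinPair P F Z t T₀ f (opL hp B a b f) := by
  intro r hr T hT hrT W hW
  have hW' := hW.mono (h.le r hr)
  obtain ⟨g, K', C, hK', hK'D, hg, g_tendsto, L_tendsto⟩ :=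
    hf.exists_contDiff_seq (isOpen_Ioo.prod hD) hK hKD hf0
  choose hgi hgC hg0 hgx using hg
  obtain ⟨CL, hCL⟩ := exists_bound_opL (hp := hp) (B := B) hM.locBounded_a hM.locBounded_b
    hK' hK'D C
  have L_le n := hCL (g n) (hg0 n) (hgC n)
  have L_bdd n := (hgi n).boundedMeasurable_opL hD hK' hK'D hM.locBounded_a (hg0 n) hM.locBounded_b
  have g_meas n (s) (hs : s ∈ Ico t T₀) : Measurable fun ω => g n (s, Z s ω) :=
    (hgi n).cont.measurable.comp (measurable_const.prodMk (h.measurable hs))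
  have lim_increment : Tendsto (fun n => ∫ ω, W ω * (g n (T, Z T ω) - g n (r, Z r ω)) ∂P) atTop
      (𝓝 (∫ ω, W ω * (f (T, Z T ω) - f (r, Z r ω)) ∂P)) :=
    tendsto_integral_mul_of_bounded hW' (fun n => (g_meas n T hT).sub (g_meas n r hr))
      (fun n ω => (abs_sub _ _).trans (add_le_add ((hgC n).abs_le _) ((hgC n).abs_le _)))
      fun ω => (g_tendsto _).sub (g_tendsto _)
  have lim_integral : Tendsto
      (fun n => ∫ ω, W ω * (∫ u in r..T, opL hp B a b (g n) (u, Z u ω)) ∂P) atTop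
      (𝓝 (∫ ω, W ω * (∫ u in r..T, opL hp B a b f (u, Z u ω)) ∂P)) :=
    tendsto_integral_mul_of_bounded hW'
      (fun n => ((h.boundedMeasurable_integral hT (L_bdd n) hr.1 hrT).mono (h.le T hT)).1)
      (fun n ω => intervalIntegral.norm_integral_le_of_norm_le_const
        (f := fun u => opL hp B a b (g n) (u, Z u ω)) fun u _ => L_le n _)
      fun ω => intervalIntegral.tendsto_integral_filter_of_dominated_convergence (fun _ => CL)
        (Eventually.of_forall fun n =>
          (h.intervalIntegrable hT (L_bdd n) hr.1 hrT ω).def'.aestronglyMeasurable)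
        (Eventually.of_forall fun n => ae_of_all _ fun u _ => L_le n _)
        intervalIntegrable_const (ae_of_all _ fun u _ => L_tendsto a b _)
  exact tendsto_nhds_unique lim_increment (lim_integral.congr fun n =>
    (h.dynkin_of_contDiff ht hM hD hK' hK'D (hgi n) (hg0 n) (hgx n) r hr T hT hrT W hW).symm)

end DynkinFormula

/-! ### The martingale and its second moment -/

theorem integral_mul_integral_tail {ℓ : ℝ → ℝ} {t T : ℝ}
    (hℓ : IntervalIntegrable ℓ volume t T) :
    ∫ u in t..T, ℓ u * (∫ v in u..T, ℓ v) = (∫ u in t..T, ℓ u) ^ 2 / 2 := by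
  have primitive_ac := hℓ.absolutelyContinuousOnInterval_intervalIntegral (c := T) right_mem_uIcc
  have by_parts := primitive_ac.integral_deriv_mul_eq_sub primitive_ac
  calc ∫ u in t..T, ℓ u * (∫ v in u..T, ℓ v)
      = ∫ u in t..T, (-1 / 2) * (deriv (fun x => ∫ v in T..x, ℓ v) u * (∫ v in T..u, ℓ v)
          + (∫ v in T..u, ℓ v) * deriv (fun x => ∫ v in T..x, ℓ v) u) := by
        refine intervalIntegral.integral_congr_ae ?_
        filter_upwards [hℓ.ae_hasDerivAt_integral] with u hderiv hu
        rw [(hderiv (uIoc_subset_uIcc hu) T right_mem_uIcc).deriv,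
          intervalIntegral.integral_symm T u]
        ring
    _ = (∫ u in t..T, ℓ u) ^ 2 / 2 := by
        rw [intervalIntegral.integral_const_mul, by_parts, intervalIntegral.integral_same,
          intervalIntegral.integral_symm t T]
        ring

section SquaredIntegral

variable {Ω : Type*} {mΩ : MeasurableSpace Ω} {P : Measure Ω} {ℓ : ℝ → Ω → ℝ}

namespace BoundedMeasurable

theorem intervalIntegrable_path (hℓ : BoundedMeasurable (Function.uncurry ℓ)) (ω : Ω) (t T : ℝ) :
    IntervalIntegrable (fun u => ℓ u ω) volume t T := by
  have : IsFiniteMeasure (volume.restrict (uIoc t T)) := ⟨by simp⟩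
  have path : BoundedMeasurable fun u => ℓ u ω := hℓ.comp measurable_prodMk_right
  exact intervalIntegrable_iff.2 path.integrable

theorem measurable_integral_tail (hℓ : BoundedMeasurable (Function.uncurry ℓ)) (T : ℝ) :
    Measurable (Function.uncurry fun u ω => ∫ v in u..T, ℓ v ω) := by
  refine measurable_uncurry_of_continuous_of_measurable (fun ω => ?_) fun u => ?_
  · simp only [intervalIntegral.integral_symm T]
    exact (intervalIntegral.continuous_primitive (hℓ.intervalIntegrable_path ω) T).neg
  · have := hℓ.1.stronglyMeasurable
    exact (this.integral_prod_left'.sub this.integral_prod_left').measurable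

theorem integrable_mul_integral_tail [IsFiniteMeasure P]
    (hℓ : BoundedMeasurable (Function.uncurry ℓ)) (t T : ℝ) :
    Integrable (Function.uncurry fun u ω => ℓ u ω * (∫ v in u..T, ℓ v ω))
      ((volume.restrict (uIoc t T)).prod P) := by
  obtain ⟨C, hC⟩ := hℓ.2
  have dominating : Continuous fun u => C * (C * |T - u|) := by fun_prop
  refine (dominating.integrableOn_uIoc.comp_fst P).mono'
    (hℓ.1.mul (hℓ.measurable_integral_tail T)).aestronglyMeasurable (ae_of_all _ fun q => ?_)
  exact (norm_mul _ _).trans_le <| mul_le_mul (hC q)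
    (intervalIntegral.norm_integral_le_of_norm_le_const fun v _ => hC (v, q.2)) (norm_nonneg _)
    ((abs_nonneg _).trans (hC q))

theorem integral_sq_intervalIntegral [IsFiniteMeasure P]
    (hℓ : BoundedMeasurable (Function.uncurry ℓ)) (t T : ℝ) :
    ∫ ω, (∫ u in t..T, ℓ u ω) ^ 2 ∂P =
      2 * ∫ u in t..T, ∫ ω, ℓ u ω * (∫ v in u..T, ℓ v ω) ∂P := by
  rw [intervalIntegral_integral_swap (hℓ.integrable_mul_integral_tail t T), ← integral_const_mul]
  simp only [integral_mul_integral_tail (hℓ.intervalIntegrable_path _ t T)]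
  ring_nf

end BoundedMeasurable

end SquaredIntegral

section Martingale

variable {Ω E : Type*} {mΩ : MeasurableSpace Ω} [MeasurableSpace E] [TopologicalSpace E]
  {P : Measure Ω} {F : ℝ → MeasurableSpace Ω} {Z : ℝ → Ω → E}
  {p : ℝ → ℝ → Kernel E E} {t T₀ r T : ℝ} {W : Ω → ℝ} {f L Γ : ℝ × E → ℝ}

/-- The process `f(T, Z_T) - f(t, Z_t) - ∫_t^T L(u, Z_u) du`, which is a martingale when `f` and `L`
satisfy Dynkin's formula. -/
noncomputable def dynkinRemainder (Z : ℝ → Ω → E) (t : ℝ) (f L : ℝ × E → ℝ) (T : ℝ) (ω : Ω) : ℝ :=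
  f (T, Z T ω) - f (t, Z t ω) - ∫ u in t..T, L (u, Z u ω)

variable [BorelSpace E]

theorem IsMarkovUnder.dynkinRemainder_eq_add (h : IsMarkovUnder P F Z p t T₀)
    (hL : BoundedMeasurable L) (hr : r ∈ Ico t T₀) (hT : T ∈ Ico t T₀) (hrT : r ≤ T) (ω : Ω) :
    dynkinRemainder Z t f L T ω = dynkinRemainder Z t f L r ω +
      (f (T, Z T ω) - f (r, Z r ω) - ∫ u in r..T, L (u, Z u ω)) := by
  have split := intervalIntegral.integral_add_adjacent_intervals
    (h.intervalIntegrable hr hL le_rfl hr.1 ω) (h.intervalIntegrable hT hL hr.1 hrT ω)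
  rw [dynkinRemainder, dynkinRemainder, ← split]
  ring

variable [TopologicalSpace.PseudoMetrizableSpace E]

theorem IsMarkovUnder.boundedMeasurable_dynkinRemainder (h : IsMarkovUnder P F Z p t T₀)
    (hf : BoundedMeasurable f) (hL : BoundedMeasurable L) (hT : T ∈ Ico t T₀) :
    BoundedMeasurable (m := F T) (dynkinRemainder Z t f L T) :=
  have ht : t ∈ Ico t T₀ := ⟨le_rfl, hT.1.trans_lt hT.2⟩
  ((h.boundedMeasurable_path hT hf).sub
    ((h.boundedMeasurable_path ht hf).mono (h.mono t ht T hT hT.1))).sub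
    (h.boundedMeasurable_integral hT hL le_rfl hT.1)

variable [IsProbabilityMeasure P]

theorem IsDynkinPair.integral_mul_dynkinRemainder (hD : IsDynkinPair P F Z t T₀ f L)
    (h : IsMarkovUnder P F Z p t T₀) (hf : BoundedMeasurable f) (hL : BoundedMeasurable L)
    (hr : r ∈ Ico t T₀) (hT : T ∈ Ico t T₀) (hrT : r ≤ T) (hW : BoundedMeasurable (m := F r) W) :
    ∫ ω, W ω * dynkinRemainder Z t f L T ω ∂P = ∫ ω, W ω * dynkinRemainder Z t f L r ω ∂P := by
  have hW' := hW.mono (h.le r hr)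
  have M_bdd := (h.boundedMeasurable_dynkinRemainder hf hL hr).mono (h.le r hr)
  have Δf_bdd := ((h.boundedMeasurable_path hT hf).mono (h.le T hT)).sub
    ((h.boundedMeasurable_path hr hf).mono (h.le r hr))
  have ΔL_bdd := (h.boundedMeasurable_integral hT hL hr.1 hrT).mono (h.le T hT)
  simp only [h.dynkinRemainder_eq_add hL hr hT hrT, mul_add, mul_sub (W _) (_ - _)]
  rw [integral_add (hW'.mul M_bdd).integrable
    ((hW'.mul Δf_bdd).sub (hW'.mul ΔL_bdd)).integrable,
    integral_sub (hW'.mul Δf_bdd).integrable (hW'.mul ΔL_bdd).integrable,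
    hD r hr T hT hrT W hW, sub_self, add_zero]

theorem IsDynkinPair.condExp_dynkinRemainder (hD : IsDynkinPair P F Z t T₀ f L)
    (h : IsMarkovUnder P F Z p t T₀) (hf : BoundedMeasurable f) (hL : BoundedMeasurable L)
    (hr : r ∈ Ico t T₀) (hT : T ∈ Ico t T₀) (hrT : r ≤ T) :
    P[dynkinRemainder Z t f L T | F r] =ᵐ[P] dynkinRemainder Z t f L r := by
  have M_bdd (s) (hs : s ∈ Ico t T₀) := h.boundedMeasurable_dynkinRemainder hf hL hs
  have integrable (s) (hs : s ∈ Ico t T₀) : Integrable (dynkinRemainder Z t f L s) P :=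
    ((M_bdd s hs).mono (h.le s hs)).integrable
  refine (ae_eq_condExp_of_forall_setIntegral_eq (h.le r hr) (integrable T hT)
    (fun S _ _ => (integrable r hr).integrableOn) (fun S hS _ => ?_)
    (M_bdd r hr).1.aestronglyMeasurable).symm
  have weight : BoundedMeasurable (m := F r) (S.indicator (1 : Ω → ℝ)) :=
    ⟨Measurable.indicator (m := F r) measurable_const hS, 1,
      fun ω => by by_cases hω : ω ∈ S <;> simp [hω]⟩
  have as_weight (g : Ω → ℝ) : ∫ ω in S, g ω ∂P = ∫ ω, S.indicator 1 ω * g ω ∂P := by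
    rw [← integral_indicator (h.le r hr S hS)]
    simp only [← indicator_mul_left, Pi.one_apply, one_mul]
  rw [as_weight, as_weight, hD.integral_mul_dynkinRemainder h hf hL hr hT hrT weight]

theorem IsDynkinPair.integral_mul_dynkinRemainder_eq_zero (hD : IsDynkinPair P F Z t T₀ f L)
    (h : IsMarkovUnder P F Z p t T₀) (hf : BoundedMeasurable f) (hL : BoundedMeasurable L)
    (hT : T ∈ Ico t T₀) (hW : BoundedMeasurable (m := F t) W) :
    ∫ ω, W ω * dynkinRemainder Z t f L T ω ∂P = 0 := by
  rw [hD.integral_mul_dynkinRemainder h hf hL ⟨le_rfl, hT.1.trans_lt hT.2⟩ hT hT.1 hW]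
  simp [dynkinRemainder]

theorem IsDynkinPair.integral_dynkinRemainder (hD : IsDynkinPair P F Z t T₀ f L)
    (h : IsMarkovUnder P F Z p t T₀) (hf : BoundedMeasurable f) (hL : BoundedMeasurable L)
    (hT : T ∈ Ico t T₀) : ∫ ω, dynkinRemainder Z t f L T ω ∂P = 0 := by
  simpa using hD.integral_mul_dynkinRemainder_eq_zero h hf hL hT (.const 1)

theorem IsMarkovUnder.integral_sq_integral (h : IsMarkovUnder P F Z p t T₀)
    (hL : BoundedMeasurable L) (hT : T ∈ Ico t T₀) :
    ∫ ω, (∫ u in t..T, L (u, Z u ω)) ^ 2 ∂P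
      = 2 * ∫ u in t..T, ∫ ω, L (u, Z u ω) * (∫ v in u..T, L (v, Z v ω)) ∂P := by
  have ℓ_bdd : BoundedMeasurable (Function.uncurry fun u ω => L (u, clampPath Z t T u ω)) :=
    (h.boundedMeasurable_comp_clampPath hT hL).mono
      (sup_le_sup le_rfl (MeasurableSpace.comap_mono (h.le T hT)))
  simp only [integral_comp_clampPath (Z := Z) (L := L) le_rfl hT.1]
  rw [ℓ_bdd.integral_sq_intervalIntegral]
  congr 1
  refine intervalIntegral.integral_congr fun u hu => ?_
  rw [uIcc_of_le hT.1] at hu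
  simp only [integral_comp_clampPath (Z := Z) (L := L) hu.1 hu.2, clampPath_eq hu]

theorem IsDynkinPair.integral_sq_integral (hD : IsDynkinPair P F Z t T₀ f L)
    (h : IsMarkovUnder P F Z p t T₀) (hf : BoundedMeasurable f) (hL : BoundedMeasurable L)
    (hT : T ∈ Ico t T₀) :
    ∫ ω, (∫ u in t..T, L (u, Z u ω)) ^ 2 ∂P
      = 2 * (∫ ω, f (T, Z T ω) * (∫ u in t..T, L (u, Z u ω)) ∂P
        - ∫ ω, (∫ u in t..T, f (u, Z u ω) * L (u, Z u ω)) ∂P) := by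
  have fT_bdd := (h.boundedMeasurable_path hT hf).mono (h.le T hT)
  have fL_bdd := hf.mul hL
  have integrable_fT := h.intervalIntegrable_integral hT hL fT_bdd le_rfl hT.1
  have integrable_fL := h.intervalIntegrable_integral hT fL_bdd (.const 1) le_rfl hT.1
  have swap_fT := h.integral_swap hT hL fT_bdd le_rfl hT.1
  have swap_fL := h.integral_swap hT fL_bdd (.const 1) le_rfl hT.1
  simp only [one_mul] at swap_fL integrable_fL
  rw [h.integral_sq_integral hL hT, ← swap_fT, ← swap_fL,
    ← intervalIntegral.integral_sub integrable_fT integrable_fL]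
  congr 1
  refine intervalIntegral.integral_congr fun u hu => ?_
  rw [uIcc_of_le hT.1] at hu
  have hu' : u ∈ Ico t T₀ := ⟨hu.1, hu.2.trans_lt hT.2⟩
  have Lu_bdd := h.boundedMeasurable_path hu' hL
  have Lu_bdd' := Lu_bdd.mono (h.le u hu')
  have fu_bdd := (h.boundedMeasurable_path hu' hf).mono (h.le u hu')
  rw [← hD u hu' T hT hu.2 _ Lu_bdd,
    ← integral_sub (fT_bdd.mul Lu_bdd').integrable (fu_bdd.mul Lu_bdd').integrable]
  exact integral_congr_ae (ae_of_all _ fun ω => by ring)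

theorem IsDynkinPair.integral_sq_sub_sq
    (hD2 : IsDynkinPair P F Z t T₀ (fun z => f z * f z) fun z => 2 * (f z * L z) + Γ z)
    (h : IsMarkovUnder P F Z p t T₀) (hf : BoundedMeasurable f) (hL : BoundedMeasurable L)
    (hΓ : BoundedMeasurable Γ) (hT : T ∈ Ico t T₀) :
    ∫ ω, (f (T, Z T ω) * f (T, Z T ω) - f (t, Z t ω) * f (t, Z t ω)) ∂P =
      2 * ∫ ω, (∫ u in t..T, f (u, Z u ω) * L (u, Z u ω)) ∂P +
        ∫ ω, (∫ u in t..T, Γ (u, Z u ω)) ∂P := by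
  have integral_bdd {g} (hg : BoundedMeasurable g) :=
    (h.boundedMeasurable_integral (L := g) hT hg le_rfl hT.1).mono (h.le T hT)
  have split (ω) : (∫ u in t..T, (2 * (f (u, Z u ω) * L (u, Z u ω)) + Γ (u, Z u ω))) =
      2 * (∫ u in t..T, f (u, Z u ω) * L (u, Z u ω)) + ∫ u in t..T, Γ (u, Z u ω) := by
    rw [intervalIntegral.integral_add _ (h.intervalIntegrable hT hΓ le_rfl hT.1 ω),
      intervalIntegral.integral_const_mul]
    exact (h.intervalIntegrable hT (hf.mul hL) le_rfl hT.1 ω).const_mul 2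
  have dynkin_sq := hD2 t ⟨le_rfl, hT.1.trans_lt hT.2⟩ T hT hT.1 (fun _ => 1) (.const 1)
  simp only [one_mul, split] at dynkin_sq
  rw [dynkin_sq, integral_add ((integral_bdd (hf.mul hL)).integrable.const_mul 2)
    (integral_bdd hΓ).integrable, integral_const_mul]

theorem IsDynkinPair.integral_sq_dynkinRemainder (hD : IsDynkinPair P F Z t T₀ f L)
    (hD2 : IsDynkinPair P F Z t T₀ (fun z => f z * f z) fun z => 2 * (f z * L z) + Γ z)
    (h : IsMarkovUnder P F Z p t T₀) (hf : BoundedMeasurable f) (hL : BoundedMeasurable L)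
    (hΓ : BoundedMeasurable Γ) (hT : T ∈ Ico t T₀) :
    ∫ ω, dynkinRemainder Z t f L T ω ^ 2 ∂P = ∫ ω, (∫ u in t..T, Γ (u, Z u ω)) ∂P := by
  have ht : t ∈ Ico t T₀ := ⟨le_rfl, hT.1.trans_lt hT.2⟩
  set x : Ω → ℝ := fun ω => f (t, Z t ω)
  set y : Ω → ℝ := fun ω => f (T, Z T ω)
  set A : Ω → ℝ := fun ω => ∫ u in t..T, L (u, Z u ω)
  set Q : Ω → ℝ := fun ω => ∫ u in t..T, f (u, Z u ω) * L (u, Z u ω)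
  set G : Ω → ℝ := fun ω => ∫ u in t..T, Γ (u, Z u ω)
  set R : Ω → ℝ := dynkinRemainder Z t f L T
  have x_bdd : BoundedMeasurable x := (h.boundedMeasurable_path ht hf).mono (h.le t ht)
  have y_bdd : BoundedMeasurable y := (h.boundedMeasurable_path hT hf).mono (h.le T hT)
  have R_bdd : BoundedMeasurable R :=
    (h.boundedMeasurable_dynkinRemainder hf hL hT).mono (h.le T hT)
  have xR : ∫ ω, x ω * R ω ∂P = 0 :=
    hD.integral_mul_dynkinRemainder_eq_zero h hf hL hT (h.boundedMeasurable_path ht hf)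
  have AA : ∫ ω, A ω ^ 2 ∂P = 2 * (∫ ω, y ω * A ω ∂P - ∫ ω, Q ω ∂P) :=
    hD.integral_sq_integral h hf hL hT
  have yyxx : ∫ ω, (y ω * y ω - x ω * x ω) ∂P = 2 * ∫ ω, Q ω ∂P + ∫ ω, G ω ∂P :=
    hD2.integral_sq_sub_sq h hf hL hΓ hT
  have A_bdd : BoundedMeasurable A :=
    (h.boundedMeasurable_integral hT hL le_rfl hT.1).mono (h.le T hT)
  have AA_bdd := A_bdd.mul A_bdd
  have yA_bdd := (BoundedMeasurable.const 2).mul (y_bdd.mul A_bdd)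
  have xR_bdd := (BoundedMeasurable.const 2).mul (x_bdd.mul R_bdd)
  have yyxx_bdd := (y_bdd.mul y_bdd).sub (x_bdd.mul x_bdd)
  calc ∫ ω, R ω ^ 2 ∂P
      = ∫ ω, ((y ω * y ω - x ω * x ω - 2 * (x ω * R ω)) + (A ω * A ω - 2 * (y ω * A ω))) ∂P :=
        integral_congr_ae (ae_of_all _ fun ω => by
          simp only [R, dynkinRemainder, y, x, A]
          ring)
    _ = ∫ ω, (y ω * y ω - x ω * x ω) ∂P - 2 * ∫ ω, x ω * R ω ∂P
          + (∫ ω, A ω ^ 2 ∂P - 2 * ∫ ω, y ω * A ω ∂P) := by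
        rw [integral_add (yyxx_bdd.sub xR_bdd).integrable (AA_bdd.sub yA_bdd).integrable,
          integral_sub yyxx_bdd.integrable xR_bdd.integrable,
          integral_sub AA_bdd.integrable yA_bdd.integrable, integral_const_mul, integral_const_mul]
        simp only [sq]
    _ = ∫ ω, G ω ∂P := by
        rw [yyxx, xR, AA]
        ring

end Martingale

theorem ContMarkovProcess.isMarkovUnder {d : ℕ} {T₀ : ℝ} {Ω : Type*} (M : ContMarkovProcess d T₀ Ω)
    {t : ℝ} (ht : 0 ≤ t) (x : Euc d) :
    IsMarkovUnder (M.P t x) (M.F t) M.X M.p t T₀ where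
  le s hs := (M.filtration t ht).le' ⟨s, hs⟩
  mono s hs T hT hsT := M.mono t t s T ht le_rfl hs.1 hsT hT.2
  adapted s hs := M.adapted t s ht hs.1 hs.2
  cont ω := (M.continuous_paths ω).mono (Ico_subset_Ico_left ht)
  kernel s T hs hsT hT := M.isMarkovKernel s T (ht.trans hs) hsT hT
  markov s T hs hsT hT A hA := M.markov t x s T ht hs hsT hT A hA

theorem theorem1p1_general {p₀ d : ℕ} (hp : p₀ ≤ d) {T₀ : ℝ} {Ω : Type*}
    (X : ContMarkovProcess d T₀ Ω) (D : Set (Euc d)) (hDo : IsOpen D)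
    (B : Matrix (Fin d) (Fin d) ℝ)
    (a : Fin p₀ → Fin p₀ → ℝ × Euc d → ℝ) (b : Fin p₀ → ℝ × Euc d → ℝ)
    (hX : IsLocalDiffusion hp X D B a b) (t : ℝ) (ht : 0 ≤ t) (htT : t < T₀) (x : Euc d)
    (f : ℝ × Euc d → ℝ) (hf : IntrinsicC2 hp B f)
    (hfc : HasCompactSupport f) (hfs : tsupport f ⊆ Set.Ioo 0 T₀ ×ˢ D) :
    (∀ ω, ∀ T ∈ Set.Ico t T₀,
      IntervalIntegrable (fun u => opL hp B a b f (u, X.X u ω)) volume t T ∧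
      IntervalIntegrable (fun u => energyDensity hp a f (u, X.X u ω)) volume t T) ∧
    Martingale (fun (T : Set.Ico t T₀) => itoRemainder hp X B a b f t T)
      (X.filtration t ht) (X.P t x) ∧
    ∀ T ∈ Set.Ico t T₀,
      ∫ ω, itoRemainder hp X B a b f t T ω ∂(X.P t x) = 0 ∧
      MemLp (itoRemainder hp X B a b f t T) 2 (X.P t x) ∧
      Integrable (fun ω => ∫ s in t..T, energyDensity hp a f (s, X.X s ω)) (X.P t x) ∧
      ∫ ω, |itoRemainder hp X B a b f t T ω| ^ 2 ∂(X.P t x) =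
        ∫ ω, (∫ s in t..T, energyDensity hp a f (s, X.X s ω)) ∂(X.P t x) := by
  have := X.isProbability t x ht htT
  have markov := X.isMarkovUnder ht x
  have zero_f (z) (hz : z ∉ tsupport f) : f z = 0 := image_eq_zero_of_notMem_tsupport hz
  have zero_ff (z) (hz : z ∉ tsupport f) : f z * f z = 0 := by rw [zero_f z hz, zero_mul]
  have f_bdd := boundedMeasurable_of_zero_off hfc hf.cont zero_f
  have L_bdd := hf.boundedMeasurable_opL hDo hfc hfs hX.locBounded_a zero_f hX.locBounded_b
  have Γ_bdd := hf.boundedMeasurable_energyDensity hDo hfc hfs hX.locBounded_a zero_f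
  have dynkin := markov.dynkin ht hX hDo hfc hfs hf zero_f
  have dynkin_sq := markov.dynkin ht hX hDo hfc hfs hf.mul_self zero_ff
  rw [funext (hf.opL_mul_self a b)] at dynkin_sq
  have M_bdd (T) (hT : T ∈ Ico t T₀) : BoundedMeasurable (m := X.F t T)
      (itoRemainder hp X B a b f t T) := markov.boundedMeasurable_dynkinRemainder f_bdd L_bdd hT
  refine ⟨fun ω T hT => ⟨markov.intervalIntegrable hT L_bdd le_rfl hT.1 ω,
    markov.intervalIntegrable hT Γ_bdd le_rfl hT.1 ω⟩,
    ⟨fun T => (M_bdd T T.2).1.stronglyMeasurable,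
      fun r T hrT => dynkin.condExp_dynkinRemainder markov f_bdd L_bdd r.2 T.2 hrT⟩,
    fun T hT => ⟨dynkin.integral_dynkinRemainder markov f_bdd L_bdd hT,
      ((M_bdd T hT).mono (markov.le T hT)).memLp 2,
      ((markov.boundedMeasurable_integral hT Γ_bdd le_rfl hT.1).mono (markov.le T hT)).integrable,
      ?_⟩⟩
  simp only [sq_abs]
  exact dynkin.integral_sq_dynkinRemainder dynkin_sq markov f_bdd L_bdd Γ_bdd hT

theorem theorem1p1 {p₀ d : ℕ} (hp : p₀ ≤ d) {T₀ : ℝ} (hT₀ : 0 < T₀) {Ω : Type*}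
    (X : ContMarkovProcess d T₀ Ω) (D : Set (Euc d)) (hDo : IsOpen D) (hDc : IsConnected D)
    (B : Matrix (Fin d) (Fin d) ℝ)
    (a : Fin p₀ → Fin p₀ → ℝ × Euc d → ℝ) (b : Fin p₀ → ℝ × Euc d → ℝ)
    (hX : IsLocalDiffusion hp X D B a b) (hB : HormanderCondition hp B)
    (t : ℝ) (ht : 0 < t) (htT : t < T₀) (x : Euc d) (α : ℝ) (hα : 0 < α) (hα1 : α ≤ 1)
    (f : ℝ × Euc d → ℝ) (hf : IntrinsicHolder hp B (Set.Ioo 0 T₀ ×ˢ D) α 2 f)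
    (hfc : HasCompactSupport f) (hfs : tsupport f ⊆ Set.Ioo 0 T₀ ×ˢ D) :
    (∀ ω, ∀ T ∈ Set.Ico t T₀,
      IntervalIntegrable (fun u => opL hp B a b f (u, X.X u ω)) volume t T ∧
      IntervalIntegrable (fun u => energyDensity hp a f (u, X.X u ω)) volume t T) ∧
    Martingale (fun (T : Set.Ico t T₀) => itoRemainder hp X B a b f t T)
      (X.filtration t ht.le) (X.P t x) ∧
    ∀ T ∈ Set.Ico t T₀,
      ∫ ω, itoRemainder hp X B a b f t T ω ∂(X.P t x) = 0 ∧
      MemLp (itoRemainder hp X B a b f t T) 2 (X.P t x) ∧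
      Integrable (fun ω => ∫ s in t..T, energyDensity hp a f (s, X.X s ω)) (X.P t x) ∧
      ∫ ω, |itoRemainder hp X B a b f t T ω| ^ 2 ∂(X.P t x) =
        ∫ ω, (∫ s in t..T, energyDensity hp a f (s, X.X s ω)) ∂(X.P t x) :=
  theorem1p1_general hp X D hDo B a b hX t ht.le htT x f
    (hf.intrinsicC2 hB (isOpen_Ioo.prod hDo) hα hfc hfs) hfc hfs
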